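/- Let $\varepsilon,\mu,\tilde\varepsilon,\tilde\mu:\mathbb R\to\mathbb R$ be piecewise continuous and periodic with period $1$, with $\varepsilon\ge c$ and $\mu\ge c$ for some constant $c>0$. For real $\delta$ put $\varepsilon_\delta=\varepsilon+\delta\tilde\varepsilon$, $\mu_\delta=\mu+\delta\tilde\mu$ and $$\mathcal L_\delta\psi=-\frac1{\varepsilon_\delta}\Big(\frac1{\mu_\delta}\psi'\Big)' .$$ For $|\delta|$ small and $k\in\mathbb R$ let $E_{1,\delta}(k)\le E_{2,\delta}(k)\le\cdots$ be the eigenvalues, counted with multiplicity, of the problem $\mathcal L_\delta\psi=E\psi$, $\psi(x+1)=e^{ik}\psi(x)$, where $\psi$ and $\psi'/\mu_\delta$ are locally absolutely continuous, and let $E_{j,\delta}^-$ and $E_{j,\delta}^+$ be the minimum and the maximum of $E_{j,\delta}(k)$ over $k\in[-\pi,\pi]$. Let $\psi_{E,1,\delta},\psi_{E,2,\delta}$ be the solutions of $\mathcal L_\delta\psi=E\psi$, i.e. of the system $\psi'=\mu_\delta\varphi$, $\varphi'=-E\varepsilon_\delta\psi$ for $(\psi,\varphi)=(\psi,\psi'/\mu_\delta)$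 (which makes sense for all real $E$ and $\delta$), with $(\psi,\psi'/\mu_\delta)(0)=(1,0)$ and $(0,1)$ respectively, and let $$D(E,\delta)=\psi_{E,1,\delta}(1)+\frac1{\mu_\delta(1)}\psi_{E,2,\delta}'(1)$$ be the discriminant (the trace of the transfer matrix over one period), where the second term is the value of the flux $\psi_{E,2,\delta}'/\mu_\delta$ at $1$. Assume that for $\delta=0$ the bands $j$ and $j+1$ ($j\ge1$) cross at a Dirac point $(0,E^*)$: that is, $E_{j,0}(0)=E_{j+1,0}(0)=E^*$, there is $\alpha>0$ such that $E_{j,0}(k)=E^*-\alpha|k|+O(k^2)$ and $E_{j+1,0}(k)=E^*+\alpha|k|+O(k^2)$ near $k=0$, and the eigenvalue $E^*$ of the problem with $k=0$, $\delta=0$ has multiplicity two. Put $$a_1=\frac{\partial^2D}{\partial E^2}(E^*,0),\qquad a_2=\frac{\partial^2D}{\partial E\,\partial\delta}(E^*,0),\qquad a_3=\frac{\partial^2D}{\partial\delta^2}(E^*,0),$$ and assume $a_2^2-a_1a_3>0$. Then for all sufficiently small $\delta>0$ there is a band gap $(E_{j,\delta}^+,E_{j+1,\delta}^-)$ between the $j$-th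 and the $(j+1)$-th band of $\mathcal L_\delta$: one has $E_{j,\delta}^+<E_{j+1,\delta}^-$, and no $E$ in this interval is an eigenvalue of the above problem for any $k\in[-\pi,\pi]$. Moreover, as $\delta\to0^+$, $$E_{j,\delta}^+=E_{j,\delta}(0)=E^*+\eta^-\delta+O(\delta^2),\qquad E_{j+1,\delta}^-=E_{j+1,\delta}(0)=E^*+\eta^+\delta+O(\delta^2),$$ where $$\eta^-=\frac{-a_2+\sqrt{a_2^2-a_1a_3}}{a_1},\qquad \eta^+=\frac{-a_2-\sqrt{a_2^2-a_1a_3}}{a_1}.$$ -/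

import Mathlib

open Set Filter Topology MeasureTheory

/-- Piecewise continuous functions of period one: finitely many discontinuities in a period,
and finite one-sided limits everywhere. -/
structure IsPiecewiseContPeriodic (f : ℝ → ℝ) : Prop where
  periodic : Function.Periodic f 1
  finite_discont : {x ∈ Icc (0 : ℝ) 1 | ¬ ContinuousAt f x}.Finite
  left_lim : ∀ x, ∃ l, Tendsto f (𝓝[<] x) (𝓝 l)
  right_lim : ∀ x, ∃ l, Tendsto f (𝓝[>] x) (𝓝 l)

/-- `ψ` solves `-(1/ε) ((1/μ) ψ')' = E ψ` on the line, with flux `φ = (1/μ) ψ'`. That is, `ψ` and `φ`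
are locally absolutely continuous, `ψ' = μ φ` and `φ' = -E ε ψ` almost everywhere
(written in integrated form). -/
structure IsSolution {F : Type*} [NormedAddCommGroup F] [NormedSpace ℝ F]
    (ε μ : ℝ → ℝ) (E : ℝ) (ψ φ : ℝ → F) : Prop where
  integrable_flux : ∀ x, IntervalIntegrable (fun t => μ t • φ t) volume 0 x
  integrable_mode : ∀ x, IntervalIntegrable (fun t => (E * ε t) • ψ t) volume 0 x
  mode_eq : ∀ x, ψ x = ψ 0 + ∫ t in (0 : ℝ)..x, μ t • φ t
  flux_eq : ∀ x, φ x = φ 0 - ∫ t in (0 : ℝ)..x, (E * ε t) • ψ t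

/-- The pair (mode, flux) of the real solution with `ψ 0 = a` and `(1/μ) ψ' (0) = b`.
For bounded measurable `ε` and `μ` there is exactly one such pair. -/
noncomputable def cauchySolution (ε μ : ℝ → ℝ) (E a b : ℝ) : (ℝ → ℝ) × (ℝ → ℝ) :=
  Classical.epsilon fun p => IsSolution ε μ E p.1 p.2 ∧ p.1 0 = a ∧ p.2 0 = b

/-- The transfer matrix `Ψ_E (x)`; its columns are the two normalized solutions with their
fluxes. -/
noncomputable def transferMatrix (ε μ : ℝ → ℝ) (E x : ℝ) : Matrix (Fin 2) (Fin 2) ℝ :=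
  !![(cauchySolution ε μ E 1 0).1 x, (cauchySolution ε μ E 0 1).1 x;
     (cauchySolution ε μ E 1 0).2 x, (cauchySolution ε μ E 0 1).2 x]

/-- The discriminant, the trace of the monodromy matrix. -/
noncomputable def discriminant (ε μ : ℝ → ℝ) (E : ℝ) : ℝ :=
  (transferMatrix ε μ E 1).trace

/-- The space of Bloch modes at `(k, E)`: complex solutions with
`ψ (x + 1) = exp (i k) ψ x`. -/
def blochSpace (ε μ : ℝ → ℝ) (k E : ℝ) : Submodule ℂ (ℝ → ℂ) where
  carrier := {ψ | (∃ φ : ℝ → ℂ, IsSolution ε μ E ψ φ) ∧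
    ∀ x, ψ (x + 1) = Complex.exp (Complex.I * k) * ψ x}
  zero_mem' := by
    refine ⟨⟨0, ?_, ?_, ?_, ?_⟩, ?_⟩ <;> simp
  add_mem' := by
    rintro ψ₁ ψ₂ ⟨⟨φ₁, h₁⟩, p₁⟩ ⟨⟨φ₂, h₂⟩, p₂⟩
    refine ⟨⟨φ₁ + φ₂, ?_, ?_, ?_, ?_⟩, ?_⟩
    · intro x
      simpa [smul_add] using (h₁.integrable_flux x).add (h₂.integrable_flux x)
    · intro x
      simpa only [Pi.add_apply, smul_add] using
        (h₁.integrable_mode x).add (h₂.integrable_mode x)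
    · intro x
      simp only [Pi.add_apply, smul_add]
      rw [intervalIntegral.integral_add (h₁.integrable_flux x) (h₂.integrable_flux x),
        h₁.mode_eq x, h₂.mode_eq x]
      ring
    · intro x
      simp only [Pi.add_apply, smul_add]
      rw [intervalIntegral.integral_add (h₁.integrable_mode x) (h₂.integrable_mode x),
        h₁.flux_eq x, h₂.flux_eq x]
      ring
    · intro x
      simp only [Pi.add_apply, p₁ x, p₂ x]
      ring
  smul_mem' := by
    rintro c ψ ⟨⟨φ, h⟩, p⟩
    refine ⟨⟨c • φ, ?_, ?_, ?_, ?_⟩, ?_⟩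
    · intro x
      simpa only [Pi.smul_apply, Pi.smul_def, smul_comm _ c] using (h.integrable_flux x).smul c
    · intro x
      simpa only [Pi.smul_apply, Pi.smul_def, smul_comm _ c] using (h.integrable_mode x).smul c
    · intro x
      simp only [Pi.smul_apply, smul_comm _ c]
      rw [intervalIntegral.integral_smul, h.mode_eq x, smul_add]
    · intro x
      simp only [Pi.smul_apply, smul_comm _ c]
      rw [intervalIntegral.integral_smul, h.flux_eq x, smul_sub]
    · intro x
      simp only [Pi.smul_apply, p x, smul_eq_mul]
      ring

/-- The dispersion relation `E_j (k)` for `j ≥ 1`: the `j`-th eigenvalue, in increasing order and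
counted with multiplicity, of the Floquet-Bloch problem at `k`. It is the least `E` such that
the modes with eigenvalue at most `E` span a space of dimension at least `j`. -/
noncomputable def bandFunction (ε μ : ℝ → ℝ) (j : ℕ) (k : ℝ) : ℝ :=
  sInf {E : ℝ | (j : Cardinal) ≤ Module.rank ℂ ↥(⨆ E' ∈ Iic E, blochSpace ε μ k E')}

/-- The `j`-th band: all values of `E_j` on the Brillouin zone. -/
def band (ε μ : ℝ → ℝ) (j : ℕ) : Set ℝ :=
  bandFunction ε μ j '' Icc (-Real.pi) Real.pi

/-- The Floquet-Bloch spectrum: all eigenvalues of the Floquet-Bloch problems. -/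
def blochSpectrum (ε μ : ℝ → ℝ) : Set ℝ :=
  {E | ∃ k ∈ Icc (-Real.pi) Real.pi, blochSpace ε μ k E ≠ ⊥}

/-- `(k₀, E₀)` is a Dirac point at which the bands `j` and `j + 1` cross. -/
structure IsDiracPoint (ε μ : ℝ → ℝ) (j : ℕ) (k₀ E₀ : ℝ) : Prop where
  one_le : 1 ≤ j
  mem_zone : k₀ ∈ Icc (-Real.pi) Real.pi
  lower_eq : bandFunction ε μ j k₀ = E₀
  upper_eq : bandFunction ε μ (j + 1) k₀ = E₀
  conical : ∃ α > 0, ∃ r > 0, ∃ C : ℝ, ∀ k : ℝ, |k - k₀| < r →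
    |bandFunction ε μ j k - (E₀ - α * |k - k₀|)| ≤ C * (k - k₀) ^ 2 ∧
    |bandFunction ε μ (j + 1) k - (E₀ + α * |k - k₀|)| ≤ C * (k - k₀) ^ 2
  multiplicity : Module.finrank ℂ (blochSpace ε μ k₀ E₀) = 2

/-- The discriminant `D(E, δ)` of the perturbed structure `(μ + δ μ₁, ε + δ ε₁)`. -/
noncomputable def perturbedDiscriminant (ε μ ε₁ μ₁ : ℝ → ℝ) (E δ : ℝ) : ℝ :=
  discriminant (ε + δ • ε₁) (μ + δ • μ₁) E

/-! A Bloch mode with quasi-momentum k is an eigenvector of the monodromy matrix M for the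
eigenvalue e^{ik}. Since det M = 1, the energies at k are the solutions of D = 2 cos k, and such an
energy is double exactly when M = ±1, equivalently when D' = 0 there. Energies with |D| > 2 lie in
gaps.

At the Dirac point M = 1. Both first derivatives of D vanish there, by differentiating det M = 1,
and the second one in E is -2 det G < 0, where G is the Gram matrix of the normalized modes. In the
scale E = E₀ + yδ this gives D = 2 + (δ²/2)(a₁y² + 2a₂y + a₃) + O(δ³). The quadratic has real roots
η⁻ < η⁺ and is positive between them, so D > 2 between two energies that are O(δ²) away from E₀ +
η^±δ (`exists_gap_of_indefinite`).

It remains to number this gap. `bandCount` counts the solutions of D = t up to a given energy with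
multiplicity. As D is strictly monotone where |D| < 2 and folds nondegenerately at ±2, the count is
locally constant in t ∈ [-2, 2] as long as t avoids D at the given energy. The cone shows that j
zeros of D lie below E₀ (`IsHillDiscriminant.bandCount_of_cone`). These zeros are simple, so their
number survives the perturbation (`eventually_bandCount_zero_eq`), and
`IsHillDiscriminant.levelFunction_gap` turns the count into the two band edges at k = 0.

The facts about D used here are collected in `IsHillDiscriminant`; they follow from the integration
by parts `IsSolution.mode_mul_flux`. -/

open scoped BoundedContinuousFunction ContDiff ComplexConjugate

/-! ### Piecewise continuous periodic coefficients. -/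

namespace IsPiecewiseContPeriodic

variable {f g : ℝ → ℝ}

theorem add (hf : IsPiecewiseContPeriodic f) (hg : IsPiecewiseContPeriodic g) :
    IsPiecewiseContPeriodic (f + g) where
  periodic := hf.periodic.add hg.periodic
  finite_discont := by
    refine (hf.finite_discont.union hg.finite_discont).subset ?_
    rintro x ⟨hx, h⟩
    by_contra hcon
    simp only [mem_union, mem_ofPred_eq, hx, true_and, not_or, not_not] at hcon
    exact h (hcon.1.add hcon.2)
  left_lim x := by
    obtain ⟨a, ha⟩ := hf.left_lim x
    obtain ⟨b, hb⟩ := hg.left_lim x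
    exact ⟨a + b, ha.add hb⟩
  right_lim x := by
    obtain ⟨a, ha⟩ := hf.right_lim x
    obtain ⟨b, hb⟩ := hg.right_lim x
    exact ⟨a + b, ha.add hb⟩

theorem const_smul (hf : IsPiecewiseContPeriodic f) (r : ℝ) :
    IsPiecewiseContPeriodic (r • f) where
  periodic x := by simp [hf.periodic x]
  finite_discont := by
    refine hf.finite_discont.subset ?_
    rintro x ⟨hx, h⟩
    exact ⟨hx, fun hc => h (hc.const_smul r)⟩
  left_lim x := by
    obtain ⟨a, ha⟩ := hf.left_lim x
    exact ⟨r • a, ha.const_smul r⟩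
  right_lim x := by
    obtain ⟨a, ha⟩ := hf.right_lim x
    exact ⟨r • a, ha.const_smul r⟩

/-- The one-sided limits and the value at a point bound the function nearby; compactness of a period
and periodicity make the bound global. -/
theorem exists_bound (hf : IsPiecewiseContPeriodic f) : ∃ K > 0, ∀ x, |f x| ≤ K := by
  have hloc : ∀ x, ∃ K, ∀ᶠ y in 𝓝 x, |f y| ≤ K := by
    intro x
    obtain ⟨a, ha⟩ := hf.left_lim x
    obtain ⟨b, hb⟩ := hf.right_lim x
    have h1 := ha.abs.eventually (eventually_le_nhds (lt_add_one |a|))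
    have h2 := hb.abs.eventually (eventually_le_nhds (lt_add_one |b|))
    refine ⟨max (|f x|) (max (|a| + 1) (|b| + 1)), ?_⟩
    rw [← nhdsNE_sup_pure, ← nhdsLT_sup_nhdsGT]
    simp only [eventually_sup, eventually_pure]
    exact ⟨⟨h1.mono fun y hy => by simp [hy], h2.mono fun y hy => by simp [hy]⟩, by simp⟩
  have hK : ∃ K, ∀ x ∈ Icc (0 : ℝ) 1, |f x| ≤ K := by
    refine isCompact_Icc.induction_on (p := fun s => ∃ K, ∀ x ∈ s, |f x| ≤ K) ⟨0, by simp⟩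
      ?_ ?_ ?_
    · rintro s t hst ⟨K, hK⟩
      exact ⟨K, fun x hx => hK x (hst hx)⟩
    · rintro s t ⟨K, hK⟩ ⟨K', hK'⟩
      refine ⟨max K K', ?_⟩
      rintro x (hx | hx)
      · exact (hK x hx).trans (le_max_left _ _)
      · exact (hK' x hx).trans (le_max_right _ _)
    · intro x _
      obtain ⟨K, hK⟩ := hloc x
      exact ⟨_, mem_nhdsWithin_of_mem_nhds hK, K, fun y hy => hy⟩
  obtain ⟨K, hK⟩ := hK
  refine ⟨max K 1, by positivity, fun x => ?_⟩
  obtain ⟨y, hy, hxy⟩ := hf.periodic.exists_mem_Ico₀ one_pos x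
  rw [hxy]
  exact (hK y ⟨hy.1, hy.2.le⟩).trans (le_max_left _ _)

theorem countable_discont (hf : IsPiecewiseContPeriodic f) :
    {x | ¬ ContinuousAt f x}.Countable := by
  have : {x | ¬ ContinuousAt f x} ⊆
      ⋃ n : ℤ, (fun y : ℝ => y + n) '' {x ∈ Icc (0 : ℝ) 1 | ¬ ContinuousAt f x} := by
    intro x hx
    simp only [mem_iUnion, mem_image]
    refine ⟨⌊x⌋, Int.fract x, ⟨⟨Int.fract_nonneg x, (Int.fract_lt_one x).le⟩, fun hc => hx ?_⟩,
      by simp⟩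
    have hper : f = fun y => f (y - ⌊x⌋) := by
      funext y
      have := hf.periodic.sub_int_mul_eq ⌊x⌋ (x := y)
      simpa using this.symm
    rw [hper]
    exact ContinuousAt.comp (f := fun y : ℝ => y - ⌊x⌋) (g := f) hc (by fun_prop)
  exact (countable_iUnion fun n => hf.finite_discont.countable.image _).mono this

/-- The function is continuous on the set of its continuity points, whose complement is countable
and hence null. -/
theorem aestronglyMeasurable (hf : IsPiecewiseContPeriodic f) :
    AEStronglyMeasurable f volume := by
  have hs : MeasurableSet {x | ContinuousAt f x} := (IsGδ.setOfPred_continuousAt f).measurableSet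
  have h1 : AEStronglyMeasurable f (volume.restrict {x | ContinuousAt f x}) :=
    ContinuousOn.aestronglyMeasurable (fun x hx => ContinuousAt.continuousWithinAt hx) hs
  rwa [Measure.restrict_eq_self_of_ae_mem] at h1
  have := hf.countable_discont.ae_notMem volume
  filter_upwards [this] with x hx
  simpa using hx

end IsPiecewiseContPeriodic

/-! ### Bounded measurable coefficients and exponentially weighted integral bounds. -/

/-- Measurable functions on the line with an absolute bound. -/
structure IsBoundedMeas (g : ℝ → ℝ) (K : ℝ) : Prop where
  meas : AEStronglyMeasurable g volume
  bound : ∀ x, |g x| ≤ K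

theorem IsPiecewiseContPeriodic.exists_isBoundedMeas {f : ℝ → ℝ}
    (hf : IsPiecewiseContPeriodic f) : ∃ K > 0, IsBoundedMeas f K := by
  obtain ⟨K, hK, h⟩ := hf.exists_bound
  exact ⟨K, hK, hf.aestronglyMeasurable, h⟩

theorem IsBoundedMeas.intervalIntegrable_smul {g : ℝ → ℝ} {K : ℝ} (hg : IsBoundedMeas g K)
    {F : Type*} [NormedAddCommGroup F] [NormedSpace ℝ F] {z : ℝ → F} (hz : Continuous z)
    (a b : ℝ) : IntervalIntegrable (fun t => g t • z t) volume a b := by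
  have h1 : IntervalIntegrable g volume a b := by
    rw [intervalIntegrable_iff]
    exact Measure.integrableOn_of_bounded (M := K) (by simp) hg.meas
      (Eventually.of_forall hg.bound)
  exact h1.smul_continuousOn hz.continuousOn

/-- Integrating the weight gains a factor 1/l, so a large rate makes Volterra operators small in the
weighted norm. -/
theorem norm_integral_le_exp_of_nonneg {F : Type*} [NormedAddCommGroup F] [NormedSpace ℝ F]
    {h : ℝ → F} {m l x : ℝ} (hl : 0 < l) (hm : 0 ≤ m) (hx : 0 ≤ x)
    (hb : ∀ t ∈ Icc 0 x, ‖h t‖ ≤ m * Real.exp (l * t)) :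
    ‖∫ t in (0 : ℝ)..x, h t‖ ≤ m / l * Real.exp (l * x) := by
  have h1 : ‖∫ t in (0 : ℝ)..x, h t‖ ≤ ∫ t in (0 : ℝ)..x, m * Real.exp (l * t) := by
    refine intervalIntegral.norm_integral_le_of_norm_le hx
      (Eventually.of_forall fun t ht => hb t ⟨ht.1.le, ht.2⟩) ?_
    exact Continuous.intervalIntegrable (by fun_prop) _ _
  refine h1.trans ?_
  rw [intervalIntegral.integral_const_mul, intervalIntegral.integral_comp_mul_left _ hl.ne',
    integral_exp, smul_eq_mul, div_eq_mul_inv, mul_assoc]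
  gcongr
  simp

theorem norm_integral_le_exp {F : Type*} [NormedAddCommGroup F] [NormedSpace ℝ F]
    {h : ℝ → F} {m l x : ℝ} (hl : 0 < l) (hm : 0 ≤ m)
    (hb : ∀ t, |t| ≤ |x| → ‖h t‖ ≤ m * Real.exp (l * |t|)) :
    ‖∫ t in (0 : ℝ)..x, h t‖ ≤ m / l * Real.exp (l * |x|) := by
  rcases le_total 0 x with hx | hx
  · rw [abs_of_nonneg hx]
    refine norm_integral_le_exp_of_nonneg hl hm hx fun t ht => ?_
    have := hb t (by rw [abs_of_nonneg ht.1, abs_of_nonneg hx]; exact ht.2)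
    rwa [abs_of_nonneg ht.1] at this
  · rw [abs_of_nonpos hx]
    have h1 : ∫ t in (0 : ℝ)..x, h t = -∫ t in (0 : ℝ)..(-x), h (-t) := by
      rw [intervalIntegral.integral_comp_neg, neg_neg, neg_zero, intervalIntegral.integral_symm]
    rw [h1, norm_neg]
    refine norm_integral_le_exp_of_nonneg hl hm (neg_nonneg.2 hx) fun t ht => ?_
    have := hb (-t) (by rw [abs_neg, abs_of_nonneg ht.1, abs_of_nonpos hx]; exact ht.2)
    rwa [abs_neg, abs_of_nonneg ht.1] at this

/-! ### Continuity and uniqueness of solutions. -/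

namespace IsSolution

variable {F : Type*} [NormedAddCommGroup F] [NormedSpace ℝ F]
  {ε μ : ℝ → ℝ} {E : ℝ} {ψ φ ψ' φ' : ℝ → F}

theorem intervalIntegrable_flux (h : IsSolution ε μ E ψ φ) (a b : ℝ) :
    IntervalIntegrable (fun t => μ t • φ t) volume a b :=
  (h.integrable_flux a).symm.trans (h.integrable_flux b)

theorem intervalIntegrable_mode (h : IsSolution ε μ E ψ φ) (a b : ℝ) :
    IntervalIntegrable (fun t => (E * ε t) • ψ t) volume a b :=
  (h.integrable_mode a).symm.trans (h.integrable_mode b)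

theorem continuous_mode (h : IsSolution ε μ E ψ φ) : Continuous ψ := by
  rw [funext h.mode_eq]
  exact continuous_const.add (intervalIntegral.continuous_primitive h.intervalIntegrable_flux 0)

theorem continuous_flux (h : IsSolution ε μ E ψ φ) : Continuous φ := by
  rw [funext h.flux_eq]
  exact continuous_const.sub (intervalIntegral.continuous_primitive h.intervalIntegrable_mode 0)

theorem add (h : IsSolution ε μ E ψ φ) (h' : IsSolution ε μ E ψ' φ') :
    IsSolution ε μ E (ψ + ψ') (φ + φ') where
  integrable_flux x := by
    simpa [smul_add] using (h.integrable_flux x).add (h'.integrable_flux x)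
  integrable_mode x := by
    simpa only [Pi.add_apply, smul_add] using (h.integrable_mode x).add (h'.integrable_mode x)
  mode_eq x := by
    simp only [Pi.add_apply, smul_add]
    rw [intervalIntegral.integral_add (h.integrable_flux x) (h'.integrable_flux x),
      h.mode_eq x, h'.mode_eq x]
    abel
  flux_eq x := by
    simp only [Pi.add_apply, smul_add]
    rw [intervalIntegral.integral_add (h.integrable_mode x) (h'.integrable_mode x),
      h.flux_eq x, h'.flux_eq x]
    abel

theorem neg (h : IsSolution ε μ E ψ φ) : IsSolution ε μ E (-ψ) (-φ) where
  integrable_flux x := by simpa [Pi.neg_def] using (h.integrable_flux x).neg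
  integrable_mode x := by
    simpa only [Pi.neg_apply, smul_neg, Pi.neg_def] using (h.integrable_mode x).neg
  mode_eq x := by
    simp only [Pi.neg_apply, smul_neg, intervalIntegral.integral_neg]
    rw [h.mode_eq x]
    abel
  flux_eq x := by
    simp only [Pi.neg_apply, smul_neg, intervalIntegral.integral_neg]
    rw [h.flux_eq x]
    abel

theorem smul_const [CompleteSpace F] {ψ φ : ℝ → ℝ} (h : IsSolution ε μ E ψ φ) (v : F) :
    IsSolution ε μ E (fun x => ψ x • v) (fun x => φ x • v) where
  integrable_flux x := by
    have := h.intervalIntegrable_flux 0 x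
    rw [intervalIntegrable_iff] at this ⊢
    simpa only [IntegrableOn, smul_assoc] using this.smul_const v
  integrable_mode x := by
    have := h.intervalIntegrable_mode 0 x
    rw [intervalIntegrable_iff] at this ⊢
    simpa only [IntegrableOn, smul_assoc] using this.smul_const v
  mode_eq x := by
    simp only [← smul_assoc]
    rw [intervalIntegral.integral_smul_const, ← add_smul, ← h.mode_eq x]
  flux_eq x := by
    simp only [← smul_assoc]
    rw [intervalIntegral.integral_smul_const, ← sub_smul, ← h.flux_eq x]

/-- Grönwall's argument by a weighted maximum: with the weight exp (-2L|x|) on [-R, R], the integral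
equations bound the maximum m by Lm/(2L) = m/2, so m = 0. -/
theorem eq_zero {K : ℝ} (hε : ∀ x, |ε x| ≤ K) (hμ : ∀ x, |μ x| ≤ K)
    (h : IsSolution ε μ E ψ φ) (hψ : ψ 0 = 0) (hφ : φ 0 = 0) : ψ = 0 ∧ φ = 0 := by
  have hK : 0 ≤ K := (abs_nonneg _).trans (hε 0)
  -- `L` dominates both |μ| and |E ε|; the summand 1 keeps it positive.
  set L : ℝ := (1 + |E|) * K + 1 with hL
  have hL0 : 0 < L := by positivity
  have key : ∀ R : ℝ, 0 ≤ R → ∀ x ∈ Icc (-R) R, ψ x = 0 ∧ φ x = 0 := by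
    intro R hR
    have hcont : ContinuousOn
        (fun x => max ‖ψ x‖ ‖φ x‖ * Real.exp (-(2 * L * |x|))) (Icc (-R) R) := by
      have := h.continuous_mode
      have := h.continuous_flux
      fun_prop
    obtain ⟨x₀, hx₀, hmax⟩ := isCompact_Icc.exists_isMaxOn ⟨0, by simpa using hR⟩ hcont
    set m := max ‖ψ x₀‖ ‖φ x₀‖ * Real.exp (-(2 * L * |x₀|)) with hm
    have hm0 : 0 ≤ m := by positivity
    have hle : ∀ x ∈ Icc (-R) R, max ‖ψ x‖ ‖φ x‖ ≤ m * Real.exp (2 * L * |x|) := by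
      intro x hx
      have h1 : max ‖ψ x‖ ‖φ x‖ * Real.exp (-(2 * L * |x|)) ≤ m := hmax hx
      calc max ‖ψ x‖ ‖φ x‖ = max ‖ψ x‖ ‖φ x‖ * Real.exp (-(2 * L * |x|))
            * Real.exp (2 * L * |x|) := by rw [mul_assoc, ← Real.exp_add]; simp
        _ ≤ _ := by gcongr
    have hmem : ∀ t, |t| ≤ |x₀| → t ∈ Icc (-R) R := fun t ht =>
      abs_le.1 (ht.trans (abs_le.2 hx₀))
    have b1 : ‖ψ x₀‖ ≤ L * m / (2 * L) * Real.exp (2 * L * |x₀|) := by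
      rw [h.mode_eq x₀, hψ, zero_add]
      refine norm_integral_le_exp (by positivity) (by positivity) fun t ht => ?_
      rw [norm_smul, mul_assoc L]
      refine mul_le_mul ?_ ((le_max_right _ _).trans (hle t (hmem t ht))) (norm_nonneg _) hL0.le
      have := hμ t
      rw [Real.norm_eq_abs]
      nlinarith [abs_nonneg E, mul_nonneg (abs_nonneg E) hK]
    have b2 : ‖φ x₀‖ ≤ L * m / (2 * L) * Real.exp (2 * L * |x₀|) := by
      rw [h.flux_eq x₀, hφ, zero_sub, norm_neg]
      refine norm_integral_le_exp (by positivity) (by positivity) fun t ht => ?_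
      rw [norm_smul, mul_assoc L]
      refine mul_le_mul ?_ ((le_max_left _ _).trans (hle t (hmem t ht))) (norm_nonneg _) hL0.le
      rw [norm_mul, Real.norm_eq_abs, Real.norm_eq_abs]
      have := mul_le_mul_of_nonneg_left (hε t) (abs_nonneg E)
      nlinarith
    have b3 : m ≤ m / 2 := by
      have : max ‖ψ x₀‖ ‖φ x₀‖ ≤ m / 2 * Real.exp (2 * L * |x₀|) := by
        have e : L * m / (2 * L) = m / 2 := by field_simp
        rw [e] at b1 b2
        exact max_le b1 b2
      calc m ≤ m / 2 * Real.exp (2 * L * |x₀|) * Real.exp (-(2 * L * |x₀|)) := by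
            rw [hm]; gcongr
        _ = m / 2 := by rw [mul_assoc, ← Real.exp_add]; simp
    have hmz : m = 0 := by linarith
    intro x hx
    have := hle x hx
    rw [hmz, zero_mul] at this
    exact ⟨norm_le_zero_iff.1 ((le_max_left _ _).trans this),
      norm_le_zero_iff.1 ((le_max_right _ _).trans this)⟩
  constructor <;> funext x
  · exact (key |x| (abs_nonneg x) x (abs_le.1 le_rfl)).1
  · exact (key |x| (abs_nonneg x) x (abs_le.1 le_rfl)).2

theorem unique {K : ℝ} (hε : ∀ x, |ε x| ≤ K) (hμ : ∀ x, |μ x| ≤ K)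
    (h : IsSolution ε μ E ψ φ) (h' : IsSolution ε μ E ψ' φ') (hψ : ψ 0 = ψ' 0)
    (hφ : φ 0 = φ' 0) : ψ = ψ' ∧ φ = φ' := by
  have := (h.add h'.neg).eq_zero hε hμ (by simp [hψ]) (by simp [hφ])
  exact ⟨by simpa [← sub_eq_add_neg, sub_eq_zero] using this.1,
    by simpa [← sub_eq_add_neg, sub_eq_zero] using this.2⟩

end IsSolution

/-! ### Existence and smooth dependence on (E, δ), by weighted Volterra operators. -/

/-- The Banach space of bounded continuous functions on the line. -/
def BddCont : Type := ℝ →ᵇ ℝ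

namespace BddCont

noncomputable instance : NormedAddCommGroup BddCont :=
  inferInstanceAs (NormedAddCommGroup (ℝ →ᵇ ℝ))

noncomputable instance : NormedSpace ℝ BddCont := inferInstanceAs (NormedSpace ℝ (ℝ →ᵇ ℝ))

instance : CompleteSpace BddCont := inferInstanceAs (CompleteSpace (ℝ →ᵇ ℝ))

instance : FunLike BddCont ℝ ℝ := inferInstanceAs (FunLike (ℝ →ᵇ ℝ) ℝ ℝ)

instance : ContinuousMapClass BddCont ℝ ℝ := inferInstanceAs (ContinuousMapClass (ℝ →ᵇ ℝ) ℝ ℝ)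

theorem norm_apply_le (z : BddCont) (x : ℝ) : ‖z x‖ ≤ ‖z‖ :=
  BoundedContinuousFunction.norm_coe_le_norm (α := ℝ) (β := ℝ) z x

theorem norm_le {z : BddCont} {C : ℝ} (hC : 0 ≤ C) : ‖z‖ ≤ C ↔ ∀ x, ‖z x‖ ≤ C :=
  BoundedContinuousFunction.norm_le (α := ℝ) (β := ℝ) (f := z) hC

@[ext] theorem ext {z w : BddCont} (h : ∀ x, z x = w x) : z = w := DFunLike.ext _ _ h

@[simp] theorem add_apply (z w : BddCont) (x : ℝ) : (z + w) x = z x + w x := rfl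

@[simp] theorem smul_apply (c : ℝ) (z : BddCont) (x : ℝ) : (c • z) x = c * z x := rfl

/-- A bounded continuous function from a pointwise bound. -/
noncomputable def ofBound (f : ℝ → ℝ) (hf : Continuous f) (C : ℝ) (h : ∀ x, ‖f x‖ ≤ C) :
    BddCont :=
  BoundedContinuousFunction.ofNormedAddCommGroup f hf C h

@[simp] theorem ofBound_apply (f : ℝ → ℝ) (hf : Continuous f) (C : ℝ) (h : ∀ x, ‖f x‖ ≤ C)
    (x : ℝ) : ofBound f hf C h x = f x := rfl

end BddCont

/-- The Volterra operator with density `g`, conjugated by the weight `exp (l |x|)`. -/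
noncomputable def weightedVolterra {g : ℝ → ℝ} {K : ℝ} (hg : IsBoundedMeas g K) {l : ℝ}
    (hl : 0 < l) : BddCont →L[ℝ] BddCont :=
  have hK : 0 ≤ K := (abs_nonneg _).trans (hg.bound 0)
  have hint : ∀ z : BddCont, ∀ a b, IntervalIntegrable
      (fun t => g t * (Real.exp (l * |t|) * z t)) volume a b := fun z a b =>
    hg.intervalIntegrable_smul (z := fun t => Real.exp (l * |t|) * z t) (by fun_prop) a b
  have hbound : ∀ z : BddCont, ∀ x,
      ‖Real.exp (-(l * |x|)) * ∫ t in (0 : ℝ)..x, g t * (Real.exp (l * |t|) * z t)‖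
        ≤ K / l * ‖z‖ := by
    intro z x
    have h1 : ‖∫ t in (0 : ℝ)..x, g t * (Real.exp (l * |t|) * z t)‖
        ≤ K * ‖z‖ / l * Real.exp (l * |x|) := by
      refine norm_integral_le_exp hl (by positivity) fun t _ => ?_
      rw [norm_mul, norm_mul, Real.norm_eq_abs, Real.norm_eq_abs, Real.abs_exp]
      calc |g t| * (Real.exp (l * |t|) * ‖z t‖) ≤ K * (Real.exp (l * |t|) * ‖z‖) := by
            gcongr
            · exact hg.bound t
            · exact z.norm_apply_le t
        _ = _ := by ring
    rw [norm_mul, Real.norm_eq_abs, Real.abs_exp]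
    calc _ ≤ Real.exp (-(l * |x|)) * (K * ‖z‖ / l * Real.exp (l * |x|)) := by gcongr
      _ = K / l * ‖z‖ * (Real.exp (-(l * |x|)) * Real.exp (l * |x|)) := by ring
      _ = _ := by rw [← Real.exp_add]; simp
  LinearMap.mkContinuous
    { toFun := fun z => BddCont.ofBound
        (fun x => Real.exp (-(l * |x|)) * ∫ t in (0 : ℝ)..x, g t * (Real.exp (l * |t|) * z t))
        (by
          have := intervalIntegral.continuous_primitive (hint z) 0
          fun_prop) (K / l * ‖z‖) (hbound z)
      map_add' := fun z w => by
        ext x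
        simp only [BddCont.ofBound_apply, BddCont.add_apply, mul_add]
        rw [intervalIntegral.integral_add (hint z 0 x) (hint w 0 x)]
        ring
      map_smul' := fun c z => by
        ext x
        simp only [BddCont.ofBound_apply, BddCont.smul_apply, RingHom.id_apply]
        rw [← mul_left_comm (Real.exp _) c, ← intervalIntegral.integral_const_mul c]
        congr 2
        funext t
        ring }
    (K / l) (fun z => (BddCont.norm_le (by positivity)).2 (hbound z))

/-- This is small for a large rate `l`, which makes the fixed point equation of the system
contractive. -/
theorem norm_weightedVolterra_le {g : ℝ → ℝ} {K : ℝ} (hg : IsBoundedMeas g K) {l : ℝ}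
    (hl : 0 < l) : ‖weightedVolterra hg hl‖ ≤ K / l := by
  unfold weightedVolterra
  exact LinearMap.mkContinuous_norm_le _ (div_nonneg ((abs_nonneg _).trans (hg.bound 0)) hl.le) _

/-- The weight `exp (-l |x|)` as a bounded function. -/
noncomputable def expWeight {l : ℝ} (hl : 0 < l) : BddCont :=
  BddCont.ofBound (fun x => Real.exp (-(l * |x|)))
    (by fun_prop) 1 (fun x => by
      rw [Real.norm_eq_abs, Real.abs_exp, Real.exp_le_one_iff]
      have := mul_nonneg hl.le (abs_nonneg x)
      linarith)

section

variable {ε μ ε₁ μ₁ : ℝ → ℝ} {K : ℝ}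

/-- The integral operator of the first order system at the parameters `p = (E, δ)`. -/
noncomputable def systemOperator (hε : IsBoundedMeas ε K) (hμ : IsBoundedMeas μ K)
    (hε₁ : IsBoundedMeas ε₁ K) (hμ₁ : IsBoundedMeas μ₁ K) {l : ℝ} (hl : 0 < l) (p : ℝ × ℝ) :
    (BddCont × BddCont) →L[ℝ] (BddCont × BddCont) :=
  ((weightedVolterra hμ hl + p.2 • weightedVolterra hμ₁ hl).comp
      (ContinuousLinearMap.snd ℝ BddCont BddCont)).prod
    (-(p.1 • (weightedVolterra hε hl + p.2 • weightedVolterra hε₁ hl)).comp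
      (ContinuousLinearMap.fst ℝ BddCont BddCont))

/-- Polynomial dependence on (E, δ) with fixed operator coefficients; smoothness is immediate from
this form. -/
theorem systemOperator_eq (hε : IsBoundedMeas ε K) (hμ : IsBoundedMeas μ K)
    (hε₁ : IsBoundedMeas ε₁ K) (hμ₁ : IsBoundedMeas μ₁ K) {l : ℝ} (hl : 0 < l) :
    ∃ A A₁ B B₁ : (BddCont × BddCont) →L[ℝ] (BddCont × BddCont),
      systemOperator hε hμ hε₁ hμ₁ hl =
        fun p => A + p.2 • A₁ + p.1 • B + (p.1 * p.2) • B₁ := by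
  refine ⟨((weightedVolterra hμ hl).comp (ContinuousLinearMap.snd ℝ BddCont BddCont)).prod 0,
    ((weightedVolterra hμ₁ hl).comp (ContinuousLinearMap.snd ℝ BddCont BddCont)).prod 0,
    (0 : BddCont × BddCont →L[ℝ] BddCont).prod
      (-(weightedVolterra hε hl).comp (ContinuousLinearMap.fst ℝ BddCont BddCont)),
    (0 : BddCont × BddCont →L[ℝ] BddCont).prod
      (-(weightedVolterra hε₁ hl).comp (ContinuousLinearMap.fst ℝ BddCont BddCont)), ?_⟩
  funext p
  refine ContinuousLinearMap.ext fun z => Prod.ext ?_ ?_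
  · simp [systemOperator]
  · simp [systemOperator, smul_smul]
    abel

theorem contDiff_systemOperator (hε : IsBoundedMeas ε K) (hμ : IsBoundedMeas μ K)
    (hε₁ : IsBoundedMeas ε₁ K) (hμ₁ : IsBoundedMeas μ₁ K) {l : ℝ} (hl : 0 < l) :
    ContDiff ℝ ∞ (systemOperator hε hμ hε₁ hμ₁ hl) := by
  obtain ⟨A, A₁, B, B₁, h⟩ := systemOperator_eq hε hμ hε₁ hμ₁ hl
  rw [h]
  exact ((contDiff_const.add (contDiff_snd.smul contDiff_const)).add
    (contDiff_fst.smul contDiff_const)).add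
    ((contDiff_fst.mul contDiff_snd).smul contDiff_const)

theorem norm_systemOperator_le (hε : IsBoundedMeas ε K) (hμ : IsBoundedMeas μ K)
    (hε₁ : IsBoundedMeas ε₁ K) (hμ₁ : IsBoundedMeas μ₁ K) {l : ℝ} (hl : 0 < l) (p : ℝ × ℝ) :
    ‖systemOperator hε hμ hε₁ hμ₁ hl p‖ ≤ (1 + |p.1|) * (1 + |p.2|) * (K / l) := by
  have hK : 0 ≤ K / l := div_nonneg ((abs_nonneg _).trans (hε.bound 0)) hl.le
  have hcomb : ∀ {f f₁ : ℝ → ℝ} (hf : IsBoundedMeas f K) (hf₁ : IsBoundedMeas f₁ K),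
      ‖weightedVolterra hf hl + p.2 • weightedVolterra hf₁ hl‖ ≤ (1 + |p.2|) * (K / l) := by
    intro f f₁ hf hf₁
    have h1 := norm_weightedVolterra_le hf hl
    have h2 := mul_le_mul_of_nonneg_left (norm_weightedVolterra_le hf₁ hl) (abs_nonneg p.2)
    calc _ ≤ ‖weightedVolterra hf hl‖ + ‖p.2 • weightedVolterra hf₁ hl‖ := norm_add_le _ _
      _ ≤ _ := by
        rw [norm_smul, Real.norm_eq_abs]
        linarith
  refine ContinuousLinearMap.opNorm_le_bound _ (by positivity) fun z => ?_
  have e : 0 ≤ |p.1| * ((1 + |p.2|) * (K / l)) * ‖z‖ := by positivity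
  have e' : 0 ≤ (1 + |p.2|) * (K / l) * ‖z‖ := by positivity
  refine max_le ?_ ?_
  · have h1 : ‖(weightedVolterra hμ hl + p.2 • weightedVolterra hμ₁ hl) z.2‖
        ≤ (1 + |p.2|) * (K / l) * ‖z‖ := by
      refine (ContinuousLinearMap.le_opNorm _ _).trans ?_
      gcongr
      · exact hcomb hμ hμ₁
      · exact norm_snd_le z
    refine le_trans h1 ?_
    nlinarith
  · have h1 : ‖-(p.1 • ((weightedVolterra hε hl + p.2 • weightedVolterra hε₁ hl) z.1))‖
        ≤ |p.1| * ((1 + |p.2|) * (K / l) * ‖z‖) := by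
      rw [norm_neg, norm_smul, Real.norm_eq_abs]
      refine mul_le_mul_of_nonneg_left ((ContinuousLinearMap.le_opNorm _ _).trans ?_)
        (abs_nonneg _)
      gcongr
      · exact hcomb hε hε₁
      · exact norm_fst_le z
    refine le_trans h1 ?_
    nlinarith

/-- Removing the weight from a fixed point gives back the system in integrated form. -/
theorem isSolution_of_systemOperator (hε : IsBoundedMeas ε K) (hμ : IsBoundedMeas μ K)
    (hε₁ : IsBoundedMeas ε₁ K) (hμ₁ : IsBoundedMeas μ₁ K) {l : ℝ} (hl : 0 < l) (p : ℝ × ℝ)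
    (a b : ℝ) (S : BddCont × BddCont)
    (hS : S = (a • expWeight hl, b • expWeight hl) + systemOperator hε hμ hε₁ hμ₁ hl p S) :
    IsSolution (ε + p.2 • ε₁) (μ + p.2 • μ₁) p.1 (fun x => Real.exp (l * |x|) * S.1 x)
      (fun x => Real.exp (l * |x|) * S.2 x) ∧ S.1 0 = a ∧ S.2 0 = b := by
  have hc1 : Continuous fun x => Real.exp (l * |x|) * S.1 x := by fun_prop
  have hc2 : Continuous fun x => Real.exp (l * |x|) * S.2 x := by fun_prop
  have hee : ∀ x, Real.exp (l * |x|) * Real.exp (-(l * |x|)) = 1 := fun x => by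
    rw [← Real.exp_add]; simp
  have i1 : ∀ x, IntervalIntegrable (fun t => μ t * (Real.exp (l * |t|) * S.2 t)) volume 0 x :=
    fun x => hμ.intervalIntegrable_smul hc2 0 x
  have i2 : ∀ x, IntervalIntegrable (fun t => p.2 * (μ₁ t * (Real.exp (l * |t|) * S.2 t)))
    volume 0 x := fun x => (hμ₁.intervalIntegrable_smul hc2 0 x).const_mul p.2
  have i3 : ∀ x, IntervalIntegrable (fun t => ε t * (Real.exp (l * |t|) * S.1 t)) volume 0 x :=
    fun x => hε.intervalIntegrable_smul hc1 0 x
  have i4 : ∀ x, IntervalIntegrable (fun t => p.2 * (ε₁ t * (Real.exp (l * |t|) * S.1 t)))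
    volume 0 x := fun x => (hε₁.intervalIntegrable_smul hc1 0 x).const_mul p.2
  have e1 : ∀ x, Real.exp (l * |x|) * S.1 x =
      a + ∫ t in (0 : ℝ)..x, (μ + p.2 • μ₁) t • (Real.exp (l * |t|) * S.2 t) := by
    intro x
    have h1 : S.1 x = a * Real.exp (-(l * |x|)) + (Real.exp (-(l * |x|)) *
        (∫ t in (0 : ℝ)..x, μ t * (Real.exp (l * |t|) * S.2 t)) + p.2 *
        (Real.exp (-(l * |x|)) * ∫ t in (0 : ℝ)..x, μ₁ t * (Real.exp (l * |t|) * S.2 t))) :=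
      congrArg (fun s : BddCont × BddCont => s.1 x) hS
    have h2 : ∫ t in (0 : ℝ)..x, (μ + p.2 • μ₁) t • (Real.exp (l * |t|) * S.2 t) =
        (∫ t in (0 : ℝ)..x, μ t * (Real.exp (l * |t|) * S.2 t)) +
          p.2 * ∫ t in (0 : ℝ)..x, μ₁ t * (Real.exp (l * |t|) * S.2 t) := by
      rw [← intervalIntegral.integral_const_mul]
      rw [← intervalIntegral.integral_add (i1 x) (i2 x)]
      congr 1
      funext t
      simp only [Pi.add_apply, Pi.smul_apply, smul_eq_mul]
      ring
    rw [h1, h2]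
    linear_combination (a + (∫ t in (0 : ℝ)..x, μ t * (Real.exp (l * |t|) * S.2 t)) +
      p.2 * ∫ t in (0 : ℝ)..x, μ₁ t * (Real.exp (l * |t|) * S.2 t)) * hee x
  have e2 : ∀ x, Real.exp (l * |x|) * S.2 x =
      b - ∫ t in (0 : ℝ)..x, (p.1 * (ε + p.2 • ε₁) t) • (Real.exp (l * |t|) * S.1 t) := by
    intro x
    have h1 : S.2 x = b * Real.exp (-(l * |x|)) + -(p.1 * (Real.exp (-(l * |x|)) *
        (∫ t in (0 : ℝ)..x, ε t * (Real.exp (l * |t|) * S.1 t)) + p.2 *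
        (Real.exp (-(l * |x|)) * ∫ t in (0 : ℝ)..x, ε₁ t * (Real.exp (l * |t|) * S.1 t)))) :=
      congrArg (fun s : BddCont × BddCont => s.2 x) hS
    have h2 : ∫ t in (0 : ℝ)..x, (p.1 * (ε + p.2 • ε₁) t) • (Real.exp (l * |t|) * S.1 t) =
        p.1 * ((∫ t in (0 : ℝ)..x, ε t * (Real.exp (l * |t|) * S.1 t)) +
          p.2 * ∫ t in (0 : ℝ)..x, ε₁ t * (Real.exp (l * |t|) * S.1 t)) := by
      rw [← intervalIntegral.integral_const_mul]
      rw [← intervalIntegral.integral_add (i3 x) (i4 x), ← intervalIntegral.integral_const_mul]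
      congr 1
      funext t
      simp only [Pi.add_apply, Pi.smul_apply, smul_eq_mul]
      ring
    rw [h1, h2]
    linear_combination (b - p.1 * ((∫ t in (0 : ℝ)..x, ε t * (Real.exp (l * |t|) * S.1 t)) +
      p.2 * ∫ t in (0 : ℝ)..x, ε₁ t * (Real.exp (l * |t|) * S.1 t))) * hee x
  have z1 : S.1 0 = a := by simpa using e1 0
  have z2 : S.2 0 = b := by simpa using e2 0
  refine ⟨⟨fun x => ?_, fun x => ?_, fun x => ?_, fun x => ?_⟩, z1, z2⟩
  · refine ((i1 x).add (i2 x)).congr fun t _ => ?_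
    simp only [Pi.add_apply, Pi.smul_apply, smul_eq_mul]
    ring
  · refine (((i3 x).add (i4 x)).const_mul p.1).congr fun t _ => ?_
    simp only [Pi.add_apply, Pi.smul_apply, smul_eq_mul]
    ring
  · simpa [z1] using e1 x
  · simpa [z2] using e2 x

/-- Solutions with fixed initial values exist and depend smoothly on `(E, δ)`, locally uniformly
in `x`. -/
theorem exists_contDiffOn_solution (hε : IsBoundedMeas ε K) (hμ : IsBoundedMeas μ K)
    (hε₁ : IsBoundedMeas ε₁ K) (hμ₁ : IsBoundedMeas μ₁ K) (a b : ℝ) (p₀ : ℝ × ℝ) :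
    ∃ (l : ℝ) (S : ℝ × ℝ → BddCont × BddCont), ContDiffAt ℝ ∞ S p₀ ∧
      ∀ᶠ p in 𝓝 p₀, IsSolution (ε + p.2 • ε₁) (μ + p.2 • μ₁) p.1
        (fun x => Real.exp (l * |x|) * (S p).1 x) (fun x => Real.exp (l * |x|) * (S p).2 x) ∧
        (S p).1 0 = a ∧ (S p).2 0 = b := by
  have hK : 0 ≤ K := (abs_nonneg _).trans (hε.bound 0)
  -- This rate makes the operator norm at `p₀` at most (l - 1)/l < 1.
  set l : ℝ := (1 + |p₀.1|) * (1 + |p₀.2|) * K + 1 with hl_def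
  have hl : 0 < l := by positivity
  set T := systemOperator hε hμ hε₁ hμ₁ hl
  have hT : ContDiff ℝ ∞ T := contDiff_systemOperator hε hμ hε₁ hμ₁ hl
  have hT0 : ‖T p₀‖ < 1 := by
    refine (norm_systemOperator_le hε hμ hε₁ hμ₁ hl p₀).trans_lt ?_
    rw [← mul_div_assoc, div_lt_one hl]
    linarith
  -- The solution is the resolvent applied to the weighted initial data, and inversion is smooth at
  -- units.
  refine ⟨l, fun p => Ring.inverse (1 - T p) (a • expWeight hl, b • expWeight hl), ?_, ?_⟩
  · have h1 : ContDiffAt ℝ ∞ (fun p => Ring.inverse (1 - T p)) p₀ := by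
      have h2 := contDiffAt_ringInverse ℝ (n := ∞) (Units.oneSub (T p₀) hT0)
      exact ContDiffAt.comp p₀ h2 (contDiffAt_const.sub hT.contDiffAt)
    exact h1.clm_apply contDiffAt_const
  · have h1 : ∀ᶠ p in 𝓝 p₀, ‖T p‖ < 1 :=
      hT.continuous.norm.continuousAt.eventually (eventually_lt_nhds hT0)
    filter_upwards [h1] with p hp
    refine isSolution_of_systemOperator hε hμ hε₁ hμ₁ hl p a b _ ?_
    have h2 : (1 - T p) * Ring.inverse (1 - T p) = 1 :=
      Ring.mul_inverse_cancel _ (Units.oneSub (T p) hp).isUnit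
    have h3 := congrArg (fun L => L (a • expWeight hl, b • expWeight hl)) h2
    simp only [mul_apply_eq_comp, sub_apply,
      one_apply_eq_self] at h3
    exact sub_eq_iff_eq_add.1 h3

end

/-! ### The transfer matrix and its dependence on the parameters. -/

theorem IsBoundedMeas.mono {g : ℝ → ℝ} {K K' : ℝ} (hg : IsBoundedMeas g K) (h : K ≤ K') :
    IsBoundedMeas g K' := ⟨hg.meas, fun x => (hg.bound x).trans h⟩

theorem isPiecewiseContPeriodic_zero : IsPiecewiseContPeriodic (0 : ℝ → ℝ) where
  periodic x := rfl
  finite_discont := by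
    convert Set.finite_empty
    ext x
    simp only [mem_ofPred_eq, mem_empty_iff_false, iff_false, not_and, not_not]
    exact fun _ => continuousAt_const
  left_lim x := ⟨0, tendsto_const_nhds⟩
  right_lim x := ⟨0, tendsto_const_nhds⟩

section

variable {ε μ ε₁ μ₁ : ℝ → ℝ}

theorem exists_common_bound (hε : IsPiecewiseContPeriodic ε) (hμ : IsPiecewiseContPeriodic μ)
    (hε₁ : IsPiecewiseContPeriodic ε₁) (hμ₁ : IsPiecewiseContPeriodic μ₁) :
    ∃ K, IsBoundedMeas ε K ∧ IsBoundedMeas μ K ∧ IsBoundedMeas ε₁ K ∧ IsBoundedMeas μ₁ K := by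
  obtain ⟨K₁, -, h₁⟩ := hε.exists_isBoundedMeas
  obtain ⟨K₂, -, h₂⟩ := hμ.exists_isBoundedMeas
  obtain ⟨K₃, -, h₃⟩ := hε₁.exists_isBoundedMeas
  obtain ⟨K₄, -, h₄⟩ := hμ₁.exists_isBoundedMeas
  exact ⟨max (max K₁ K₂) (max K₃ K₄), h₁.mono (by simp), h₂.mono (by simp), h₃.mono (by simp),
    h₄.mono (by simp)⟩

theorem IsSolution.eq_of_init {F : Type*} [NormedAddCommGroup F] [NormedSpace ℝ F]
    (hε : IsPiecewiseContPeriodic ε) (hμ : IsPiecewiseContPeriodic μ) {E : ℝ}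
    {ψ φ ψ' φ' : ℝ → F} (h : IsSolution ε μ E ψ φ) (h' : IsSolution ε μ E ψ' φ')
    (hψ : ψ 0 = ψ' 0) (hφ : φ 0 = φ' 0) : ψ = ψ' ∧ φ = φ' := by
  obtain ⟨K, h1, h2, -, -⟩ := exists_common_bound hε hμ hε hμ
  exact h.unique h1.bound h2.bound h' hψ hφ

theorem cauchySolution_spec (hε : IsPiecewiseContPeriodic ε) (hμ : IsPiecewiseContPeriodic μ)
    (E a b : ℝ) : IsSolution ε μ E (cauchySolution ε μ E a b).1 (cauchySolution ε μ E a b).2 ∧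
      (cauchySolution ε μ E a b).1 0 = a ∧ (cauchySolution ε μ E a b).2 0 = b := by
  have hex : ∃ p : (ℝ → ℝ) × (ℝ → ℝ), IsSolution ε μ E p.1 p.2 ∧ p.1 0 = a ∧ p.2 0 = b := by
    obtain ⟨K, h1, h2, h3, h4⟩ := exists_common_bound hε hμ isPiecewiseContPeriodic_zero
      isPiecewiseContPeriodic_zero
    obtain ⟨l, S, -, hS⟩ := exists_contDiffOn_solution h1 h2 h3 h4 a b (E, 0)
    have := hS.self_of_nhds
    simp only [smul_zero, add_zero] at this
    exact ⟨⟨_, _⟩, this.1, by simpa using this.2⟩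
  exact Classical.epsilon_spec hex

theorem cauchySolution_eq (hε : IsPiecewiseContPeriodic ε) (hμ : IsPiecewiseContPeriodic μ)
    {E a b : ℝ} {ψ φ : ℝ → ℝ} (h : IsSolution ε μ E ψ φ) (ha : ψ 0 = a) (hb : φ 0 = b) :
    cauchySolution ε μ E a b = (ψ, φ) := by
  obtain ⟨h1, h2, h3⟩ := cauchySolution_spec hε hμ E a b
  have := h1.eq_of_init hε hμ h (h2.trans ha.symm) (h3.trans hb.symm)
  exact Prod.ext this.1 this.2

/-- By uniqueness the chosen solution agrees near `p₀` with the smooth resolvent solution, and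
evaluation at `x` is a bounded functional. -/
theorem contDiff_cauchySolution (hε : IsPiecewiseContPeriodic ε)
    (hμ : IsPiecewiseContPeriodic μ) (hε₁ : IsPiecewiseContPeriodic ε₁)
    (hμ₁ : IsPiecewiseContPeriodic μ₁) (a b x : ℝ) :
    ContDiff ℝ ∞ (fun p : ℝ × ℝ => (cauchySolution (ε + p.2 • ε₁) (μ + p.2 • μ₁) p.1 a b).1 x) ∧
    ContDiff ℝ ∞
      (fun p : ℝ × ℝ => (cauchySolution (ε + p.2 • ε₁) (μ + p.2 • μ₁) p.1 a b).2 x) := by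
  obtain ⟨K, h1, h2, h3, h4⟩ := exists_common_bound hε hμ hε₁ hμ₁
  simp only [contDiff_iff_contDiffAt, ← forall_and]
  intro p₀
  obtain ⟨l, S, hS, hsol⟩ := exists_contDiffOn_solution h1 h2 h3 h4 a b p₀
  let ev : BddCont →L[ℝ] ℝ := LinearMap.mkContinuous
    { toFun := fun z => z x, map_add' := fun _ _ => rfl, map_smul' := fun _ _ => rfl } 1
    (fun z => by rw [one_mul]; exact z.norm_apply_le x)
  have heq : ∀ᶠ p in 𝓝 p₀, cauchySolution (ε + p.2 • ε₁) (μ + p.2 • μ₁) p.1 a b =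
      (fun x => Real.exp (l * |x|) * (S p).1 x, fun x => Real.exp (l * |x|) * (S p).2 x) := by
    filter_upwards [hsol] with p hp
    exact cauchySolution_eq (hε.add (hε₁.const_smul _)) (hμ.add (hμ₁.const_smul _)) hp.1
      (by simpa using hp.2.1) (by simpa using hp.2.2)
  constructor
  · have h : ContDiffAt ℝ ∞ (fun p => Real.exp (l * |x|) * ev (S p).1) p₀ :=
      contDiffAt_const.mul (ev.contDiff.contDiffAt.comp p₀ hS.fst)
    refine h.congr_of_eventuallyEq ?_
    filter_upwards [heq] with p hp
    rw [hp]
    rfl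
  · have h : ContDiffAt ℝ ∞ (fun p => Real.exp (l * |x|) * ev (S p).2) p₀ :=
      contDiffAt_const.mul (ev.contDiff.contDiffAt.comp p₀ hS.snd)
    refine h.congr_of_eventuallyEq ?_
    filter_upwards [heq] with p hp
    rw [hp]
    rfl

/-- The weighted sup norm controls the sup norm on [0, 1] up to the factor exp |l|. The uniformity
in `x` is needed in `continuousAt_modeGram`. -/
theorem cauchySolution_mode_uniform (hε : IsPiecewiseContPeriodic ε)
    (hμ : IsPiecewiseContPeriodic μ) (a b E : ℝ) {η : ℝ} (hη : 0 < η) :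
    ∀ᶠ E' in 𝓝 E, ∀ x ∈ Icc (0 : ℝ) 1,
      |(cauchySolution ε μ E' a b).1 x - (cauchySolution ε μ E a b).1 x| ≤ η := by
  obtain ⟨K, h1, h2, h3, h4⟩ := exists_common_bound hε hμ isPiecewiseContPeriodic_zero
    isPiecewiseContPeriodic_zero
  obtain ⟨l, S, hS, hsol⟩ := exists_contDiffOn_solution h1 h2 h3 h4 a b (E, 0)
  have hc : ContinuousAt (fun E' : ℝ => ‖(S (E', 0)).1 - (S (E, 0)).1‖) E := by
    have h5 : ContinuousAt (fun E' : ℝ => S (E', 0)) E :=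
      ContinuousAt.comp (f := fun E' : ℝ => (E', (0 : ℝ))) (g := S) hS.continuousAt (by fun_prop)
    exact (h5.fst.sub continuousAt_const).norm
  have hpos : (0 : ℝ) < Real.exp (-|l|) * η := by positivity
  have hlt : ∀ᶠ E' in 𝓝 E, ‖(S (E', 0)).1 - (S (E, 0)).1‖ < Real.exp (-|l|) * η := by
    refine hc.eventually (eventually_lt_nhds ?_)
    simpa using hpos
  have hsol' : ∀ᶠ E' in 𝓝 E, (cauchySolution ε μ E' a b).1 =
      fun x => Real.exp (l * |x|) * (S (E', 0)).1 x := by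
    have : Tendsto (fun E' : ℝ => (E', (0 : ℝ))) (𝓝 E) (𝓝 (E, 0)) :=
      Continuous.tendsto (by fun_prop) E
    filter_upwards [this.eventually hsol] with E' h
    simp only [smul_zero, add_zero] at h
    rw [cauchySolution_eq hε hμ h.1 (by simpa using h.2.1) (by simpa using h.2.2)]
  filter_upwards [hlt, hsol'] with E' hE' hs x hx
  rw [hs, hsol'.self_of_nhds, ← mul_sub, abs_mul, Real.abs_exp]
  have h6 : |(S (E', 0)).1 x - (S (E, 0)).1 x| ≤ Real.exp (-|l|) * η :=
    (((S (E', 0)).1 - (S (E, 0)).1).norm_apply_le x).trans hE'.le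
  have h7 : Real.exp (l * |x|) ≤ Real.exp |l| := by
    rw [Real.exp_le_exp, abs_of_nonneg hx.1]
    calc l * x ≤ |l| * x := mul_le_mul_of_nonneg_right (le_abs_self l) hx.1
      _ ≤ |l| * 1 := mul_le_mul_of_nonneg_left hx.2 (abs_nonneg l)
      _ = |l| := mul_one _
  calc _ ≤ Real.exp |l| * (Real.exp (-|l|) * η) := by gcongr
    _ = η := by rw [← mul_assoc, ← Real.exp_add]; simp

theorem transferMatrix_isSolution (hε : IsPiecewiseContPeriodic ε)
    (hμ : IsPiecewiseContPeriodic μ) (E : ℝ) (j : Fin 2) :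
    IsSolution ε μ E (fun x => transferMatrix ε μ E x 0 j)
      (fun x => transferMatrix ε μ E x 1 j) := by
  fin_cases j
  · exact (cauchySolution_spec hε hμ E 1 0).1
  · exact (cauchySolution_spec hε hμ E 0 1).1

theorem transferMatrix_zero (hε : IsPiecewiseContPeriodic ε)
    (hμ : IsPiecewiseContPeriodic μ) (E : ℝ) : transferMatrix ε μ E 0 = 1 := by
  obtain ⟨-, h1, h2⟩ := cauchySolution_spec hε hμ E 1 0
  obtain ⟨-, h3, h4⟩ := cauchySolution_spec hε hμ E 0 1
  ext i j
  fin_cases i <;> fin_cases j <;> simp [transferMatrix, h1, h2, h3, h4]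

theorem contDiff_transferMatrix (hε : IsPiecewiseContPeriodic ε)
    (hμ : IsPiecewiseContPeriodic μ) (hε₁ : IsPiecewiseContPeriodic ε₁)
    (hμ₁ : IsPiecewiseContPeriodic μ₁) (x : ℝ) (i j : Fin 2) :
    ContDiff ℝ ∞
      (fun p : ℝ × ℝ => transferMatrix (ε + p.2 • ε₁) (μ + p.2 • μ₁) p.1 x i j) := by
  have h1 := contDiff_cauchySolution hε hμ hε₁ hμ₁ 1 0 x
  have h2 := contDiff_cauchySolution hε hμ hε₁ hμ₁ 0 1 x
  fin_cases i <;> fin_cases j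
  exacts [h1.1, h2.1, h1.2, h2.2]

theorem transferMatrix_uniform (hε : IsPiecewiseContPeriodic ε)
    (hμ : IsPiecewiseContPeriodic μ) (E : ℝ) (j : Fin 2) {η : ℝ} (hη : 0 < η) :
    ∀ᶠ E' in 𝓝 E, ∀ x ∈ Icc (0 : ℝ) 1,
      |transferMatrix ε μ E' x 0 j - transferMatrix ε μ E x 0 j| ≤ η := by
  fin_cases j
  · exact cauchySolution_mode_uniform hε hμ 1 0 E hη
  · exact cauchySolution_mode_uniform hε hμ 0 1 E hη

theorem contDiff_perturbedDiscriminant (hε : IsPiecewiseContPeriodic ε)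
    (hμ : IsPiecewiseContPeriodic μ) (hε₁ : IsPiecewiseContPeriodic ε₁)
    (hμ₁ : IsPiecewiseContPeriodic μ₁) :
    ContDiff ℝ ∞ (fun p : ℝ × ℝ => perturbedDiscriminant ε μ ε₁ μ₁ p.1 p.2) := by
  simp only [perturbedDiscriminant, discriminant, Matrix.trace_fin_two]
  exact (contDiff_transferMatrix hε hμ hε₁ hμ₁ 1 0 0).add
    (contDiff_transferMatrix hε hμ hε₁ hμ₁ 1 1 1)

/-- Integration by parts for the product of a mode and a flux. -/
theorem IsSolution.mode_mul_flux {𝔸 : Type*} [NormedRing 𝔸] [NormedAlgebra ℝ 𝔸]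
    [CompleteSpace 𝔸] (hε : IsPiecewiseContPeriodic ε) (hμ : IsPiecewiseContPeriodic μ)
    {E E' : ℝ} {ψ φ ψ' φ' : ℝ → 𝔸} (h : IsSolution ε μ E ψ φ) (h' : IsSolution ε μ E' ψ' φ')
    (x : ℝ) :
    ψ x * φ' x - ψ 0 * φ' 0 =
      (∫ t in (0 : ℝ)..x, μ t • (φ t * φ' t)) - E' • ∫ t in (0 : ℝ)..x, ε t • (ψ t * ψ' t) := by
  obtain ⟨K, h1, h2, -, -⟩ := exists_common_bound hε hμ hε hμ
  have cψ := h.continuous_mode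
  have cφ := h.continuous_flux
  have cψ' := h'.continuous_mode
  have cφ' := h'.continuous_flux
  have i1 : IntervalIntegrable (fun t => μ t • (φ t * φ' t)) volume 0 x :=
    h2.intervalIntegrable_smul (cφ.mul cφ') 0 x
  have i2 : IntervalIntegrable (fun t => E' • (ε t • (ψ t * ψ' t))) volume 0 x :=
    (h1.intervalIntegrable_smul (cψ.mul cψ') 0 x).smul E'
  rw [← intervalIntegral.integral_smul, ← intervalIntegral.integral_sub i1 i2]
  -- Mode and flux are differentiable off the countable set of discontinuities of the coefficients,
  -- which suffices because their product is continuous.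
  refine (MeasureTheory.integral_eq_of_hasDerivAt_off_countable (fun t => ψ t * φ' t) _
    (hμ.countable_discont.union hε.countable_discont) (by fun_prop) ?_ (i1.sub i2)).symm
  rintro t ⟨-, ht⟩
  simp only [mem_union, mem_ofPred_eq, not_or, not_not] at ht
  have d1 : HasDerivAt ψ (μ t • φ t) t := by
    rw [funext h.mode_eq]
    refine (intervalIntegral.integral_hasDerivAt_right (h.intervalIntegrable_flux 0 t) ?_
      (ht.1.smul cφ.continuousAt)).const_add _
    exact (hμ.aestronglyMeasurable.smul cφ.aestronglyMeasurable).stronglyMeasurableAtFilter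
  have d2 : HasDerivAt φ' (-((E' * ε t) • ψ' t)) t := by
    rw [funext h'.flux_eq]
    refine (intervalIntegral.integral_hasDerivAt_right (h'.intervalIntegrable_mode 0 t) ?_
      ((continuousAt_const.mul ht.2).smul cψ'.continuousAt)).const_sub _
    exact ((hε.aestronglyMeasurable.const_mul E').smul
      cψ'.aestronglyMeasurable).stronglyMeasurableAtFilter
  refine (d1.mul d2).congr_deriv ?_
  simp [mul_smul, sub_eq_add_neg]

end

/-! ### Energy derivatives of the monodromy matrix through Gram matrices. -/

/-- Carathéodory's form of the derivative: `q` is the difference quotient, extended continuously to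
`x`. -/
theorem hasDerivAt_of_sub_eq_mul {f q : ℝ → ℝ} {x : ℝ} (h : ∀ y, f y - f x = (y - x) * q y)
    (hq : ContinuousAt q x) : HasDerivAt f (q x) x := by
  rw [hasDerivAt_iff_tendsto_slope]
  refine (hq.tendsto.mono_left nhdsWithin_le_nhds).congr' ?_
  filter_upwards [self_mem_nhdsWithin] with y hy
  have : y - x ≠ 0 := sub_ne_zero.2 hy
  rw [slope_def_field, h y]
  field_simp

namespace IsPiecewiseContPeriodic

variable {g u v w : ℝ → ℝ}

theorem intervalIntegrable_mul (hg : IsPiecewiseContPeriodic g) (hw : Continuous w) (a b : ℝ) :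
    IntervalIntegrable (fun t => g t * w t) volume a b := by
  obtain ⟨K, -, h⟩ := hg.exists_isBoundedMeas
  exact h.intervalIntegrable_smul hw a b

theorem integral_quadratic (hg : IsPiecewiseContPeriodic g) (hu : Continuous u)
    (hv : Continuous v) (A B C : ℝ) :
    ∫ t in (0 : ℝ)..1, g t * (A * (u t * u t) + B * (u t * v t) + C * (v t * v t)) =
      A * (∫ t in (0 : ℝ)..1, g t * (u t * u t)) + B * (∫ t in (0 : ℝ)..1, g t * (u t * v t)) +
        C * ∫ t in (0 : ℝ)..1, g t * (v t * v t) := by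
  have i1 := (hg.intervalIntegrable_mul (hu.mul hu) 0 1).const_mul A
  have i2 := (hg.intervalIntegrable_mul (hu.mul hv) 0 1).const_mul B
  have i3 := (hg.intervalIntegrable_mul (hv.mul hv) 0 1).const_mul C
  simp only [Pi.mul_apply] at i1 i2 i3
  rw [← intervalIntegral.integral_const_mul, ← intervalIntegral.integral_const_mul,
    ← intervalIntegral.integral_const_mul, ← intervalIntegral.integral_add i1 i2,
    ← intervalIntegral.integral_add (i1.add i2) i3]
  congr 1
  funext t
  ring

theorem integral_mul_nonneg (hgc : ∀ x, 0 ≤ g x) (hw : ∀ x, 0 ≤ w x) :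
    0 ≤ ∫ t in (0 : ℝ)..1, g t * w t :=
  intervalIntegral.integral_nonneg zero_le_one fun t _ => mul_nonneg (hgc t) (hw t)

theorem integral_mul_pos (hg : IsPiecewiseContPeriodic g) {c : ℝ} (hc : 0 < c)
    (hgc : ∀ x, c ≤ g x) (hw : Continuous w) (hw0 : ∀ x, 0 ≤ w x)
    (hpos : ∃ x ∈ Icc (0 : ℝ) 1, 0 < w x) : 0 < ∫ t in (0 : ℝ)..1, g t * w t := by
  have h1 : 0 < ∫ t in (0 : ℝ)..1, w t :=
    intervalIntegral.integral_pos one_pos hw.continuousOn (fun x _ => hw0 x) hpos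
  calc 0 < c * ∫ t in (0 : ℝ)..1, w t := by positivity
    _ = ∫ t in (0 : ℝ)..1, c * w t := by rw [intervalIntegral.integral_const_mul]
    _ ≤ _ := intervalIntegral.integral_mono_on zero_le_one
        ((hw.intervalIntegrable 0 1).const_mul c) (hg.intervalIntegrable_mul hw 0 1)
        fun x _ => mul_le_mul_of_nonneg_right (hgc x) (hw0 x)

end IsPiecewiseContPeriodic

/-- A vanishing mode makes the flux constant on the period; the mode at 1 is then this constant
times ∫ μ > 0. -/
theorem IsSolution.flux_zero_of_mode_zero {F : Type*} [NormedAddCommGroup F] [NormedSpace ℝ F]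
    [CompleteSpace F] {ε μ : ℝ → ℝ} {E c : ℝ} {ψ φ : ℝ → F} (hμ : IsPiecewiseContPeriodic μ)
    (hc : 0 < c) (hμc : ∀ x, c ≤ μ x) (h : IsSolution ε μ E ψ φ)
    (hψ : ∀ x ∈ Icc (0 : ℝ) 1, ψ x = 0) : φ 0 = 0 := by
  have h1 : ∀ x ∈ Icc (0 : ℝ) 1, φ x = φ 0 := by
    intro x hx
    rw [h.flux_eq x, sub_eq_self]
    have h0 : ∫ t in (0 : ℝ)..x, (E * ε t) • ψ t = ∫ t in (0 : ℝ)..x, (0 : F) := by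
      refine intervalIntegral.integral_congr fun t ht => ?_
      rw [uIcc_of_le hx.1] at ht
      simp [hψ t ⟨ht.1, ht.2.trans hx.2⟩]
    rw [h0]
    simp
  have h2 : (∫ t in (0 : ℝ)..1, μ t) • φ 0 = 0 := by
    have h3 := h.mode_eq 1
    rw [hψ 1 (by simp), hψ 0 (by simp), zero_add] at h3
    rw [h3, ← intervalIntegral.integral_smul_const]
    refine intervalIntegral.integral_congr fun t ht => ?_
    rw [uIcc_of_le zero_le_one] at ht
    simp [h1 t ht]
  have h3 : 0 < ∫ t in (0 : ℝ)..1, μ t := by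
    simpa using hμ.integral_mul_pos hc hμc (w := fun _ => 1) continuous_const
      (fun _ => zero_le_one) ⟨0, by simp, one_pos⟩
  exact (smul_eq_zero.1 h2).resolve_left h3.ne'

/-- The weighted products of the normalized modes at two energies. -/
noncomputable def modeGram (ε μ : ℝ → ℝ) (E E' : ℝ) (i j : Fin 2) : ℝ :=
  ∫ t in (0 : ℝ)..1, ε t * (transferMatrix ε μ E t 0 i * transferMatrix ε μ E' t 0 j)

/-- The weighted products of the normalized fluxes. -/
noncomputable def fluxGram (ε μ : ℝ → ℝ) (E : ℝ) (i j : Fin 2) : ℝ :=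
  ∫ t in (0 : ℝ)..1, μ t * (transferMatrix ε μ E t 1 i * transferMatrix ε μ E t 1 j)

section

variable {ε μ : ℝ → ℝ}

theorem continuous_transferMatrix (hε : IsPiecewiseContPeriodic ε)
    (hμ : IsPiecewiseContPeriodic μ) (E : ℝ) (i j : Fin 2) :
    Continuous fun x => transferMatrix ε μ E x i j := by
  fin_cases i
  · exact (transferMatrix_isSolution hε hμ E j).continuous_mode
  · exact (transferMatrix_isSolution hε hμ E j).continuous_flux

theorem modeGram_comm (E : ℝ) (i j : Fin 2) : modeGram ε μ E E i j = modeGram ε μ E E j i := by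
  simp only [modeGram, mul_comm (transferMatrix ε μ E _ 0 i)]

/-- The Wronskian is constant: the two integrations by parts at the same energy have equal
right-hand sides. -/
theorem transferMatrix_det (hε : IsPiecewiseContPeriodic ε) (hμ : IsPiecewiseContPeriodic μ)
    (E x : ℝ) : transferMatrix ε μ E x 0 0 * transferMatrix ε μ E x 1 1 -
      transferMatrix ε μ E x 0 1 * transferMatrix ε μ E x 1 0 = 1 := by
  have s := transferMatrix_isSolution hε hμ E
  have h1 := (s 0).mode_mul_flux hε hμ (s 1) x
  have h2 := (s 1).mode_mul_flux hε hμ (s 0) x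
  simp only [transferMatrix_zero hε hμ, mul_comm (transferMatrix ε μ E _ _ 1)] at h1 h2
  simp only [Matrix.one_apply, Fin.isValue, ↓reduceIte, zero_ne_one, one_ne_zero] at h1 h2
  linarith

theorem fluxGram_sub_modeGram (hε : IsPiecewiseContPeriodic ε)
    (hμ : IsPiecewiseContPeriodic μ) (E : ℝ) (i j : Fin 2) :
    fluxGram ε μ E i j - E * modeGram ε μ E E i j =
      transferMatrix ε μ E 1 0 i * transferMatrix ε μ E 1 1 j -
        (1 : Matrix (Fin 2) (Fin 2) ℝ) 0 i * (1 : Matrix (Fin 2) (Fin 2) ℝ) 1 j := by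
  have s := transferMatrix_isSolution hε hμ E
  have h1 := (s i).mode_mul_flux hε hμ (s j) 1
  simp only [transferMatrix_zero hε hμ] at h1
  exact h1.symm

/-- Lagrange's identity: in the Wronskian of solutions at two energies the flux integrals cancel,
and the mode integral survives with the energy difference as factor. -/
theorem transferMatrix_lagrange (hε : IsPiecewiseContPeriodic ε)
    (hμ : IsPiecewiseContPeriodic μ) (E E' : ℝ) (i j : Fin 2) :
    transferMatrix ε μ E 1 0 i * transferMatrix ε μ E' 1 1 j -
      transferMatrix ε μ E' 1 0 j * transferMatrix ε μ E 1 1 i =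
    (1 : Matrix (Fin 2) (Fin 2) ℝ) 0 i * (1 : Matrix (Fin 2) (Fin 2) ℝ) 1 j -
      (1 : Matrix (Fin 2) (Fin 2) ℝ) 0 j * (1 : Matrix (Fin 2) (Fin 2) ℝ) 1 i -
      (E' - E) * modeGram ε μ E E' i j := by
  have h1 := (transferMatrix_isSolution hε hμ E i).mode_mul_flux hε hμ
    (transferMatrix_isSolution hε hμ E' j) 1
  have h2 := (transferMatrix_isSolution hε hμ E' j).mode_mul_flux hε hμ
    (transferMatrix_isSolution hε hμ E i) 1
  simp only [transferMatrix_zero hε hμ, smul_eq_mul, mul_comm (transferMatrix ε μ E' _ 0 j),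
    mul_comm (transferMatrix ε μ E' _ 1 j)] at h1 h2
  simp only [modeGram]
  linarith

/-- Cramer's rule applied to `transferMatrix_lagrange`, with determinant one. The difference is an
exact multiple of E' - E, so continuity of `modeGram` alone yields the derivative. -/
theorem transferMatrix_sub (hε : IsPiecewiseContPeriodic ε)
    (hμ : IsPiecewiseContPeriodic μ) (E E' : ℝ) (i j : Fin 2) :
    transferMatrix ε μ E' 1 i j - transferMatrix ε μ E 1 i j =
      (E' - E) * (transferMatrix ε μ E 1 i 0 * modeGram ε μ E E' 1 j -
        transferMatrix ε μ E 1 i 1 * modeGram ε μ E E' 0 j) := by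
  have d := transferMatrix_det hε hμ E 1
  have l0 := transferMatrix_lagrange hε hμ E E' 0 j
  have l1 := transferMatrix_lagrange hε hμ E E' 1 j
  fin_cases j
  · simp only [Fin.zero_eta, Matrix.one_apply, Fin.isValue, ↓reduceIte, zero_ne_one,
      one_ne_zero] at l0 l1 ⊢
    fin_cases i
    · simp only [Fin.zero_eta, Fin.isValue]
      linear_combination (-transferMatrix ε μ E' 1 0 0) * d + transferMatrix ε μ E 1 0 1 * l0 -
        transferMatrix ε μ E 1 0 0 * l1
    · simp only [Fin.mk_one, Fin.isValue]
      linear_combination (-transferMatrix ε μ E' 1 1 0) * d + transferMatrix ε μ E 1 1 1 * l0 -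
        transferMatrix ε μ E 1 1 0 * l1
  · simp only [Fin.mk_one, Matrix.one_apply, Fin.isValue, ↓reduceIte, zero_ne_one,
      one_ne_zero] at l0 l1 ⊢
    fin_cases i
    · simp only [Fin.zero_eta, Fin.isValue]
      linear_combination (-transferMatrix ε μ E' 1 0 1) * d + transferMatrix ε μ E 1 0 1 * l0 -
        transferMatrix ε μ E 1 0 0 * l1
    · simp only [Fin.mk_one, Fin.isValue]
      linear_combination (-transferMatrix ε μ E' 1 1 1) * d + transferMatrix ε μ E 1 1 1 * l0 -
        transferMatrix ε μ E 1 1 0 * l1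

theorem continuousAt_modeGram (hε : IsPiecewiseContPeriodic ε)
    (hμ : IsPiecewiseContPeriodic μ) (E : ℝ) (i j : Fin 2) :
    ContinuousAt (fun E' => modeGram ε μ E E' i j) E := by
  obtain ⟨K, hK, hb⟩ := hε.exists_bound
  obtain ⟨B, hB⟩ := isCompact_Icc.exists_bound_of_continuousOn (s := Icc (0 : ℝ) 1)
    (continuous_transferMatrix hε hμ E 0 i).continuousOn
  have hB0 : 0 ≤ B := (norm_nonneg _).trans (hB 0 (by simp))
  rw [Metric.continuousAt_iff']
  intro η hη
  have hη' : 0 < η / (K * (B + 1)) := by positivity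
  filter_upwards [transferMatrix_uniform hε hμ E j (half_pos hη')] with E' hE'
  rw [Real.dist_eq, modeGram, modeGram, ← intervalIntegral.integral_sub]
  · have hle : ‖∫ t in (0 : ℝ)..1,
        (ε t * (transferMatrix ε μ E t 0 i * transferMatrix ε μ E' t 0 j) -
          ε t * (transferMatrix ε μ E t 0 i * transferMatrix ε μ E t 0 j))‖ ≤
        K * ((B + 1) * (η / (K * (B + 1)) / 2)) * |1 - 0| := by
      refine intervalIntegral.norm_integral_le_of_norm_le_const fun t ht => ?_
      rw [uIoc_of_le zero_le_one] at ht
      have ht' : t ∈ Icc (0 : ℝ) 1 := ⟨ht.1.le, ht.2⟩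
      rw [← mul_sub, ← mul_sub, norm_mul, norm_mul, Real.norm_eq_abs, Real.norm_eq_abs (_ - _)]
      gcongr
      · exact hb t
      · linarith [hB t ht']
      · exact hE' t ht'
    rw [Real.norm_eq_abs] at hle
    refine hle.trans_lt ?_
    have e : K * ((B + 1) * (η / (K * (B + 1)) / 2)) * |1 - 0| = η / 2 := by
      rw [sub_zero, abs_one]
      field_simp
    rw [e]
    linarith
  · exact hε.intervalIntegrable_mul ((continuous_transferMatrix hε hμ E 0 i).mul
      (continuous_transferMatrix hε hμ E' 0 j)) 0 1
  · exact hε.intervalIntegrable_mul ((continuous_transferMatrix hε hμ E 0 i).mul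
      (continuous_transferMatrix hε hμ E 0 j)) 0 1

theorem hasDerivAt_transferMatrix (hε : IsPiecewiseContPeriodic ε)
    (hμ : IsPiecewiseContPeriodic μ) (E : ℝ) (i j : Fin 2) :
    HasDerivAt (fun E' => transferMatrix ε μ E' 1 i j)
      (transferMatrix ε μ E 1 i 0 * modeGram ε μ E E 1 j -
        transferMatrix ε μ E 1 i 1 * modeGram ε μ E E 0 j) E :=
  hasDerivAt_of_sub_eq_mul (q := fun E' => transferMatrix ε μ E 1 i 0 * modeGram ε μ E E' 1 j -
        transferMatrix ε μ E 1 i 1 * modeGram ε μ E E' 0 j)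
    (fun E' => transferMatrix_sub hε hμ E E' i j)
    ((continuousAt_const.mul (continuousAt_modeGram hε hμ E 1 j)).sub
      (continuousAt_const.mul (continuousAt_modeGram hε hμ E 0 j)))

theorem discriminant_eq (E : ℝ) : discriminant ε μ E =
    transferMatrix ε μ E 1 0 0 + transferMatrix ε μ E 1 1 1 := Matrix.trace_fin_two _

/-- The form with coefficients m01, m11 - m00, -m10, integrated over the modes, has discriminant D²
- 4. Its definiteness for |D| < 2 is what makes D monotone there. -/
theorem deriv_discriminant (hε : IsPiecewiseContPeriodic ε)
    (hμ : IsPiecewiseContPeriodic μ) (E : ℝ) :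
    deriv (discriminant ε μ) E = -(transferMatrix ε μ E 1 0 1 * modeGram ε μ E E 0 0 +
      (transferMatrix ε μ E 1 1 1 - transferMatrix ε μ E 1 0 0) * modeGram ε μ E E 0 1 +
      (-transferMatrix ε μ E 1 1 0) * modeGram ε μ E E 1 1) := by
  have h := (hasDerivAt_transferMatrix hε hμ E 0 0).add (hasDerivAt_transferMatrix hε hμ E 1 1)
  have e : discriminant ε μ =
      (fun E' => transferMatrix ε μ E' 1 0 0) + fun E' => transferMatrix ε μ E' 1 1 1 := by
    funext E'
    exact discriminant_eq E'
  rw [e, h.deriv, modeGram_comm E 1 0]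
  ring

theorem contDiff_transferMatrix_energy (hε : IsPiecewiseContPeriodic ε)
    (hμ : IsPiecewiseContPeriodic μ) (i j : Fin 2) :
    ContDiff ℝ ∞ (fun E => transferMatrix ε μ E 1 i j) := by
  have h := contDiff_transferMatrix hε hμ isPiecewiseContPeriodic_zero
    isPiecewiseContPeriodic_zero 1 i j
  simp only [smul_zero, add_zero] at h
  exact h.comp (f := fun E : ℝ => (E, (0 : ℝ))) (by fun_prop)

theorem contDiff_discriminant (hε : IsPiecewiseContPeriodic ε)
    (hμ : IsPiecewiseContPeriodic μ) : ContDiff ℝ ∞ (discriminant ε μ) := by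
  rw [funext discriminant_eq]
  exact (contDiff_transferMatrix_energy hε hμ 0 0).add (contDiff_transferMatrix_energy hε hμ 1 1)

theorem integral_mode_quadratic (hε : IsPiecewiseContPeriodic ε)
    (hμ : IsPiecewiseContPeriodic μ) (E A B C : ℝ) :
    ∫ t in (0 : ℝ)..1, ε t * (A * (transferMatrix ε μ E t 0 0 * transferMatrix ε μ E t 0 0) +
      B * (transferMatrix ε μ E t 0 0 * transferMatrix ε μ E t 0 1) +
      C * (transferMatrix ε μ E t 0 1 * transferMatrix ε μ E t 0 1)) =
    A * modeGram ε μ E E 0 0 + B * modeGram ε μ E E 0 1 + C * modeGram ε μ E E 1 1 :=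
  hε.integral_quadratic (continuous_transferMatrix hε hμ E 0 0)
    (continuous_transferMatrix hε hμ E 0 1) A B C

theorem integral_flux_quadratic (hε : IsPiecewiseContPeriodic ε)
    (hμ : IsPiecewiseContPeriodic μ) (E A B C : ℝ) :
    ∫ t in (0 : ℝ)..1, μ t * (A * (transferMatrix ε μ E t 1 0 * transferMatrix ε μ E t 1 0) +
      B * (transferMatrix ε μ E t 1 0 * transferMatrix ε μ E t 1 1) +
      C * (transferMatrix ε μ E t 1 1 * transferMatrix ε μ E t 1 1)) =
    A * fluxGram ε μ E 0 0 + B * fluxGram ε μ E 0 1 + C * fluxGram ε μ E 1 1 :=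
  hμ.integral_quadratic (continuous_transferMatrix hε hμ E 1 0)
    (continuous_transferMatrix hε hμ E 1 1) A B C

/-- The Gram matrix of the normalized modes is positive definite. -/
theorem modeGram_posDef (hε : IsPiecewiseContPeriodic ε) (hμ : IsPiecewiseContPeriodic μ)
    {c : ℝ} (hc : 0 < c) (hεc : ∀ x, c ≤ ε x) (hμc : ∀ x, c ≤ μ x) (E : ℝ) {a b : ℝ}
    (hab : a ≠ 0 ∨ b ≠ 0) :
    0 < a ^ 2 * modeGram ε μ E E 0 0 + 2 * a * b * modeGram ε μ E E 0 1 +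
      b ^ 2 * modeGram ε μ E E 1 1 := by
  rw [← integral_mode_quadratic hε hμ]
  have e : ∀ t, a ^ 2 * (transferMatrix ε μ E t 0 0 * transferMatrix ε μ E t 0 0) +
      2 * a * b * (transferMatrix ε μ E t 0 0 * transferMatrix ε μ E t 0 1) +
      b ^ 2 * (transferMatrix ε μ E t 0 1 * transferMatrix ε μ E t 0 1) =
      (transferMatrix ε μ E t 0 0 * a + transferMatrix ε μ E t 0 1 * b) ^ 2 := fun t => by ring
  simp only [e]
  have c0 := continuous_transferMatrix hε hμ E 0 0
  have c1 := continuous_transferMatrix hε hμ E 0 1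
  refine hε.integral_mul_pos hc hεc (by fun_prop) (fun x => sq_nonneg _) ?_
  by_contra! hcon
  have hz : ∀ x ∈ Icc (0 : ℝ) 1,
      transferMatrix ε μ E x 0 0 * a + transferMatrix ε μ E x 0 1 * b = 0 := fun x hx =>
    pow_eq_zero_iff two_ne_zero |>.1 (le_antisymm (hcon x hx) (sq_nonneg _))
  have hs := ((transferMatrix_isSolution hε hμ E 0).smul_const a).add
    ((transferMatrix_isSolution hε hμ E 1).smul_const b)
  have h1 := hs.flux_zero_of_mode_zero hμ hc hμc (fun x hx => hz x hx)
  have h0 := hz 0 (by simp)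
  simp [transferMatrix_zero hε hμ] at h0 h1
  simp [h0, h1] at hab

/-- On the vector (-G01, G00) the positive definite form takes the value G00 · det G. -/
theorem modeGram_det_pos (hε : IsPiecewiseContPeriodic ε) (hμ : IsPiecewiseContPeriodic μ)
    {c : ℝ} (hc : 0 < c) (hεc : ∀ x, c ≤ ε x) (hμc : ∀ x, c ≤ μ x) (E : ℝ) :
    0 < modeGram ε μ E E 0 0 * modeGram ε μ E E 1 1 - modeGram ε μ E E 0 1 ^ 2 := by
  have h0 := modeGram_posDef hε hμ hc hεc hμc E (a := 1) (b := 0) (by simp)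
  simp only [one_pow, one_mul, mul_zero, zero_mul, add_zero, ne_eq, OfNat.ofNat_ne_zero,
    not_false_eq_true, zero_pow] at h0
  have h1 := modeGram_posDef hε hμ hc hεc hμc E (a := -modeGram ε μ E E 0 1)
    (b := modeGram ε μ E E 0 0) (Or.inr h0.ne')
  refine pos_of_mul_pos_right (a := modeGram ε μ E E 0 0) ?_ h0.le
  linarith

end

/-! ### Sign, monotonicity, folds and oscillation of the discriminant. -/

/-- The properties of the discriminant of a Hill operator on which band counting rests. -/
structure IsHillDiscriminant (D : ℝ → ℝ) : Prop where
  contDiff : ContDiff ℝ ∞ D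
  two_lt : ∀ E < 0, 2 < D E
  deriv_ne : ∀ E, |D E| < 2 → deriv D E ≠ 0
  neg_of_two : ∀ E, D E = 2 → deriv D E = 0 → deriv (deriv D) E < 0
  pos_of_neg_two : ∀ E, D E = -2 → deriv D E = 0 → 0 < deriv (deriv D) E
  oscillates : ∀ E₁, ∃ E ≥ E₁, 2 ≤ |D E|

section

variable {ε μ : ℝ → ℝ} {c : ℝ}

/-- The form is invariant under the monodromy matrix, so the boundary terms of the integrations by
parts cancel. Comparing the signs of both sides restricts the sign of `E`. -/
theorem fluxGram_quadratic (hε : IsPiecewiseContPeriodic ε) (hμ : IsPiecewiseContPeriodic μ)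
    (E : ℝ) :
    E * (transferMatrix ε μ E 1 0 1 * modeGram ε μ E E 0 0 +
      (transferMatrix ε μ E 1 1 1 - transferMatrix ε μ E 1 0 0) * modeGram ε μ E E 0 1 +
      (-transferMatrix ε μ E 1 1 0) * modeGram ε μ E E 1 1) =
    transferMatrix ε μ E 1 0 1 * fluxGram ε μ E 0 0 +
      (transferMatrix ε μ E 1 1 1 - transferMatrix ε μ E 1 0 0) * fluxGram ε μ E 0 1 +
      (-transferMatrix ε μ E 1 1 0) * fluxGram ε μ E 1 1 := by
  have d := transferMatrix_det hε hμ E 1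
  have h00 := fluxGram_sub_modeGram hε hμ E 0 0
  have h01 := fluxGram_sub_modeGram hε hμ E 0 1
  have h11 := fluxGram_sub_modeGram hε hμ E 1 1
  simp only [Matrix.one_apply, Fin.isValue, ↓reduceIte, zero_ne_one, one_ne_zero] at h00 h01 h11
  linear_combination (-transferMatrix ε μ E 1 0 1) * h00 -
    (transferMatrix ε μ E 1 1 1 - transferMatrix ε μ E 1 0 0) * h01 +
    transferMatrix ε μ E 1 1 0 * h11 -
    (transferMatrix ε μ E 1 1 1 - transferMatrix ε μ E 1 0 0) * d

theorem transferMatrix_eq_scalar (hε : IsPiecewiseContPeriodic ε)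
    (hμ : IsPiecewiseContPeriodic μ) {E : ℝ} (h01 : transferMatrix ε μ E 1 0 1 = 0)
    (h10 : transferMatrix ε μ E 1 1 0 = 0)
    (h : transferMatrix ε μ E 1 0 0 = transferMatrix ε μ E 1 1 1) :
    transferMatrix ε μ E 1 = 1 ∨ transferMatrix ε μ E 1 = -1 := by
  have d := transferMatrix_det hε hμ E 1
  rw [h01, h, zero_mul, sub_zero] at d
  rcases mul_self_eq_one_iff.1 d with d | d
  · left
    ext i j
    fin_cases i <;> fin_cases j <;> simp [h01, h10, h, d]
  · right
    ext i j
    fin_cases i <;> fin_cases j <;> simp [h01, h10, h, d]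

/-- For |D| ≤ 2 the form in `deriv_discriminant` is semidefinite, its discriminant being D² - 4 ≤ 0.
The witness is minus a nonzero diagonal coefficient of it, so that s · D' is the integral of a
nonnegative form over the modes; the second inequality is the same for the fluxes. -/
theorem exists_semidefinite (hε : IsPiecewiseContPeriodic ε) (hμ : IsPiecewiseContPeriodic μ)
    (hc : 0 < c) (hεc : ∀ x, c ≤ ε x) (hμc : ∀ x, c ≤ μ x) {E : ℝ}
    (hD : |discriminant ε μ E| ≤ 2)
    (hM : ¬(transferMatrix ε μ E 1 = 1 ∨ transferMatrix ε μ E 1 = -1)) :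
    ∃ s : ℝ, 0 < s * deriv (discriminant ε μ) E ∧ 0 ≤ E * (s * deriv (discriminant ε μ) E) := by
  have d := transferMatrix_det hε hμ E 1
  have hD' := abs_le.1 hD
  rw [discriminant_eq] at hD'
  rw [deriv_discriminant hε hμ]
  have hE := fluxGram_quadratic hε hμ E
  have cT := continuous_transferMatrix hε hμ E
  have z0 := transferMatrix_zero hε hμ E
  have hG := modeGram_posDef hε hμ hc hεc hμc E (a := 0) (b := 1) (by simp)
  have hF : 0 ≤ fluxGram ε μ E 1 1 := IsPiecewiseContPeriodic.integral_mul_nonneg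
    (fun x => hc.le.trans (hμc x)) fun x => mul_self_nonneg _
  set m00 := transferMatrix ε μ E 1 0 0
  set m01 := transferMatrix ε μ E 1 0 1 with hm01
  set m10 := transferMatrix ε μ E 1 1 0 with hm10
  set m11 := transferMatrix ε μ E 1 1 1
  have hdisc : 0 ≤ -(4 * m01 * m10) - (m11 - m00) ^ 2 := by
    have : -(4 * m01 * m10) - (m11 - m00) ^ 2 = (2 - (m00 + m11)) * (2 + (m00 + m11)) := by
      linear_combination 4 * d
    rw [this]
    exact mul_nonneg (by linarith) (by linarith)
  -- If m01 = 0, then semidefiniteness forces m11 = m00, and -m10 is the only coefficient left.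
  by_cases h01 : m01 = 0
  · have hdiff : m11 - m00 = 0 := by
      rw [h01, mul_zero, zero_mul] at hdisc
      exact pow_eq_zero_iff two_ne_zero |>.1 (le_antisymm (by linarith) (sq_nonneg _))
    have h10 : m10 ≠ 0 := fun h10 =>
      hM (transferMatrix_eq_scalar hε hμ h01 h10 (by linarith))
    refine ⟨m10, ?_, ?_⟩
    · rw [h01, hdiff]
      have : 0 < m10 ^ 2 := by positivity
      nlinarith
    · have e : E * (m10 * -(m01 * modeGram ε μ E E 0 0 + (m11 - m00) * modeGram ε μ E E 0 1 +
          -m10 * modeGram ε μ E E 1 1)) = m10 ^ 2 * fluxGram ε μ E 1 1 := by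
        rw [h01, hdiff] at hE ⊢
        linear_combination (-m10) * hE
      rw [e]
      positivity
  · have hQ : ∀ u v : ℝ, 0 ≤ m01 * m01 * (u * u) + m01 * (m11 - m00) * (u * v) +
        m01 * -m10 * (v * v) := by
      intro u v
      have : m01 * m01 * (u * u) + m01 * (m11 - m00) * (u * v) + m01 * -m10 * (v * v) =
          (m01 * u + (m11 - m00) / 2 * v) ^ 2 +
            (-(4 * m01 * m10) - (m11 - m00) ^ 2) / 4 * v ^ 2 := by ring
      rw [this]
      positivity
    refine ⟨-m01, ?_, ?_⟩
    · have := hε.integral_mul_pos hc hεc (w := fun t =>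
        m01 * m01 * (transferMatrix ε μ E t 0 0 * transferMatrix ε μ E t 0 0) +
        m01 * (m11 - m00) * (transferMatrix ε μ E t 0 0 * transferMatrix ε μ E t 0 1) +
        m01 * -m10 * (transferMatrix ε μ E t 0 1 * transferMatrix ε μ E t 0 1))
        (by have := cT 0 0; have := cT 0 1; fun_prop) (fun x => hQ _ _)
        ⟨0, by simp, by
          simp only [z0]
          simp only [Matrix.one_apply_eq, mul_one, ne_eq, zero_ne_one, not_false_eq_true,
            Matrix.one_apply_ne, mul_zero, add_zero]
          exact mul_self_pos.2 h01⟩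
      rw [integral_mode_quadratic hε hμ] at this
      linarith
    · have := IsPiecewiseContPeriodic.integral_mul_nonneg (fun x => hc.le.trans (hμc x))
        (fun x => hQ (transferMatrix ε μ E x 1 0) (transferMatrix ε μ E x 1 1))
      rw [integral_flux_quadratic hε hμ] at this
      linear_combination this - m01 * hE

theorem deriv_discriminant_eq_zero (hε : IsPiecewiseContPeriodic ε)
    (hμ : IsPiecewiseContPeriodic μ) {E : ℝ}
    (hM : transferMatrix ε μ E 1 = 1 ∨ transferMatrix ε μ E 1 = -1) :
    deriv (discriminant ε μ) E = 0 := by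
  rw [deriv_discriminant hε hμ]
  rcases hM with hM | hM <;> simp [hM]

theorem deriv_discriminant_eq_zero_iff (hε : IsPiecewiseContPeriodic ε)
    (hμ : IsPiecewiseContPeriodic μ)
    (hc : 0 < c) (hεc : ∀ x, c ≤ ε x) (hμc : ∀ x, c ≤ μ x) {E : ℝ}
    (hD : |discriminant ε μ E| ≤ 2) : deriv (discriminant ε μ) E = 0 ↔
    transferMatrix ε μ E 1 = 1 ∨ transferMatrix ε μ E 1 = -1 := by
  refine ⟨fun h => ?_, deriv_discriminant_eq_zero hε hμ⟩
  by_contra hM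
  obtain ⟨s, hs, -⟩ := exists_semidefinite hε hμ hc hεc hμc hD hM
  simp [h] at hs

/-- If M = ±1, the boundary terms vanish and ∫ μφ² = E ∫ εψ² for the first normalized solution,
impossible for E < 0; otherwise `exists_semidefinite` applies. -/
theorem two_lt_abs_discriminant (hε : IsPiecewiseContPeriodic ε)
    (hμ : IsPiecewiseContPeriodic μ) (hc : 0 < c) (hεc : ∀ x, c ≤ ε x) (hμc : ∀ x, c ≤ μ x)
    {E : ℝ} (hE : E < 0) : 2 < |discriminant ε μ E| := by
  by_contra! hD
  by_cases hM : transferMatrix ε μ E 1 = 1 ∨ transferMatrix ε μ E 1 = -1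
  · have h00 := fluxGram_sub_modeGram hε hμ E 0 0
    have hz : transferMatrix ε μ E 1 1 0 = 0 := by rcases hM with hM | hM <;> simp [hM]
    simp only [hz, Matrix.one_apply, Fin.isValue, ↓reduceIte, one_ne_zero, mul_zero,
      sub_zero] at h00
    have hF : 0 ≤ fluxGram ε μ E 0 0 := IsPiecewiseContPeriodic.integral_mul_nonneg
      (fun x => hc.le.trans (hμc x)) fun x => mul_self_nonneg _
    have hG := modeGram_posDef hε hμ hc hεc hμc E (a := 1) (b := 0) (by simp)
    nlinarith
  · obtain ⟨s, h1, h2⟩ := exists_semidefinite hε hμ hc hεc hμc hD hM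
    nlinarith

theorem discriminant_zero (hε : IsPiecewiseContPeriodic ε) (hμ : IsPiecewiseContPeriodic μ) :
    discriminant ε μ 0 = 2 := by
  have h0 := (transferMatrix_isSolution hε hμ 0 0)
  have h1 := (transferMatrix_isSolution hε hμ 0 1)
  have f1 := h1.flux_eq 1
  have f0 : ∀ x, transferMatrix ε μ 0 x 1 0 = 0 := fun x => by
    have := h0.flux_eq x
    simpa [transferMatrix_zero hε hμ] using this
  have m0 := h0.mode_eq 1
  simp [transferMatrix_zero hε hμ, f0] at m0 f1
  rw [discriminant_eq, m0, f1]
  norm_num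

/-- A value below -2 would, because D(0) = 2, force a zero of D at a negative energy. -/
theorem two_lt_discriminant (hε : IsPiecewiseContPeriodic ε)
    (hμ : IsPiecewiseContPeriodic μ) (hc : 0 < c) (hεc : ∀ x, c ≤ ε x) (hμc : ∀ x, c ≤ μ x)
    {E : ℝ} (hE : E < 0) : 2 < discriminant ε μ E := by
  rcases lt_abs.1 (two_lt_abs_discriminant hε hμ hc hεc hμc hE) with h | h
  · exact h
  have hcont := (contDiff_discriminant hε hμ).continuous
  have h0 := discriminant_zero hε hμ
  obtain ⟨x, hx, hx0⟩ := intermediate_value_Icc hE.le hcont.continuousOn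
    (show (0 : ℝ) ∈ Icc (discriminant ε μ E) (discriminant ε μ 0) from
      ⟨by linarith, by linarith⟩)
  have hx' : x < 0 := lt_of_le_of_ne hx.2 fun h => by
    rw [h, h0] at hx0
    norm_num at hx0
  have := two_lt_abs_discriminant hε hμ hc hεc hμc hx'
  rw [hx0] at this
  norm_num at this

/-- On a pair of vectors of determinant one, q(v) q(v') = b(v, v')² + (4 - D²)/4, where b is the
polar form of q. The sign `s` makes the leading coefficient m01 positive. -/
theorem exists_sign_definite {m00 m01 m10 m11 : ℝ} (d : m00 * m11 - m01 * m10 = 1)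
    (hD : |m00 + m11| < 2) : ∃ s : ℝ, |s| = 1 ∧
      (∀ u v, 0 ≤ s * m01 * (u * u) + s * (m11 - m00) * (u * v) + s * -m10 * (v * v)) ∧
      ∀ u v u' v', u * v' - v * u' = 1 → (4 - (m00 + m11) ^ 2) / 4 ≤
        (s * m01 * (u * u) + s * (m11 - m00) * (u * v) + s * -m10 * (v * v)) *
        (s * m01 * (u' * u') + s * (m11 - m00) * (u' * v') + s * -m10 * (v' * v')) := by
  obtain ⟨hD1, hD2⟩ := abs_lt.1 hD
  have hD0 : 0 < 4 - (m00 + m11) ^ 2 := by nlinarith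
  have hdisc : -(4 * m01 * m10) - (m11 - m00) ^ 2 = 4 - (m00 + m11) ^ 2 := by
    linear_combination 4 * d
  have h01 : m01 ≠ 0 := by
    rintro h
    rw [h] at hdisc
    nlinarith [sq_nonneg (m11 - m00)]
  obtain ⟨s, hs, hsm⟩ : ∃ s : ℝ, |s| = 1 ∧ 0 < s * m01 := by
    rcases lt_or_gt_of_ne h01 with h | h
    · exact ⟨-1, by simp, by linarith⟩
    · exact ⟨1, by simp, by linarith⟩
  have hs2 : s ^ 2 = 1 := by rw [← sq_abs, hs, one_pow]
  refine ⟨s, hs, fun u v => ?_, fun u v u' v' hdet => ?_⟩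
  · have h1 : (s * m01) * (s * m01 * (u * u) + s * (m11 - m00) * (u * v) + s * -m10 * (v * v)) =
        s ^ 2 * ((m01 * u + (m11 - m00) / 2 * v) ^ 2 + (4 - (m00 + m11) ^ 2) / 4 * v ^ 2) := by
      linear_combination (s ^ 2 * v ^ 2 / 4) * hdisc
    refine nonneg_of_mul_nonneg_right (a := s * m01) ?_ hsm
    rw [h1]
    positivity
  · have h1 : (s * m01 * (u * u) + s * (m11 - m00) * (u * v) + s * -m10 * (v * v)) *
        (s * m01 * (u' * u') + s * (m11 - m00) * (u' * v') + s * -m10 * (v' * v')) =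
        s ^ 2 * ((m01 * (u * u') + (m11 - m00) / 2 * (u * v' + v * u') + -m10 * (v * v')) ^ 2 +
        (4 - (m00 + m11) ^ 2) / 4 * (u * v' - v * u') ^ 2) := by
      linear_combination (s ^ 2 * (u * v' - v * u') ^ 2 / 4) * hdisc
    rw [h1, hs2, hdet]
    nlinarith [sq_nonneg (m01 * (u * u') +
        (m11 - m00) / 2 * (u * v' + v * u') + -m10 * (v * v'))]

/-- The arithmetic mean dominates the geometric mean 2 √(E e m A B), and e m ≥ c², A B ≥ r²/4. -/
theorem weighted_am_gm {E c e m A B r : ℝ} (hE : 0 < E) (hc : 0 < c) (he : c ≤ e) (hm : c ≤ m)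
    (hA : 0 ≤ A) (hB : 0 ≤ B) (hr : r * r / 4 ≤ A * B) :
    √E * c * r ≤ E * (e * A) + m * B := by
  have hsE : √E * √E = E := Real.mul_self_sqrt hE.le
  have he0 : 0 ≤ e := hc.le.trans he
  have hm0 : 0 ≤ m := hc.le.trans hm
  have h1 : E * (c * c) * (r * r / 4) ≤ (E * (e * A)) * (m * B) := by
    have h2 : c * c ≤ e * m := mul_le_mul he hm hc.le he0
    have h3 : 0 ≤ r * r / 4 := by have := mul_self_nonneg r; linarith
    calc E * (c * c) * (r * r / 4) ≤ E * (e * m) * (A * B) := by gcongr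
      _ = _ := by ring
  have h2 : 0 ≤ E * (e * A) + m * B := by positivity
  refine le_of_sq_le_sq ?_ h2
  have h3 : (√E * c * r) ^ 2 = 4 * (E * (c * c) * (r * r / 4)) := by
    linear_combination (c * r) ^ 2 * hsE
  rw [h3]
  nlinarith [sq_nonneg (E * (e * A) - m * B)]

/-- A lower bound for the slope of the discriminant inside a band. -/
theorem le_abs_deriv_discriminant (hε : IsPiecewiseContPeriodic ε)
    (hμ : IsPiecewiseContPeriodic μ) (hc : 0 < c) (hεc : ∀ x, c ≤ ε x) (hμc : ∀ x, c ≤ μ x)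
    {E : ℝ} (hE : 0 < E) (hD : |discriminant ε μ E| < 2) :
    c * √(4 - discriminant ε μ E ^ 2) ≤ 2 * √E * |deriv (discriminant ε μ) E| := by
  have dx := transferMatrix_det hε hμ E
  rw [deriv_discriminant hε hμ]
  have hEq := fluxGram_quadratic hε hμ E
  have hD0 : 0 ≤ 4 - discriminant ε μ E ^ 2 := by
    obtain ⟨hD1, hD2⟩ := abs_lt.1 hD
    nlinarith
  rw [discriminant_eq] at hD hD0 ⊢
  have cT := continuous_transferMatrix hε hμ E
  obtain ⟨s, hs, hQ0, hQQ⟩ := exists_sign_definite (dx 1) hD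
  set m00 := transferMatrix ε μ E 1 0 0
  set m01 := transferMatrix ε μ E 1 0 1
  set m10 := transferMatrix ε μ E 1 1 0
  set m11 := transferMatrix ε μ E 1 1 1
  set r := √(4 - (m00 + m11) ^ 2) with hr
  have hrr : r * r = 4 - (m00 + m11) ^ 2 := Real.mul_self_sqrt hD0
  -- The rows of the transfer matrix at `t` have determinant one, so the values of the form on modes
  -- and fluxes have product at least r²/4.
  have hpt := fun t => weighted_am_gm (r := r) hE hc (hεc t) (hμc t)
    (hQ0 (transferMatrix ε μ E t 0 0) (transferMatrix ε μ E t 0 1))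
    (hQ0 (transferMatrix ε μ E t 1 0) (transferMatrix ε μ E t 1 1))
    (by rw [hrr]; exact hQQ _ _ _ _ (dx t))
  have hcont : ∀ i, Continuous fun t =>
      s * m01 * (transferMatrix ε μ E t i 0 * transferMatrix ε μ E t i 0) +
      s * (m11 - m00) * (transferMatrix ε μ E t i 0 * transferMatrix ε μ E t i 1) +
      s * -m10 * (transferMatrix ε μ E t i 1 * transferMatrix ε μ E t i 1) := fun i => by
    have := cT i 0
    have := cT i 1
    fun_prop
  have i1 := (hε.intervalIntegrable_mul (hcont 0) 0 1).const_mul E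
  have i2 := (hμ.intervalIntegrable_mul (hcont 1) 0 1)
  have hint := intervalIntegral.integral_mono_on (zero_le_one (α := ℝ))
    (_root_.intervalIntegrable_const (c := √E * c * r)) (i1.add i2) fun t _ => hpt t
  rw [intervalIntegral.integral_add i1 i2, intervalIntegral.integral_const_mul E,
    integral_mode_quadratic hε hμ, integral_flux_quadratic hε hμ,
    intervalIntegral.integral_const, sub_zero, one_smul] at hint
  set q := m01 * modeGram ε μ E E 0 0 + (m11 - m00) * modeGram ε μ E E 0 1 +
    -m10 * modeGram ε μ E E 1 1 with hq
  have hsE : √E * √E = E := Real.mul_self_sqrt hE.le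
  -- By `fluxGram_quadratic` the flux integral is E times the mode integral, so their weighted sum
  -- is 2E s q.
  have h5 : √E * (c * r) ≤ √E * (2 * √E * (s * q)) := by
    calc _ = √E * c * r := by ring
      _ ≤ _ := hint
      _ = 2 * E * (s * q) := by linear_combination (-s) * hEq
      _ = _ := by linear_combination (-2 * (s * q)) * hsE
  have h6 : s * q ≤ |q| := by
    calc s * q ≤ |s * q| := le_abs_self _
      _ = |q| := by rw [abs_mul, hs, one_mul]
  rw [abs_neg]
  calc c * r ≤ 2 * √E * (s * q) := le_of_mul_le_mul_left h5 (Real.sqrt_pos.2 hE)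
    _ ≤ _ := by gcongr

/-- If |D| stayed below 2, the slope of arcsin (D/2) would be at least c/(2√E) in absolute value. By
the mean value theorem its increments would grow like √E, yet they are bounded by π. -/
theorem discriminant_oscillates (hε : IsPiecewiseContPeriodic ε)
    (hμ : IsPiecewiseContPeriodic μ) (hc : 0 < c) (hεc : ∀ x, c ≤ ε x) (hμc : ∀ x, c ≤ μ x)
    (E₁ : ℝ) : ∃ E ≥ E₁, 2 ≤ |discriminant ε μ E| := by
  by_contra! hcon
  set a : ℝ := max E₁ 1
  have ha : 1 ≤ a := le_max_right _ _
  have hlt : ∀ E ≥ a, |discriminant ε μ E| < 2 := fun E hE =>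
    hcon E ((le_max_left _ _).trans hE)
  have hder : ∀ E ≥ a, HasDerivAt (fun E => Real.arcsin (discriminant ε μ E / 2))
      (1 / √(1 - (discriminant ε μ E / 2) ^ 2) * (deriv (discriminant ε μ) E / 2)) E := by
    intro E hE
    obtain ⟨h1, h2⟩ := abs_lt.1 (hlt E hE)
    have hd : HasDerivAt (discriminant ε μ) (deriv (discriminant ε μ) E) E :=
      ((contDiff_discriminant hε hμ).differentiable (by simp)).differentiableAt.hasDerivAt
    exact (Real.hasDerivAt_arcsin (by linarith) (by linarith)).comp E (hd.div_const 2)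
  have hbound : ∀ E ≥ a, c / (2 * √E) ≤
      |1 / √(1 - (discriminant ε μ E / 2) ^ 2) * (deriv (discriminant ε μ) E / 2)| := by
    intro E hE
    have hE0 : 0 < E := by linarith
    have hsE0 : 0 < √E := Real.sqrt_pos.2 hE0
    obtain ⟨h1, h2⟩ := abs_lt.1 (hlt E hE)
    have h3 := le_abs_deriv_discriminant hε hμ hc hεc hμc hE0 (hlt E hE)
    have h4 : √(4 - discriminant ε μ E ^ 2) = 2 * √(1 - (discriminant ε μ E / 2) ^ 2) := by
      have : 4 - discriminant ε μ E ^ 2 = 2 ^ 2 * (1 - (discriminant ε μ E / 2) ^ 2) := by ring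
      rw [this, Real.sqrt_mul (by norm_num), Real.sqrt_sq (by norm_num)]
    have h5 : 0 < √(1 - (discriminant ε μ E / 2) ^ 2) := Real.sqrt_pos.2 (by nlinarith)
    rw [h4] at h3
    generalize √(1 - (discriminant ε μ E / 2) ^ 2) = w at h3 h5 ⊢
    rw [abs_mul, abs_div, abs_div, abs_one, abs_of_pos h5, abs_of_pos (two_pos : (0 : ℝ) < 2)]
    rw [div_le_iff₀ (by positivity)]
    calc c = c * (2 * w) / (2 * w) := by field_simp
      _ ≤ 2 * √E * |deriv (discriminant ε μ) E| / (2 * w) := by gcongr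
      _ = _ := by field_simp
  have hgrow : ∀ E > a, c * (E - a) ≤ 2 * √E * Real.pi := by
    intro E hE
    have hE0 : 0 < E := by linarith
    have hsE0 : 0 < √E := Real.sqrt_pos.2 hE0
    obtain ⟨ξ, hξ, hmvt⟩ := exists_hasDerivAt_eq_slope
      (fun E => Real.arcsin (discriminant ε μ E / 2)) _ hE
      (fun x hx => (hder x hx.1).continuousAt.continuousWithinAt)
      (fun x hx => hder x hx.1.le)
    have h1 := hbound ξ hξ.1.le
    rw [hmvt] at h1
    have h2 : c / (2 * √E) ≤ c / (2 * √ξ) := by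
      have : 0 < √ξ := Real.sqrt_pos.2 (by linarith [hξ.1])
      have := Real.sqrt_le_sqrt hξ.2.le
      gcongr
    have h3 := h2.trans h1
    have hEa : 0 < E - a := by linarith
    rw [abs_div, abs_of_pos hEa, div_le_div_iff₀ (by positivity) hEa] at h3
    have h4 : |Real.arcsin (discriminant ε μ E / 2) - Real.arcsin (discriminant ε μ a / 2)|
        ≤ Real.pi := by
      rw [abs_le]
      constructor <;>
      linarith [Real.arcsin_le_pi_div_two (discriminant ε μ E / 2),
        Real.neg_pi_div_two_le_arcsin (discriminant ε μ E / 2),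
        Real.arcsin_le_pi_div_two (discriminant ε μ a / 2),
        Real.neg_pi_div_two_le_arcsin (discriminant ε μ a / 2)]
    calc c * (E - a) ≤ _ := h3
      _ ≤ Real.pi * (2 * √E) := by gcongr
      _ = _ := by ring
  -- The contradiction is read off at E = s², where the growth bound becomes c(s² - a) ≤ 2πs.
  set s : ℝ := a + 2 * Real.pi / c + 1
  have hpi := Real.pi_pos
  have hs : 1 ≤ s := by
    have : 0 < 2 * Real.pi / c := by positivity
    simp only [s]
    linarith
  have hsa : a < s ^ 2 := by
    have : 0 < 2 * Real.pi / c := by positivity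
    have : a < s := by simp only [s]; linarith
    nlinarith
  have := hgrow (s ^ 2) hsa
  rw [Real.sqrt_sq (by linarith)] at this
  have h7 : c * s = c * a + 2 * Real.pi + c := by
    simp only [s]
    field_simp
  have h8 : c * s ^ 2 = c * a * s + 2 * Real.pi * s + c * s := by linear_combination s * h7
  have h9 : 0 ≤ c * a * (s - 1) := mul_nonneg (by positivity) (by linarith)
  have h10 : 0 < c * s := by positivity
  linarith

/-- Differentiating det M = 1 twice at M = s·1 gives s tr M'' + 2 det M' = 0, and det M' is the Gram
determinant. -/
theorem deriv_deriv_discriminant (hε : IsPiecewiseContPeriodic ε)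
    (hμ : IsPiecewiseContPeriodic μ) {E s : ℝ} (hs : s ^ 2 = 1)
    (hM : transferMatrix ε μ E 1 = s • 1) :
    deriv (deriv (discriminant ε μ)) E = -(2 * s) *
      (modeGram ε μ E E 0 0 * modeGram ε μ E E 1 1 - modeGram ε μ E E 0 1 ^ 2) := by
  set f : Fin 2 → Fin 2 → ℝ → ℝ := fun i j E' => transferMatrix ε μ E' 1 i j with hf
  have hfc : ∀ i j, ContDiff ℝ ∞ (f i j) := contDiff_transferMatrix_energy hε hμ
  have hd1 : ∀ i j E', HasDerivAt (f i j) (deriv (f i j) E') E' := fun i j E' =>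
    ((hfc i j).differentiable (by simp)).differentiableAt.hasDerivAt
  have hd2 : ∀ i j, HasDerivAt (deriv (f i j)) (deriv (deriv (f i j)) E) E := fun i j =>
    (((contDiff_infty_iff_deriv.1 (hfc i j)).2).differentiable
      (by simp)).differentiableAt.hasDerivAt
  have e1 : ∀ E', deriv (f 0 0) E' * f 1 1 E' + f 0 0 E' * deriv (f 1 1) E' -
      (deriv (f 0 1) E' * f 1 0 E' + f 0 1 E' * deriv (f 1 0) E') = 0 := by
    intro E'
    have h1 := ((hd1 0 0 E').mul (hd1 1 1 E')).sub ((hd1 0 1 E').mul (hd1 1 0 E'))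
    have h2 : (f 0 0 * f 1 1 - f 0 1 * f 1 0) = fun _ => 1 :=
      funext fun E'' => transferMatrix_det hε hμ E'' 1
    rw [h2] at h1
    exact h1.unique (hasDerivAt_const _ _)
  have e2 := (((hd2 0 0).mul (hd1 1 1 E)).add ((hd1 0 0 E).mul (hd2 1 1))).sub
    (((hd2 0 1).mul (hd1 1 0 E)).add ((hd1 0 1 E).mul (hd2 1 0)))
  have e3 : (deriv (f 0 0) * f 1 1 + f 0 0 * deriv (f 1 1) -
      (deriv (f 0 1) * f 1 0 + f 0 1 * deriv (f 1 0))) = fun _ => 0 := funext e1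
  rw [e3] at e2
  have e4 := e2.unique (hasDerivAt_const _ _)
  have e5 : deriv (discriminant ε μ) = deriv (f 0 0) + deriv (f 1 1) := by
    have : discriminant ε μ = f 0 0 + f 1 1 := funext fun E' => discriminant_eq E'
    rw [this]
    funext E'
    exact ((hd1 0 0 E').add (hd1 1 1 E')).deriv
  rw [e5, ((hd2 0 0).add (hd2 1 1)).deriv]
  have g : ∀ i j, deriv (f i j) E = transferMatrix ε μ E 1 i 0 * modeGram ε μ E E 1 j -
        transferMatrix ε μ E 1 i 1 * modeGram ε μ E E 0 j := fun i j =>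
    (hasDerivAt_transferMatrix hε hμ E i j).deriv
  have fv : ∀ i j, f i j E = transferMatrix ε μ E 1 i j := fun i j => rfl
  simp only [g, fv, hM, Matrix.smul_apply, Matrix.one_apply, Fin.isValue, ↓reduceIte, zero_ne_one,
    one_ne_zero, smul_eq_mul, mul_one, mul_zero, zero_mul, sub_zero, zero_sub, add_zero,
    zero_add, modeGram_comm E 1 0] at e4
  linear_combination s * e4 + (-(deriv (deriv (f 0 0)) E + deriv (deriv (f 1 1)) E) +
    2 * s * (modeGram ε μ E E 0 1 ^ 2 - modeGram ε μ E E 0 0 * modeGram ε μ E E 1 1)) * hs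

theorem isHillDiscriminant (hε : IsPiecewiseContPeriodic ε)
    (hμ : IsPiecewiseContPeriodic μ) (hc : 0 < c) (hεc : ∀ x, c ≤ ε x) (hμc : ∀ x, c ≤ μ x) :
    IsHillDiscriminant (discriminant ε μ) where
  contDiff := contDiff_discriminant hε hμ
  two_lt E hE := two_lt_discriminant hε hμ hc hεc hμc hE
  deriv_ne E hE h := by
    rcases (deriv_discriminant_eq_zero_iff hε hμ hc hεc hμc hE.le).1 h with hM | hM <;>
    · rw [discriminant_eq, hM] at hE
      norm_num at hE
  neg_of_two E hE h := by
    have hpos := modeGram_det_pos hε hμ hc hεc hμc E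
    rcases (deriv_discriminant_eq_zero_iff hε hμ hc hεc hμc (by rw [hE]; norm_num)).1 h with
      hM | hM
    · rw [deriv_deriv_discriminant hε hμ (s := 1) (by norm_num) (by simpa using hM)]
      linarith
    · rw [discriminant_eq, hM] at hE
      norm_num at hE
  pos_of_neg_two E hE h := by
    have hpos := modeGram_det_pos hε hμ hc hεc hμc E
    rcases (deriv_discriminant_eq_zero_iff hε hμ hc hεc hμc (by rw [hE]; norm_num)).1 h with
      hM | hM
    · rw [discriminant_eq, hM] at hE
      norm_num at hE
    · rw [deriv_deriv_discriminant hε hμ (s := -1) (by norm_num) (by simpa using hM)]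
      linarith
  oscillates := discriminant_oscillates hε hμ hc hεc hμc

end

/-! ### Bloch spaces: dimension and orthogonality. -/

theorem finrank_finset_sup {𝕜 V ι : Type*} [Field 𝕜] [AddCommGroup V] [Module 𝕜 V]
    [DecidableEq ι] (W : ι → Submodule 𝕜 V) [∀ i, FiniteDimensional 𝕜 (W i)]
    (h : ∀ (s : Finset ι) (a : ι), a ∉ s → Disjoint (s.sup W) (W a)) (s : Finset ι) :
    Module.finrank 𝕜 ↥(s.sup W) = ∑ i ∈ s, Module.finrank 𝕜 (W i) := by
  induction s using Finset.induction_on with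
  | empty => simp
  | insert a s ha ih =>
    have h1 := Submodule.finrank_sup_add_finrank_inf_eq (W a) (s.sup W)
    rw [(h s a ha).symm.eq_bot, finrank_bot, add_zero] at h1
    rw [Finset.sup_insert, Finset.sum_insert ha, h1, ih]

namespace IsSolution

variable {F : Type*} [NormedAddCommGroup F] [NormedSpace ℝ F]
  {ε μ : ℝ → ℝ} {E : ℝ} {ψ φ : ℝ → F}

theorem shift (hε : Function.Periodic ε 1) (hμ : Function.Periodic μ 1)
    (h : IsSolution ε μ E ψ φ) :
    IsSolution ε μ E (fun x => ψ (x + 1)) (fun x => φ (x + 1)) where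
  integrable_flux x := by
    have := (h.intervalIntegrable_flux (0 + 1) (x + 1)).comp_add_right 1
    simpa [hμ _] using this
  integrable_mode x := by
    have := (h.intervalIntegrable_mode (0 + 1) (x + 1)).comp_add_right 1
    simpa [hε _] using this
  mode_eq x := by
    have h1 : ∫ t in (0 : ℝ)..x, μ t • φ (t + 1) = ∫ t in (0 + 1 : ℝ)..(x + 1), μ t • φ t := by
      rw [← intervalIntegral.integral_comp_add_right (fun t => μ t • φ t)]
      simp only [hμ _]
    rw [h1, h.mode_eq (x + 1), h.mode_eq (0 + 1), add_assoc,
      intervalIntegral.integral_add_adjacent_intervals (h.intervalIntegrable_flux _ _)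
        (h.intervalIntegrable_flux _ _)]
  flux_eq x := by
    have h1 : ∫ t in (0 : ℝ)..x, (E * ε t) • ψ (t + 1) =
        ∫ t in (0 + 1 : ℝ)..(x + 1), (E * ε t) • ψ t := by
      rw [← intervalIntegral.integral_comp_add_right (fun t => (E * ε t) • ψ t)]
      simp only [hε _]
    rw [h1, h.flux_eq (x + 1), h.flux_eq (0 + 1), sub_sub,
      intervalIntegral.integral_add_adjacent_intervals (h.intervalIntegrable_mode _ _)
        (h.intervalIntegrable_mode _ _)]

theorem conj_comp {ψ φ : ℝ → ℂ} (h : IsSolution ε μ E ψ φ) :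
    IsSolution ε μ E (fun x => conj (ψ x)) (fun x => conj (φ x)) where
  integrable_flux x := by
    have := h.integrable_flux x
    rw [intervalIntegrable_iff] at this ⊢
    have h2 := (Complex.conjLIE.integrable_comp_iff (μ := volume.restrict (uIoc 0 x))).2 this
    simpa [Function.comp_def, IntegrableOn] using h2
  integrable_mode x := by
    have := h.integrable_mode x
    rw [intervalIntegrable_iff] at this ⊢
    have h2 := (Complex.conjLIE.integrable_comp_iff (μ := volume.restrict (uIoc 0 x))).2 this
    simpa [Function.comp_def, IntegrableOn] using h2
  mode_eq x := by
    rw [h.mode_eq x, map_add, ← intervalIntegral.intervalIntegral_conj]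
    simp
  flux_eq x := by
    rw [h.flux_eq x, map_sub, ← intervalIntegral.intervalIntegral_conj]
    simp

end IsSolution

section

variable {ε μ : ℝ → ℝ} {c : ℝ}

/-- The complex solution with initial values `v`. -/
noncomputable def solutionMode (ε μ : ℝ → ℝ) (E : ℝ) : (Fin 2 → ℂ) →ₗ[ℂ] (ℝ → ℂ) where
  toFun v x := transferMatrix ε μ E x 0 0 • v 0 + transferMatrix ε μ E x 0 1 • v 1
  map_add' v w := by
    funext x
    simp only [Pi.add_apply, smul_add]
    abel
  map_smul' r v := by
    funext x
    simp only [Pi.smul_apply, smul_eq_mul, RingHom.id_apply, Complex.real_smul]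
    ring

theorem solutionMode_isSolution (hε : IsPiecewiseContPeriodic ε)
    (hμ : IsPiecewiseContPeriodic μ) (E : ℝ) (v : Fin 2 → ℂ) :
    IsSolution ε μ E (solutionMode ε μ E v) (fun x =>
      transferMatrix ε μ E x 1 0 • v 0 + transferMatrix ε μ E x 1 1 • v 1) :=
  ((transferMatrix_isSolution hε hμ E 0).smul_const (v 0)).add
    ((transferMatrix_isSolution hε hμ E 1).smul_const (v 1))

theorem solutionMode_apply (E : ℝ) (v : Fin 2 → ℂ) (x : ℝ) : solutionMode ε μ E v x =
    transferMatrix ε μ E x 0 0 • v 0 + transferMatrix ε μ E x 0 1 • v 1 := rfl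

theorem eq_solutionMode (hε : IsPiecewiseContPeriodic ε) (hμ : IsPiecewiseContPeriodic μ)
    {E : ℝ} {ψ φ : ℝ → ℂ} (h : IsSolution ε μ E ψ φ) :
    ψ = solutionMode ε μ E ![ψ 0, φ 0] ∧ φ = fun x =>
      transferMatrix ε μ E x 1 0 • ψ 0 + transferMatrix ε μ E x 1 1 • φ 0 := by
  have h1 := solutionMode_isSolution hε hμ E ![ψ 0, φ 0]
  exact h.eq_of_init hε hμ h1 (by simp [solutionMode_apply, transferMatrix_zero hε hμ])
    (by simp [transferMatrix_zero hε hμ])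

theorem solutionMode_eq_zero (hε : IsPiecewiseContPeriodic ε)
    (hμ : IsPiecewiseContPeriodic μ) (hc : 0 < c) (hμc : ∀ x, c ≤ μ x) {E : ℝ}
    {v : Fin 2 → ℂ} (h : ∀ x ∈ Icc (0 : ℝ) 1, solutionMode ε μ E v x = 0) : v = 0 := by
  have h1 := (solutionMode_isSolution hε hμ E v).flux_zero_of_mode_zero hμ hc hμc h
  have h0 := h 0 (by simp)
  simp [solutionMode_apply, transferMatrix_zero hε hμ] at h0 h1
  ext i
  fin_cases i
  exacts [h0, h1]

theorem solutionMode_injective (hε : IsPiecewiseContPeriodic ε)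
    (hμ : IsPiecewiseContPeriodic μ) (hc : 0 < c) (hμc : ∀ x, c ≤ μ x) (E : ℝ) :
    Function.Injective (solutionMode ε μ E) := by
  rw [← LinearMap.ker_eq_bot, LinearMap.ker_eq_bot']
  intro v hv
  exact solutionMode_eq_zero hε hμ hc hμc fun x _ => congrFun hv x

/-- The monodromy matrix minus the Floquet multiplier. -/
noncomputable def floquetMatrix (ε μ : ℝ → ℝ) (k E : ℝ) : Matrix (Fin 2) (Fin 2) ℂ :=
  (transferMatrix ε μ E 1).map Complex.ofReal - Complex.exp (Complex.I * k) • 1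

theorem floquetMatrix_mulVec_eq_zero_iff (k E : ℝ) (v : Fin 2 → ℂ) :
    (floquetMatrix ε μ k E).mulVecLin v = 0 ↔ ∀ i, transferMatrix ε μ E 1 i 0 • v 0 +
      transferMatrix ε μ E 1 i 1 • v 1 = Complex.exp (Complex.I * k) * v i := by
  rw [floquetMatrix, Matrix.mulVecLin_apply, Matrix.sub_mulVec, Matrix.smul_mulVec,
    Matrix.one_mulVec, sub_eq_zero, funext_iff]
  simp [Matrix.mulVec, dotProduct, Fin.sum_univ_two]

/-- Bloch modes correspond to eigenvectors of the monodromy matrix, although only the mode, not its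
flux, is required to be quasi-periodic. -/
theorem blochSpace_eq_map (hε : IsPiecewiseContPeriodic ε)
    (hμ : IsPiecewiseContPeriodic μ) (hc : 0 < c) (hμc : ∀ x, c ≤ μ x) (k E : ℝ) :
    blochSpace ε μ k E =
      (LinearMap.ker (floquetMatrix ε μ k E).mulVecLin).map (solutionMode ε μ E) := by
  set z := Complex.exp (Complex.I * k) with hz
  ext ψ
  simp only [Submodule.mem_map, LinearMap.mem_ker, floquetMatrix_mulVec_eq_zero_iff, ← hz]
  constructor
  · rintro ⟨⟨φ, h⟩, hq⟩
    obtain ⟨hψ, hφ⟩ := eq_solutionMode hε hμ h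
    -- The shifted solution minus e^{ik} times the original one has vanishing mode, hence vanishing
    -- flux at 0; this supplies φ(1) = e^{ik} φ(0).
    have hs := (h.shift hε.periodic hμ.periodic).add
      (solutionMode_isSolution hε hμ E (z • ![ψ 0, φ 0])).neg
    have h0 := hs.flux_zero_of_mode_zero hμ hc hμc (fun x _ => by
      rw [map_smul, ← hψ]
      simp [hq x, hz])
    have hψ1 : ψ 1 = z * ψ 0 := by simpa using hq 0
    have hφ1 : φ 1 = z * φ 0 := by
      simp [transferMatrix_zero hε hμ] at h0
      linear_combination h0
    refine ⟨![ψ 0, φ 0], fun i => ?_, hψ.symm⟩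
    fin_cases i
    · have := congrFun hψ 1
      rw [hψ1] at this
      exact this.symm
    · have := congrFun hφ 1
      rw [hφ1] at this
      exact this.symm
  · rintro ⟨v, hv, rfl⟩
    refine ⟨⟨_, solutionMode_isSolution hε hμ E v⟩, fun x => ?_⟩
    have h1 := (solutionMode_isSolution hε hμ E v).shift hε.periodic hμ.periodic
    have h2 := solutionMode_isSolution hε hμ E (z • v)
    have h3 := h1.eq_of_init hε hμ h2
      (by simpa [solutionMode_apply, transferMatrix_zero hε hμ] using hv 0)
      (by simpa [transferMatrix_zero hε hμ] using hv 1)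
    have h4 := congrFun h3.1 x
    rw [map_smul] at h4
    exact h4

theorem finrank_blochSpace_eq_ker (hε : IsPiecewiseContPeriodic ε)
    (hμ : IsPiecewiseContPeriodic μ) (hc : 0 < c) (hμc : ∀ x, c ≤ μ x) (k E : ℝ) :
    Module.finrank ℂ (blochSpace ε μ k E) =
      Module.finrank ℂ (LinearMap.ker (floquetMatrix ε μ k E).mulVecLin) := by
  rw [blochSpace_eq_map hε hμ hc hμc]
  exact (Submodule.equivMapOfInjective _ (solutionMode_injective hε hμ hc hμc E) _).finrank_eq.symm

theorem finiteDimensional_blochSpace (hε : IsPiecewiseContPeriodic ε)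
    (hμ : IsPiecewiseContPeriodic μ) (hc : 0 < c) (hμc : ∀ x, c ≤ μ x) (k E : ℝ) :
    FiniteDimensional ℂ (blochSpace ε μ k E) := by
  rw [blochSpace_eq_map hε hμ hc hμc]
  infer_instance

/-- For z = e^{ik} and det M = 1 one has det (M - z) = 1 - zD + z², and z + 1/z = 2 cos k. -/
theorem floquetMatrix_det (hε : IsPiecewiseContPeriodic ε) (hμ : IsPiecewiseContPeriodic μ)
    (k E : ℝ) : (floquetMatrix ε μ k E).det =
      Complex.exp (Complex.I * k) * ((2 * Real.cos k - discriminant ε μ E : ℝ) : ℂ) := by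
  have d := congrArg Complex.ofReal (transferMatrix_det hε hμ E 1)
  push_cast at d
  have h1 : Complex.exp (Complex.I * k) * Complex.exp (-(k : ℂ) * Complex.I) = 1 := by
    rw [← Complex.exp_add]
    simp [mul_comm]
  rw [Matrix.det_fin_two, discriminant_eq]
  push_cast
  rw [Complex.cos]
  simp only [floquetMatrix, Matrix.sub_apply, Matrix.map_apply, Matrix.smul_apply,
    Matrix.one_apply, Fin.isValue, ↓reduceIte, zero_ne_one, one_ne_zero, smul_eq_mul, mul_one,
    mul_zero, sub_zero]
  rw [mul_comm (k : ℂ) Complex.I] at *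
  linear_combination d - h1

/-- The multiplicity of a Floquet eigenvalue in terms of the discriminant. -/
noncomputable def levelMult (D : ℝ → ℝ) (E : ℝ) : ℕ :=
  open scoped Classical in if deriv D E = 0 then 2 else 1

theorem finrank_blochSpace_of_ne (hε : IsPiecewiseContPeriodic ε)
    (hμ : IsPiecewiseContPeriodic μ) (hc : 0 < c) (hμc : ∀ x, c ≤ μ x) {k E : ℝ}
    (h : discriminant ε μ E ≠ 2 * Real.cos k) : Module.finrank ℂ (blochSpace ε μ k E) = 0 := by
  rw [finrank_blochSpace_eq_ker hε hμ hc hμc]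
  have hdet : (floquetMatrix ε μ k E).det ≠ 0 := by
    rw [floquetMatrix_det hε hμ]
    refine mul_ne_zero (Complex.exp_ne_zero _) ?_
    exact_mod_cast sub_ne_zero.2 h.symm
  have hker : LinearMap.ker (floquetMatrix ε μ k E).mulVecLin = ⊥ := by
    rw [LinearMap.ker_eq_bot']
    intro v hv
    exact Matrix.eq_zero_of_mulVec_eq_zero hdet hv
  rw [hker, finrank_bot]

theorem floquetMatrix_eq_zero_iff (hε : IsPiecewiseContPeriodic ε)
    (hμ : IsPiecewiseContPeriodic μ) {k E : ℝ} (h : discriminant ε μ E = 2 * Real.cos k) :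
    floquetMatrix ε μ k E = 0 ↔
      transferMatrix ε μ E 1 = 1 ∨ transferMatrix ε μ E 1 = -1 := by
  constructor
  · intro h0
    have e : ∀ i j, ((transferMatrix ε μ E 1 i j : ℝ) : ℂ) =
        Complex.exp (Complex.I * k) * (1 : Matrix (Fin 2) (Fin 2) ℂ) i j := fun i j => by
      have := congrFun (congrFun h0 i) j
      simpa [floquetMatrix, sub_eq_zero] using this
    refine transferMatrix_eq_scalar hε hμ ?_ ?_ ?_
    · simpa using e 0 1
    · simpa using e 1 0
    · have h1 : ((transferMatrix ε μ E 1 0 0 : ℝ) : ℂ) = (transferMatrix ε μ E 1 1 1 : ℝ) := by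
        rw [e 0 0, e 1 1]
        simp
      exact_mod_cast h1
  · intro hM
    have hz : ∀ s : ℝ, s ^ 2 = 1 → Real.cos k = s → Complex.exp (Complex.I * k) = s := by
      intro s hs hcos
      have hsin : Real.sin k = 0 := by
        have := Real.sin_sq_add_cos_sq k
        rw [hcos, hs] at this
        exact pow_eq_zero_iff two_ne_zero |>.1 (by linarith)
      rw [mul_comm, Complex.exp_mul_I, ← Complex.ofReal_cos, ← Complex.ofReal_sin, hcos, hsin]
      simp
    rw [discriminant_eq] at h
    rcases hM with hM | hM
    · rw [hM] at h
      have := hz 1 (by norm_num) (by simp at h; linarith)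
      ext i j
      fin_cases i <;> fin_cases j <;> simp [floquetMatrix, hM, this]
    · rw [hM] at h
      have := hz (-1) (by norm_num) (by simp at h; linarith)
      ext i j
      fin_cases i <;> fin_cases j <;> simp [floquetMatrix, hM, this]

/-- Here M - z is singular, so its kernel is a line unless M - z = 0. The latter means M = ±1, that
is D' = 0. -/
theorem finrank_blochSpace_of_eq (hε : IsPiecewiseContPeriodic ε)
    (hμ : IsPiecewiseContPeriodic μ) (hc : 0 < c) (hεc : ∀ x, c ≤ ε x) (hμc : ∀ x, c ≤ μ x)
    {k E : ℝ} (h : discriminant ε μ E = 2 * Real.cos k) :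
    Module.finrank ℂ (blochSpace ε μ k E) = levelMult (discriminant ε μ) E := by
  have hD : |discriminant ε μ E| ≤ 2 := by
    rw [h, abs_mul, abs_two]
    linarith [Real.abs_cos_le_one k]
  rw [finrank_blochSpace_eq_ker hε hμ hc hμc, levelMult]
  simp only [deriv_discriminant_eq_zero_iff hε hμ hc hεc hμc hD,
    ← floquetMatrix_eq_zero_iff hε hμ h]
  split_ifs with h0
  · rw [h0, Matrix.mulVecLin_zero, LinearMap.ker_zero, finrank_top]
    simp
  · have hdet : (floquetMatrix ε μ k E).det = 0 := by
      rw [floquetMatrix_det hε hμ, h]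
      simp
    obtain ⟨v, hv, hv0⟩ := Matrix.exists_mulVec_eq_zero_iff.2 hdet
    have h1 : LinearMap.ker (floquetMatrix ε μ k E).mulVecLin ≠ ⊥ := by
      intro hbot
      have : v ∈ LinearMap.ker (floquetMatrix ε μ k E).mulVecLin := hv0
      rw [hbot] at this
      exact hv this
    have h2 : LinearMap.ker (floquetMatrix ε μ k E).mulVecLin < ⊤ := by
      refine lt_top_iff_ne_top.2 fun htop => h0 ?_
      rw [LinearMap.ker_eq_top] at htop
      ext i j
      have := congrFun (LinearMap.congr_fun htop (Pi.single j 1)) i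
      simpa using this
    have h3 := Submodule.finrank_lt h2.ne
    have h4 := Submodule.one_le_finrank_iff.2 h1
    simp at h3
    omega

/-- Modes with different energies and equal quasi-momentum are orthogonal. -/
theorem blochSpace_orthogonal (hε : IsPiecewiseContPeriodic ε)
    (hμ : IsPiecewiseContPeriodic μ) (hc : 0 < c) (hμc : ∀ x, c ≤ μ x) {k E E' : ℝ}
    (hE : E ≠ E') {ψ ψ' : ℝ → ℂ} (h : ψ ∈ blochSpace ε μ k E)
    (h' : ψ' ∈ blochSpace ε μ k E') :
    ∫ t in (0 : ℝ)..1, ε t • (ψ t * conj (ψ' t)) = 0 := by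
  rw [blochSpace_eq_map hε hμ hc hμc] at h h'
  obtain ⟨v, hv, rfl⟩ := h
  obtain ⟨w, hw, rfl⟩ := h'
  simp only [SetLike.mem_coe, LinearMap.mem_ker, floquetMatrix_mulVec_eq_zero_iff] at hv hw
  have s1 := solutionMode_isSolution hε hμ E v
  have s2 := (solutionMode_isSolution hε hμ E' w).conj_comp
  -- The Floquet multiplier is unimodular, so the boundary terms at 0 and 1 cancel in both
  -- integrations by parts.
  have hzz : Complex.exp (Complex.I * k) * conj (Complex.exp (Complex.I * k)) = 1 := by
    rw [Complex.mul_conj, Complex.normSq_eq_norm_sq, mul_comm, Complex.norm_exp_ofReal_mul_I]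
    simp
  have e1 := s1.mode_mul_flux hε hμ s2 1
  have e2 := s2.mode_mul_flux hε hμ s1 1
  simp only [solutionMode_apply, hv 0, hv 1, hw 0, hw 1, transferMatrix_zero hε hμ] at e1 e2
  simp only [map_mul, Matrix.one_apply_eq, one_smul, ne_eq, zero_ne_one, not_false_eq_true,
    Matrix.one_apply_ne, zero_smul, add_zero, one_ne_zero, zero_add] at e1 e2
  rw [show ∀ a b : ℂ, Complex.exp (Complex.I * k) * a *
      (conj (Complex.exp (Complex.I * k)) * b) = a * b from fun a b => by
        linear_combination (a * b) * hzz, sub_self] at e1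
  rw [show ∀ a b : ℂ, conj (Complex.exp (Complex.I * k)) * a *
      (Complex.exp (Complex.I * k) * b) = a * b from fun a b => by
        linear_combination (a * b) * hzz, sub_self] at e2
  simp only [mul_comm (conj _)] at e2
  have e3 := e1.symm.trans e2
  rw [sub_right_inj] at e3
  have e4 : (E' - E) • ∫ t in (0 : ℝ)..1, ε t • (solutionMode ε μ E v t *
      conj (solutionMode ε μ E' w t)) = 0 := by
    rw [sub_smul, sub_eq_zero]
    exact e3
  exact (smul_eq_zero.1 e4).resolve_left (sub_ne_zero.2 hE.symm)

/-- Continuous functions orthogonal to `g` on a period. -/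
def orthogonalTo (hε : IsPiecewiseContPeriodic ε) (g : ℝ → ℂ) (hg : Continuous g) :
    Submodule ℂ (ℝ → ℂ) where
  carrier := {f | Continuous f ∧ ∫ t in (0 : ℝ)..1, ε t • (f t * g t) = 0}
  zero_mem' := by
    refine ⟨continuous_const, ?_⟩
    simp
  add_mem' := by
    rintro a b ⟨ca, ha⟩ ⟨cb, hb⟩
    refine ⟨ca.add cb, ?_⟩
    obtain ⟨K, -, h⟩ := hε.exists_isBoundedMeas
    have ia := h.intervalIntegrable_smul (z := fun t => a t * g t) (ca.mul hg) 0 1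
    have ib := h.intervalIntegrable_smul (z := fun t => b t * g t) (cb.mul hg) 0 1
    simp only [Pi.add_apply, add_mul, smul_add]
    rw [intervalIntegral.integral_add ia ib, ha, hb, add_zero]
  smul_mem' := by
    rintro r a ⟨ca, ha⟩
    refine ⟨ca.const_smul r, ?_⟩
    have e : ∀ t, ε t • ((r • a) t * g t) = r • (ε t • (a t * g t)) := fun t => by
      simp only [Pi.smul_apply, smul_eq_mul, Complex.real_smul]
      ring
    simp only [e]
    rw [intervalIntegral.integral_smul, ha, smul_zero]

theorem continuous_of_mem_blochSpace {k E : ℝ} {ψ : ℝ → ℂ} (h : ψ ∈ blochSpace ε μ k E) :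
    Continuous ψ := by
  obtain ⟨⟨φ, h⟩, -⟩ := h
  exact h.continuous_mode

/-- A common element is orthogonal to all modes in the sum, hence to itself, and so vanishes on a
period. -/
theorem disjoint_sup_blochSpace (hε : IsPiecewiseContPeriodic ε)
    (hμ : IsPiecewiseContPeriodic μ) (hc : 0 < c) (hεc : ∀ x, c ≤ ε x) (hμc : ∀ x, c ≤ μ x)
    (k : ℝ) (s : Finset ℝ) (E : ℝ) (hE : E ∉ s) :
    Disjoint (s.sup (blochSpace ε μ k)) (blochSpace ε μ k E) := by
  rw [Submodule.disjoint_def]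
  intro f hf hfE
  have cf := continuous_of_mem_blochSpace hfE
  have hle : s.sup (blochSpace ε μ k) ≤
      orthogonalTo hε (fun x => conj (f x)) (Complex.continuous_conj.comp cf) := by
    refine Finset.sup_le fun E' hE' ψ hψ => ⟨continuous_of_mem_blochSpace hψ, ?_⟩
    exact blochSpace_orthogonal hε hμ hc hμc (fun h : E' = E => hE (h ▸ hE')) hψ hfE
  have h0 := (hle hf).2
  have h1 : ∫ t in (0 : ℝ)..1, ε t * Complex.normSq (f t) = 0 := by
    have e : ∀ t, ε t • (f t * conj (f t)) = ((ε t * Complex.normSq (f t) : ℝ) : ℂ) := fun t => by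
      rw [Complex.mul_conj, Complex.real_smul]
      push_cast
      rfl
    simp only [e] at h0
    rw [intervalIntegral.integral_ofReal] at h0
    exact_mod_cast h0
  rw [blochSpace_eq_map hε hμ hc hμc] at hfE
  obtain ⟨v, -, rfl⟩ := hfE
  rw [solutionMode_eq_zero hε hμ hc hμc (v := v) (E := E), map_zero]
  by_contra! hcon
  obtain ⟨x, hx, hne⟩ := hcon
  have := hε.integral_mul_pos hc hεc (w := fun t => Complex.normSq (solutionMode ε μ E v t))
    (Complex.continuous_normSq.comp cf) (fun t => Complex.normSq_nonneg _)
    ⟨x, hx, Complex.normSq_pos.2 hne⟩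
  exact this.ne' h1

end

/-! ### Counting the levels of the discriminant. -/

/-- The number of solutions of `D x = t` with `x ≤ E`, counted with multiplicity. -/
noncomputable def bandCount (D : ℝ → ℝ) (t E : ℝ) : ℕ :=
  ∑ᶠ x ∈ {x | x ≤ E ∧ D x = t}, levelMult D x

theorem one_le_levelMult (D : ℝ → ℝ) (E : ℝ) : 1 ≤ levelMult D E := by
  rw [levelMult]
  split_ifs <;> norm_num

theorem levelMult_of_ne {D : ℝ → ℝ} {E : ℝ} (h : deriv D E ≠ 0) : levelMult D E = 1 :=
  if_neg h

theorem levelMult_of_eq {D : ℝ → ℝ} {E : ℝ} (h : deriv D E = 0) : levelMult D E = 2 :=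
  if_pos h

theorem levelMult_neg (D : ℝ → ℝ) (E : ℝ) : levelMult (fun x => -D x) E = levelMult D E := by
  simp [levelMult]

section LocalCount

variable {X : Type*} [TopologicalSpace X]

/-- If near each zero of `F p₀` the number of zeros, weighted by `m`, does not change, then the
weighted number of zeros on the whole interval does not change. -/
theorem eventually_finsum_zeros_eq {F : X → ℝ → ℝ} {m : X → ℝ → ℕ} {p₀ : X} {l : Filter X}
    (hl : l ≤ 𝓝 p₀) (hF : Continuous (Function.uncurry F)) {a b : ℝ}
    (ha : F p₀ a ≠ 0) (hb : F p₀ b ≠ 0)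
    (hfin : ∀ᶠ p in l, {x | x ∈ Icc a b ∧ F p x = 0}.Finite)
    (hfin₀ : {x | x ∈ Icc a b ∧ F p₀ x = 0}.Finite)
    (hloc : ∀ z, z ∈ Icc a b → F p₀ z = 0 → ∀ᶠ r in 𝓝[>] (0 : ℝ), ∀ᶠ p in l,
      ∑ᶠ x ∈ {x | |x - z| < r ∧ F p x = 0}, m p x = m p₀ z) :
    ∀ᶠ p in l, ∑ᶠ x ∈ {x | x ∈ Icc a b ∧ F p x = 0}, m p x =
      ∑ᶠ x ∈ {x | x ∈ Icc a b ∧ F p₀ x = 0}, m p₀ x := by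
  set Z := {x | x ∈ Icc a b ∧ F p₀ x = 0} with hZ
  have hsmall : ∀ d : ℝ, 0 < d → ∀ᶠ r in 𝓝[>] (0 : ℝ), r < d := fun d hd =>
    mem_nhdsWithin_of_mem_nhds (Iio_mem_nhds hd)
  have h1 : ∀ᶠ r in 𝓝[>] (0 : ℝ), ∀ z ∈ Z, ∀ᶠ p in l,
      ∑ᶠ x ∈ {x | |x - z| < r ∧ F p x = 0}, m p x = m p₀ z :=
    (hfin₀.eventually_all).2 fun z hz => hloc z hz.1 hz.2
  have h2 : ∀ᶠ r in 𝓝[>] (0 : ℝ), ∀ z ∈ Z, ∀ w ∈ Z, z ≠ w → 2 * r < |z - w| := by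
    refine (hfin₀.eventually_all).2 fun z _ => (hfin₀.eventually_all).2 fun w _ => ?_
    by_cases hzw : z = w
    · exact Eventually.of_forall fun r h => (h hzw).elim
    · have : 0 < |z - w| / 2 := by
        have := abs_pos.2 (sub_ne_zero.2 hzw)
        linarith
      filter_upwards [hsmall _ this] with r hr _
      linarith
  have h3 : ∀ᶠ r in 𝓝[>] (0 : ℝ), ∀ z ∈ Z, r < z - a ∧ r < b - z := by
    refine (hfin₀.eventually_all).2 fun z hz => ?_
    have haz : a < z := lt_of_le_of_ne hz.1.1 fun h => ha (h ▸ hz.2)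
    have hzb : z < b := lt_of_le_of_ne hz.1.2 fun h => hb (h ▸ hz.2)
    exact (hsmall _ (sub_pos.2 haz)).and (hsmall _ (sub_pos.2 hzb))
  -- One radius serves all zeros: the local counts hold, the neighbourhoods are disjoint and they
  -- stay inside the interval.
  obtain ⟨r, h1, h2, h3, hr⟩ := (h1.and (h2.and (h3.and self_mem_nhdsWithin))).exists
  have hr0 : 0 < r := hr
  -- On the compact remainder `F p₀` has no zero, hence neither has `F p` for `p` near `p₀`.
  set K := Icc a b \ ⋃ z ∈ Z, Metric.ball z r with hK
  have hKc : IsCompact K := isCompact_Icc.diff (isOpen_biUnion fun z _ => Metric.isOpen_ball)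
  have hne : ∀ᶠ p in 𝓝 p₀, ∀ x ∈ K, F p x ≠ 0 := by
    refine hKc.eventually_forall_of_forall_eventually fun x hx => ?_
    have hx0 : F p₀ x ≠ 0 := fun h0 => hx.2
      (mem_biUnion (show x ∈ Z from ⟨hx.1, h0⟩) (Metric.mem_ball_self hr0))
    exact hF.continuousAt.eventually_ne hx0
  have h1' : ∀ᶠ p in l, ∀ z ∈ Z, ∑ᶠ x ∈ {x | |x - z| < r ∧ F p x = 0}, m p x = m p₀ z :=
    (hfin₀.eventually_all).2 h1
  filter_upwards [hfin, hl hne, h1'] with p hp hpK hpl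
  have hsub : ∀ z ∈ Z, {x | |x - z| < r ∧ F p x = 0} ⊆ {x | x ∈ Icc a b ∧ F p x = 0} := by
    rintro z hz x ⟨hx, hx0⟩
    obtain ⟨h4, h5⟩ := h3 z hz
    obtain ⟨h6, h7⟩ := abs_lt.1 hx
    exact ⟨⟨by linarith, by linarith⟩, hx0⟩
  have hU : {x | x ∈ Icc a b ∧ F p x = 0} = ⋃ z ∈ Z, {x | |x - z| < r ∧ F p x = 0} := by
    refine Subset.antisymm ?_ (iUnion₂_subset hsub)
    rintro x ⟨hx, hx0⟩
    by_contra hcon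
    refine hpK x ⟨hx, fun hmem => hcon ?_⟩ hx0
    obtain ⟨z, hz, hxz⟩ := mem_iUnion₂.1 hmem
    exact mem_biUnion hz ⟨by rwa [Metric.mem_ball, Real.dist_eq] at hxz, hx0⟩
  refine (finsum_mem_congr hU fun _ _ => rfl).trans ?_
  rw [finsum_mem_biUnion _ hfin₀ fun z hz => hp.subset (hsub z hz)]
  · exact finsum_mem_congr rfl hpl
  · intro z hz w hw hzw
    rw [Function.onFun, Set.disjoint_left]
    rintro x ⟨hx, -⟩ ⟨hx', -⟩
    have h4 := h2 z hz w hw hzw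
    have h5 : |z - w| ≤ |x - z| + |x - w| := by
      rw [abs_sub_comm x z]
      simpa using abs_sub_le z x w
    linarith

/-- An implicit function argument with a merely topological parameter: near (p₀, z) the derivative
stays positive, so F p is strictly increasing there, and the opposite signs at z ± r/2 persist. -/
theorem eventually_unique_zero_of_pos {F F' : X → ℝ → ℝ} (hF : Continuous (Function.uncurry F))
    (hd : ∀ p x, HasDerivAt (F p) (F' p x) x) (hF' : Continuous (Function.uncurry F'))
    {p₀ : X} {z : ℝ} (h0 : F p₀ z = 0) (h1 : 0 < F' p₀ z) :
    ∀ᶠ r in 𝓝[>] (0 : ℝ), ∀ᶠ p in 𝓝 p₀, ∃ y, {x | |x - z| < r ∧ F p x = 0} = {y} ∧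
      F' p y ≠ 0 := by
  have hev : ∀ᶠ q : X × ℝ in 𝓝 p₀ ×ˢ 𝓝 z, 0 < F' q.1 q.2 := by
    rw [← nhds_prod_eq]
    exact hF'.continuousAt.eventually (lt_mem_nhds h1)
  obtain ⟨P, hP, R, hR, hPR⟩ := eventually_prod_iff.1 hev
  obtain ⟨ρ, hρ, hball⟩ := Metric.eventually_nhds_iff.1 hR
  filter_upwards [mem_nhdsWithin_of_mem_nhds (Iio_mem_nhds hρ), self_mem_nhdsWithin] with r hr hr0
  have hr0 : 0 < r := hr0
  have hr : r < ρ := hr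
  have hmono : ∀ p, P p → StrictMonoOn (F p) (Ioo (z - r) (z + r)) := by
    intro p hp
    refine strictMonoOn_of_deriv_pos (convex_Ioo _ _)
      (fun x _ => (hd p x).continuousAt.continuousWithinAt) fun x hx => ?_
    rw [interior_Ioo] at hx
    rw [(hd p x).deriv]
    refine hPR hp (hball ?_)
    rw [Real.dist_eq, abs_lt]
    exact ⟨by linarith [hx.1], by linarith [hx.2]⟩
  have hm0 := hmono p₀ hP.self_of_nhds
  have hlo : F p₀ (z - r / 2) < 0 := by
    rw [← h0]
    exact hm0 ⟨by linarith, by linarith⟩ ⟨by linarith, by linarith⟩ (by linarith)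
  have hhi : 0 < F p₀ (z + r / 2) := by
    rw [← h0]
    exact hm0 ⟨by linarith, by linarith⟩ ⟨by linarith, by linarith⟩ (by linarith)
  have c1 : ∀ x, Continuous fun p => F p x := fun x =>
    hF.comp (f := fun p : X => (p, x)) (by fun_prop)
  filter_upwards [hP, (c1 _).continuousAt.eventually (gt_mem_nhds hlo),
    (c1 _).continuousAt.eventually (lt_mem_nhds hhi)] with p hp hlo' hhi'
  obtain ⟨y, hy, hy0⟩ := intermediate_value_Icc (show z - r / 2 ≤ z + r / 2 by linarith)
    (f := F p) (fun x _ => (hd p x).continuousAt.continuousWithinAt)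
    (show (0 : ℝ) ∈ Icc _ _ from ⟨hlo'.le, hhi'.le⟩)
  have hyI : y ∈ Ioo (z - r) (z + r) := ⟨by linarith [hy.1], by linarith [hy.2]⟩
  refine ⟨y, ?_, ?_⟩
  · ext x
    simp only [mem_ofPred_eq, mem_singleton_iff]
    constructor
    · rintro ⟨hx, hx0⟩
      obtain ⟨h4, h5⟩ := abs_lt.1 hx
      exact (hmono p hp).injOn ⟨by linarith, by linarith⟩ hyI (hx0.trans hy0.symm)
    · rintro rfl
      exact ⟨abs_lt.2 ⟨by linarith [hyI.1], by linarith [hyI.2]⟩, hy0⟩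
  · refine (hPR hp (hball ?_)).ne'
    rw [Real.dist_eq, abs_lt]
    exact ⟨by linarith [hyI.1], by linarith [hyI.2]⟩

theorem eventually_unique_zero {F F' : X → ℝ → ℝ} (hF : Continuous (Function.uncurry F))
    (hd : ∀ p x, HasDerivAt (F p) (F' p x) x) (hF' : Continuous (Function.uncurry F'))
    {p₀ : X} {z : ℝ} (h0 : F p₀ z = 0) (h1 : F' p₀ z ≠ 0) :
    ∀ᶠ r in 𝓝[>] (0 : ℝ), ∀ᶠ p in 𝓝 p₀, ∃ y, {x | |x - z| < r ∧ F p x = 0} = {y} ∧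
      F' p y ≠ 0 := by
  rcases lt_or_gt_of_ne h1 with h1 | h1
  · have := eventually_unique_zero_of_pos (F := fun p x => -F p x) (F' := fun p x => -F' p x)
      hF.neg (fun p x => (hd p x).neg) hF'.neg (p₀ := p₀) (z := z) (by simpa using h0)
      (by simpa using h1)
    simpa only [neg_eq_zero, ne_eq] using this
  · exact eventually_unique_zero_of_pos hF hd hF' h0 h1

end LocalCount

theorem strictAntiOn_deriv_near {D : ℝ → ℝ} (hD : ContDiff ℝ ∞ D) {z : ℝ}
    (h2 : deriv (deriv D) z < 0) :
    ∀ᶠ r in 𝓝[>] (0 : ℝ), StrictAntiOn (deriv D) (Ioo (z - r) (z + r)) := by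
  have c1 := (contDiff_infty_iff_deriv.1 hD).2
  have c2 := (contDiff_infty_iff_deriv.1 c1).2
  have hev := c2.continuous.continuousAt.eventually (gt_mem_nhds h2)
  obtain ⟨ρ, hρ, hball⟩ := Metric.eventually_nhds_iff.1 hev
  filter_upwards [mem_nhdsWithin_of_mem_nhds (Iio_mem_nhds hρ)] with r hr
  have hr : r < ρ := hr
  refine strictAntiOn_of_deriv_neg (convex_Ioo _ _) c1.continuous.continuousOn fun x hx => ?_
  rw [interior_Ioo] at hx
  refine hball ?_
  rw [Real.dist_eq, abs_lt]
  exact ⟨by linarith [hx.1], by linarith [hx.2]⟩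

/-- Below a nondegenerate local maximum the level has two simple preimages. -/
theorem eventually_finsum_level_of_max {D : ℝ → ℝ} (hD : ContDiff ℝ ∞ D) {z t₀ : ℝ}
    (h0 : D z = t₀) (h1 : deriv D z = 0) (h2 : deriv (deriv D) z < 0) :
    ∀ᶠ r in 𝓝[>] (0 : ℝ), ∀ᶠ t in 𝓝[≤] t₀,
      ∑ᶠ x ∈ {x | |x - z| < r ∧ D x = t}, levelMult D x = 2 := by
  have hdiff : Differentiable ℝ D := hD.differentiable (by simp)
  filter_upwards [strictAntiOn_deriv_near hD h2, self_mem_nhdsWithin] with r hanti hr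
  have hr : 0 < r := hr
  have hz : z ∈ Ioo (z - r) (z + r) := ⟨by linarith, by linarith⟩
  have hpos : ∀ x ∈ Ioo (z - r) z, 0 < deriv D x := fun x hx => by
    rw [← h1]
    exact hanti ⟨hx.1, by linarith [hx.2]⟩ hz hx.2
  have hneg : ∀ x ∈ Ioo z (z + r), deriv D x < 0 := fun x hx => by
    rw [← h1]
    exact hanti hz ⟨by linarith [hx.1], hx.2⟩ hx.1
  have hmono : StrictMonoOn D (Ioc (z - r) z) :=
    strictMonoOn_of_deriv_pos (convex_Ioc _ _) hD.continuous.continuousOn fun x hx => by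
      rw [interior_Ioc] at hx
      exact hpos x hx
  have hant : StrictAntiOn D (Ico z (z + r)) :=
    strictAntiOn_of_deriv_neg (convex_Ico _ _) hD.continuous.continuousOn fun x hx => by
      rw [interior_Ico] at hx
      exact hneg x hx
  have hzl : z ∈ Ioc (z - r) z := ⟨by linarith, le_rfl⟩
  have hzr : z ∈ Ico z (z + r) := ⟨le_rfl, by linarith⟩
  have hlo : D (z - r / 2) < t₀ := by
    rw [← h0]
    exact hmono ⟨by linarith, by linarith⟩ hzl (by linarith)
  have hhi : D (z + r / 2) < t₀ := by
    rw [← h0]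
    exact hant hzr ⟨by linarith, by linarith⟩ (by linarith)
  filter_upwards [mem_nhdsWithin_of_mem_nhds (Ioi_mem_nhds hlo),
    mem_nhdsWithin_of_mem_nhds (Ioi_mem_nhds hhi), self_mem_nhdsWithin] with t ht1 ht2 ht3
  have ht1 : D (z - r / 2) < t := ht1
  have ht2 : D (z + r / 2) < t := ht2
  have ht3 : t ≤ t₀ := ht3
  -- At the critical level a single preimage counts twice; strictly below it each monotone branch
  -- contributes one simple preimage.
  rcases ht3.eq_or_lt with rfl | ht3
  · have hset : {x | |x - z| < r ∧ D x = t} = {z} := by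
      ext x
      simp only [mem_ofPred_eq, mem_singleton_iff]
      constructor
      · rintro ⟨hx, hx0⟩
        obtain ⟨h4, h5⟩ := abs_lt.1 hx
        rcases le_total x z with h | h
        · exact hmono.injOn ⟨by linarith, h⟩ hzl (hx0.trans h0.symm)
        · exact hant.injOn ⟨h, by linarith⟩ hzr (hx0.trans h0.symm)
      · rintro rfl
        exact ⟨by simpa using hr, h0⟩
    refine (finsum_mem_congr hset fun _ _ => rfl).trans ?_
    rw [finsum_mem_singleton, levelMult_of_eq h1]
  · obtain ⟨x₁, hx₁, e₁⟩ := intermediate_value_Icc (show z - r / 2 ≤ z by linarith)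
      hD.continuous.continuousOn (show t ∈ Icc _ _ from ⟨ht1.le, by linarith⟩)
    obtain ⟨x₂, hx₂, e₂⟩ := intermediate_value_Icc' (show z ≤ z + r / 2 by linarith)
      hD.continuous.continuousOn (show t ∈ Icc _ _ from ⟨ht2.le, by linarith⟩)
    have l₁ : x₁ < z := lt_of_le_of_ne hx₁.2 fun h => by rw [h] at e₁; linarith
    have l₂ : z < x₂ := lt_of_le_of_ne hx₂.1 fun h => by rw [← h] at e₂; linarith
    have hset : {x | |x - z| < r ∧ D x = t} = {x₁, x₂} := by
      ext x
      simp only [mem_ofPred_eq, mem_insert_iff, mem_singleton_iff]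
      constructor
      · rintro ⟨hx, hx0⟩
        obtain ⟨h4, h5⟩ := abs_lt.1 hx
        rcases le_total x z with h | h
        · left
          exact hmono.injOn ⟨by linarith, h⟩ ⟨by linarith [hx₁.1], hx₁.2⟩ (hx0.trans e₁.symm)
        · right
          exact hant.injOn ⟨h, by linarith⟩ ⟨hx₂.1, by linarith [hx₂.2]⟩ (hx0.trans e₂.symm)
      · rintro (rfl | rfl)
        · exact ⟨abs_lt.2 ⟨by linarith [hx₁.1], by linarith⟩, e₁⟩
        · exact ⟨abs_lt.2 ⟨by linarith, by linarith [hx₂.2]⟩, e₂⟩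
    refine (finsum_mem_congr hset fun _ _ => rfl).trans ?_
    rw [finsum_mem_pair (by linarith [l₁.trans l₂] : x₁ ≠ x₂)]
    rw [levelMult_of_ne (hpos x₁ ⟨by linarith [hx₁.1], l₁⟩).ne',
      levelMult_of_ne (hneg x₂ ⟨l₂, by linarith [hx₂.2]⟩).ne]

theorem eventually_finsum_level_of_min {D : ℝ → ℝ} (hD : ContDiff ℝ ∞ D) {z t₀ : ℝ}
    (h0 : D z = t₀) (h1 : deriv D z = 0) (h2 : 0 < deriv (deriv D) z) :
    ∀ᶠ r in 𝓝[>] (0 : ℝ), ∀ᶠ t in 𝓝[≥] t₀,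
      ∑ᶠ x ∈ {x | |x - z| < r ∧ D x = t}, levelMult D x = 2 := by
  have hd : deriv (fun x => -D x) = fun x => -deriv D x := funext fun x => deriv.fun_neg
  have := eventually_finsum_level_of_max (D := fun x => -D x) hD.neg (z := z) (t₀ := -t₀)
    (by simp [h0]) (by simp [h1]) (by rw [hd]; simpa using h2)
  filter_upwards [this] with r hr
  have htend : Tendsto (fun t : ℝ => -t) (𝓝[≥] t₀) (𝓝[≤] (-t₀)) := by
    refine tendsto_nhdsWithin_iff.2 ⟨?_, ?_⟩
    · exact (continuous_neg.tendsto t₀).mono_left nhdsWithin_le_nhds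
    · filter_upwards [self_mem_nhdsWithin] with t ht
      exact neg_le_neg (show t₀ ≤ t from ht)
  filter_upwards [htend.eventually hr] with t ht
  simpa only [neg_inj, levelMult_neg] using ht

namespace IsHillDiscriminant

variable {D : ℝ → ℝ}

theorem differentiable (hD : IsHillDiscriminant D) : Differentiable ℝ D :=
  hD.contDiff.differentiable (by simp)

theorem contDiff_deriv (hD : IsHillDiscriminant D) : ContDiff ℝ ∞ (deriv D) :=
  (contDiff_infty_iff_deriv.1 hD.contDiff).2

theorem deriv_deriv_ne (hD : IsHillDiscriminant D) {x : ℝ} (hx : |D x| ≤ 2)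
    (h : deriv D x = 0) : deriv (deriv D) x ≠ 0 := by
  rcases hx.lt_or_eq with h1 | h1
  · exact (hD.deriv_ne x h1 h).elim
  · rcases eq_or_eq_neg_of_abs_eq h1 with h1 | h1
    · exact (hD.neg_of_two x h1 h).ne
    · exact (hD.pos_of_neg_two x h1 h).ne'

theorem nonneg_of_level (hD : IsHillDiscriminant D) {t x : ℝ} (ht : t ≤ 2) (hx : D x = t) :
    0 ≤ x := by
  by_contra! h
  linarith [hD.two_lt x h]

/-- At a critical preimage D'' ≠ 0 isolates the zero of D', and by Rolle's theorem a second preimage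
nearby would produce another zero of D'. -/
theorem eventually_ne_level (hD : IsHillDiscriminant D) {t : ℝ} (ht : |t| ≤ 2) (a : ℝ) :
    ∀ᶠ x in 𝓝[≠] a, D x ≠ t := by
  by_cases ha : D a = t
  · by_cases hd : deriv D a = 0
    · have h2 := hD.deriv_deriv_ne (ha ▸ ht) hd
      have hd2 : HasDerivAt (deriv D) (deriv (deriv D) a) a :=
        (hD.contDiff_deriv.differentiable (by simp)).differentiableAt.hasDerivAt
      have hev := hd2.eventually_ne h2 (c := 0)
      rw [eventually_nhdsWithin_iff, Metric.eventually_nhds_iff] at hev ⊢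
      obtain ⟨ρ, hρ, hball⟩ := hev
      refine ⟨ρ, hρ, fun x hx hxa hxt => ?_⟩
      rw [Real.dist_eq, abs_lt] at hx
      rcases lt_or_gt_of_ne hxa with h | h
      · obtain ⟨ξ, hξ, h0⟩ := exists_deriv_eq_zero h hD.differentiable.continuous.continuousOn
          (hxt.trans ha.symm)
        exact hball (by rw [Real.dist_eq, abs_lt]; constructor <;> linarith [hξ.1, hξ.2])
          hξ.2.ne h0
      · obtain ⟨ξ, hξ, h0⟩ := exists_deriv_eq_zero h hD.differentiable.continuous.continuousOn
          (ha.trans hxt.symm)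
        exact hball (by rw [Real.dist_eq, abs_lt]; constructor <;> linarith [hξ.1, hξ.2])
          hξ.1.ne' h0
    · exact (hD.differentiable a).hasDerivAt.eventually_ne hd
  · exact mem_nhdsWithin_of_mem_nhds
      (hD.differentiable.continuous.continuousAt.eventually_ne ha)

theorem finite_level (hD : IsHillDiscriminant D) {t : ℝ} (ht : |t| ≤ 2) (a b : ℝ) :
    {x | x ∈ Icc a b ∧ D x = t}.Finite := by
  by_contra hinf
  obtain ⟨z, -, hz⟩ := Set.Infinite.exists_accPt_of_subset_isCompact hinf
    (isCompact_Icc (a := a) (b := b)) fun x hx => hx.1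
  rw [accPt_iff_frequently_nhdsNE] at hz
  exact hz ((hD.eventually_ne_level ht z).mono fun x hx hxt => hx hxt.2)

/-- D exceeds 2 at negative energies, so nothing is lost by cutting at -1, an endpoint where the
level is not attained. -/
theorem bandCount_set (hD : IsHillDiscriminant D) {t : ℝ} (ht : t ≤ 2) (E : ℝ) :
    {x | x ≤ E ∧ D x = t} = {x | x ∈ Icc (-1) E ∧ D x = t} := by
  ext x
  simp only [mem_ofPred_eq, mem_Icc]
  constructor
  · rintro ⟨h1, h2⟩
    exact ⟨⟨by linarith [hD.nonneg_of_level ht h2], h1⟩, h2⟩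
  · rintro ⟨⟨-, h1⟩, h2⟩
    exact ⟨h1, h2⟩

theorem finite_bandCount_set (hD : IsHillDiscriminant D) {t : ℝ} (ht : |t| ≤ 2) (E : ℝ) :
    {x | x ≤ E ∧ D x = t}.Finite := by
  rw [hD.bandCount_set (abs_le.1 ht).2]
  exact hD.finite_level ht _ _

theorem bandCount_mono (hD : IsHillDiscriminant D) {t : ℝ} (ht : |t| ≤ 2) {E E' : ℝ}
    (h : E ≤ E') : bandCount D t E ≤ bandCount D t E' := by
  have hsub : {x | x ≤ E ∧ D x = t} ⊆ {x | x ≤ E' ∧ D x = t} := fun x hx => ⟨hx.1.trans h, hx.2⟩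
  have := finsum_mem_add_sdiff hsub (hD.finite_bandCount_set ht E') (f := levelMult D)
  rw [bandCount, bandCount, ← this]
  exact Nat.le_add_right _ _

theorem bandCount_lt (hD : IsHillDiscriminant D) {t : ℝ} (ht : |t| ≤ 2) {E E' : ℝ}
    (h : E < E') (hE' : D E' = t) : bandCount D t E < bandCount D t E' := by
  have hsub : {x | x ≤ E ∧ D x = t} ⊆ {x | x ≤ E' ∧ D x = t} :=
    fun x hx => ⟨hx.1.trans h.le, hx.2⟩
  have hins : insert E' {x | x ≤ E ∧ D x = t} ⊆ {x | x ≤ E' ∧ D x = t} :=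
    insert_subset ⟨le_rfl, hE'⟩ hsub
  have h1 := finsum_mem_add_sdiff hins (hD.finite_bandCount_set ht E') (f := levelMult D)
  have h2 := finsum_mem_insert (levelMult D)
    (show E' ∉ {x | x ≤ E ∧ D x = t} from fun hx => hx.1.not_gt h)
    (hD.finite_bandCount_set ht E)
  have h3 := one_le_levelMult D E'
  rw [bandCount, bandCount, ← h1, h2]
  omega

theorem bandCount_of_neg (hD : IsHillDiscriminant D) {t : ℝ} (ht : |t| ≤ 2) {E : ℝ}
    (hE : E < 0) : bandCount D t E = 0 := by
  have : {x | x ≤ E ∧ D x = t} = ∅ := by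
    ext x
    simp only [mem_ofPred_eq, mem_empty_iff_false, iff_false, not_and]
    intro hx h
    linarith [hD.nonneg_of_level (abs_le.1 ht).2 h]
  rw [bandCount, this, finsum_mem_empty]

theorem _root_.bandCount_congr {t : ℝ} {E E' : ℝ} (h : E ≤ E')
    (hne : ∀ x ∈ Ioc E E', D x ≠ t) : bandCount D t E = bandCount D t E' := by
  have : {x | x ≤ E ∧ D x = t} = {x | x ≤ E' ∧ D x = t} := by
    ext x
    refine ⟨fun hx => ⟨hx.1.trans h, hx.2⟩, fun hx => ⟨?_, hx.2⟩⟩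
    by_contra! hlt
    exact hne x ⟨hlt, hx.1⟩ hx.2
  rw [bandCount, bandCount, this]

/-- The count of levels below `E` is locally constant in the level. -/
theorem eventually_bandCount_eq (hD : IsHillDiscriminant D) {t₀ E : ℝ}
    (ht₀ : t₀ ∈ Icc (-2 : ℝ) 2) (hE : D E ≠ t₀) :
    ∀ᶠ t in 𝓝[Icc (-2) 2] t₀, bandCount D t E = bandCount D t₀ E := by
  have hcont := hD.differentiable.continuous
  have hab : ∀ t ∈ Icc (-2 : ℝ) 2, |t| ≤ 2 := fun t ht => abs_le.2 ht
  have key := eventually_finsum_zeros_eq (F := fun t x => D x - t) (m := fun _ x => levelMult D x)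
    (p₀ := t₀) (l := 𝓝[Icc (-2) 2] t₀) nhdsWithin_le_nhds
    (by simp only [Function.uncurry_def]; fun_prop) (a := -1) (b := E)
    (by have := hD.two_lt (-1) (by norm_num); exact sub_ne_zero.2 (by linarith [ht₀.2]))
    (sub_ne_zero.2 hE)
    (by
      filter_upwards [self_mem_nhdsWithin] with t ht
      simpa only [sub_eq_zero] using hD.finite_level (hab t ht) _ _)
    (by simpa only [sub_eq_zero] using hD.finite_level (hab _ ht₀) _ _)
    (by
      intro z _ hz
      rw [sub_eq_zero] at hz
      simp only [sub_eq_zero]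
      by_cases hd : deriv D z = 0
      · have habs : |D z| = 2 := by
          refine le_antisymm (hz ▸ hab _ ht₀) ?_
          by_contra! hlt
          exact hD.deriv_ne z hlt hd
        rw [levelMult_of_eq hd]
        -- Levels in [-2, 2] lie below a maximum of value 2 and above a minimum of value -2: the
        -- sides on which two preimages persist.
        rcases eq_or_eq_neg_of_abs_eq habs with h2 | h2
        · have := eventually_finsum_level_of_max hD.contDiff hz hd (hD.neg_of_two z h2 hd)
          filter_upwards [this] with r hr
          refine Eventually.filter_mono (nhdsWithin_mono _ ?_) hr
          rw [← hz, h2]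
          exact fun x hx => hx.2
        · have := eventually_finsum_level_of_min hD.contDiff hz hd (hD.pos_of_neg_two z h2 hd)
          filter_upwards [this] with r hr
          refine Eventually.filter_mono (nhdsWithin_mono _ ?_) hr
          rw [← hz, h2]
          exact fun x hx => hx.1
      · have hcd := hD.contDiff_deriv.continuous
        have := eventually_unique_zero (F := fun t x => D x - t) (F' := fun _ x => deriv D x)
          (by simp only [Function.uncurry_def]; fun_prop)
          (fun t x => (hD.differentiable x).hasDerivAt.sub_const t)
          (by simp only [Function.uncurry_def]; fun_prop) (p₀ := t₀) (sub_eq_zero.2 hz) hd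
        filter_upwards [this] with r hr
        filter_upwards [hr.filter_mono nhdsWithin_le_nhds] with t ⟨y, hy, hy'⟩
        simp only [sub_eq_zero] at hy
        refine (finsum_mem_congr hy fun _ _ => rfl).trans ?_
        rw [finsum_mem_singleton, levelMult_of_ne hy', levelMult_of_ne hd])
  filter_upwards [key, self_mem_nhdsWithin] with t ht htI
  simp only [sub_eq_zero] at ht
  rwa [bandCount, bandCount, hD.bandCount_set htI.2, hD.bandCount_set ht₀.2]

/-- The count up to `E` can change only when the level passes through `D E`. -/
theorem bandCount_eq_of_isPreconnected (hD : IsHillDiscriminant D) {S : Set ℝ} {E : ℝ}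
    (hS : IsPreconnected S) (hS2 : S ⊆ Icc (-2) 2) (hE : D E ∉ S) {t t' : ℝ} (ht : t ∈ S)
    (ht' : t' ∈ S) : bandCount D t E = bandCount D t' E := by
  refine hS.constant (f := fun t => bandCount D t E) (fun s hs => ?_) ht ht'
  refine tendsto_nhds_of_eventually_eq ?_
  exact (hD.eventually_bandCount_eq (hS2 hs) fun h => hE (h ▸ hs)).filter_mono
    (nhdsWithin_mono _ hS2)

end IsHillDiscriminant

/-- For a smooth family the number of zeros below a fixed energy is locally constant. -/
theorem eventually_bandCount_zero_eq {D : ℝ → ℝ → ℝ}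
    (hsmooth : ContDiff ℝ ∞ (Function.uncurry D))
    (hD : ∀ᶠ δ in 𝓝 0, IsHillDiscriminant (D δ)) {E : ℝ} (hE : D 0 E ≠ 0) :
    ∀ᶠ δ in 𝓝 0, bandCount (D δ) 0 E = bandCount (D 0) 0 E := by
  have hD0 := hD.self_of_nhds
  have habs : |(0 : ℝ)| ≤ 2 := by norm_num
  have hd : ∀ δ x, HasDerivAt (D δ) (fderiv ℝ (Function.uncurry D) (δ, x) (0, 1)) x := by
    intro δ x
    have h1 : HasFDerivAt (Function.uncurry D) (fderiv ℝ (Function.uncurry D) (δ, x)) (δ, x) :=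
      (hsmooth.differentiable (by simp)).differentiableAt.hasFDerivAt
    exact h1.comp_hasDerivAt x ((hasDerivAt_const x δ).prodMk (hasDerivAt_id x))
  have hF' : Continuous (Function.uncurry
      fun δ x => fderiv ℝ (Function.uncurry D) (δ, x) (0, 1)) :=
    (hsmooth.continuous_fderiv (by simp)).clm_apply continuous_const
  have key := eventually_finsum_zeros_eq (F := D) (m := fun δ x => levelMult (D δ) x)
    (p₀ := 0) (l := 𝓝 0) le_rfl hsmooth.continuous (a := -1) (b := E)
    (by have := hD0.two_lt (-1) (by norm_num); linarith)
    hE (hD.mono fun δ h => h.finite_level habs _ _) (hD0.finite_level habs _ _)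
    (by
      intro z _ hz
      -- Level zero is used because |D| < 2 there makes every zero simple, so no fold has to be
      -- followed under the perturbation.
      have hne : deriv (D 0) z ≠ 0 := hD0.deriv_ne z (by rw [hz]; norm_num)
      have := eventually_unique_zero hsmooth.continuous hd hF' (p₀ := 0) hz
        (by rwa [← (hd 0 z).deriv])
      filter_upwards [this] with r hr
      filter_upwards [hr] with δ ⟨y, hy, hy'⟩
      refine (finsum_mem_congr hy fun _ _ => rfl).trans ?_
      rw [finsum_mem_singleton, levelMult_of_ne hne,
        levelMult_of_ne (by rwa [(hd δ y).deriv])])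
  filter_upwards [key, hD] with δ h1 h2
  rwa [bandCount, bandCount, h2.bandCount_set (by norm_num), hD0.bandCount_set (by norm_num)]

theorem abs_two_mul_cos_le (k : ℝ) : |2 * Real.cos k| ≤ 2 := by
  rw [abs_mul, abs_two]
  linarith [Real.abs_cos_le_one k]

/-! ### Band functions as level counts. -/

section

variable {ε μ : ℝ → ℝ} {c : ℝ}

/-- Only the finitely many energies with D = 2 cos k contribute; their spaces are independent and
have dimension `levelMult`. -/
theorem rank_iSup_blochSpace (hε : IsPiecewiseContPeriodic ε)
    (hμ : IsPiecewiseContPeriodic μ) (hc : 0 < c) (hεc : ∀ x, c ≤ ε x) (hμc : ∀ x, c ≤ μ x)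
    (k E : ℝ) : Module.rank ℂ ↥(⨆ E' ∈ Iic E, blochSpace ε μ k E') =
      (bandCount (discriminant ε μ) (2 * Real.cos k) E : Cardinal) := by
  classical
  have hD := isHillDiscriminant hε hμ hc hεc hμc
  have hfd := finiteDimensional_blochSpace hε hμ hc hμc k
  have hfin := hD.finite_bandCount_set (abs_two_mul_cos_le k) E
  set s := hfin.toFinset with hs
  have hsup : ⨆ E' ∈ Iic E, blochSpace ε μ k E' = s.sup (blochSpace ε μ k) := by
    refine le_antisymm (iSup₂_le fun E' hE' => ?_) (Finset.sup_le fun E' hE' => ?_)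
    · by_cases h : discriminant ε μ E' = 2 * Real.cos k
      · exact Finset.le_sup (f := blochSpace ε μ k) ((hfin.mem_toFinset).2 ⟨hE', h⟩)
      · have h0 := finrank_blochSpace_of_ne hε hμ hc hμc h
        rw [Submodule.finrank_eq_zero] at h0
        rw [h0]
        exact bot_le
    · exact le_iSup₂_of_le E' ((hfin.mem_toFinset).1 hE').1 le_rfl
  rw [hsup, ← Module.finrank_eq_rank,
    finrank_finset_sup _ (disjoint_sup_blochSpace hε hμ hc hεc hμc k), bandCount,
    finsum_mem_eq_finite_toFinset_sum _ hfin]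
  congr 1
  refine Finset.sum_congr rfl fun E' hE' => ?_
  exact finrank_blochSpace_of_eq hε hμ hc hεc hμc ((hfin.mem_toFinset).1 hE').2

theorem bandFunction_eq (hε : IsPiecewiseContPeriodic ε)
    (hμ : IsPiecewiseContPeriodic μ) (hc : 0 < c) (hεc : ∀ x, c ≤ ε x) (hμc : ∀ x, c ≤ μ x)
    (j : ℕ) (k : ℝ) : bandFunction ε μ j k =
      sInf {E | j ≤ bandCount (discriminant ε μ) (2 * Real.cos k) E} := by
  rw [bandFunction]
  simp only [rank_iSup_blochSpace hε hμ hc hεc hμc, Nat.cast_le]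

theorem discriminant_eq_of_mem_blochSpectrum (hε : IsPiecewiseContPeriodic ε)
    (hμ : IsPiecewiseContPeriodic μ) (hc : 0 < c) (hμc : ∀ x, c ≤ μ x) {E : ℝ}
    (h : E ∈ blochSpectrum ε μ) : discriminant ε μ E ≤ 2 := by
  obtain ⟨k, -, hk⟩ := h
  by_contra! hlt
  have hne : discriminant ε μ E ≠ 2 * Real.cos k := by
    have := (abs_le.1 (abs_two_mul_cos_le k)).2
    linarith
  have := finiteDimensional_blochSpace hε hμ hc hμc k E
  exact hk (Submodule.finrank_eq_zero.1 (finrank_blochSpace_of_ne hε hμ hc hμc hne))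

end

namespace IsHillDiscriminant

variable {D : ℝ → ℝ}

/-- The band functions in terms of the discriminant. -/
noncomputable def _root_.levelFunction (D : ℝ → ℝ) (j : ℕ) (k : ℝ) : ℝ :=
  sInf {E | j ≤ bandCount D (2 * Real.cos k) E}

theorem bddBelow_levelFunction_set (hD : IsHillDiscriminant D) {j : ℕ} (hj : 1 ≤ j) (k : ℝ) :
    ∀ E ∈ {E | j ≤ bandCount D (2 * Real.cos k) E}, 0 ≤ E := by
  intro E hE
  by_contra! hlt
  have := hD.bandCount_of_neg (abs_two_mul_cos_le k) hlt
  have hE : j ≤ bandCount D (2 * Real.cos k) E := hE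
  omega

theorem levelFunction_le (hD : IsHillDiscriminant D) {j : ℕ} (hj : 1 ≤ j) {k E : ℝ}
    (h : j ≤ bandCount D (2 * Real.cos k) E) : levelFunction D j k ≤ E :=
  csInf_le ⟨0, fun E hE => hD.bddBelow_levelFunction_set hj k E hE⟩ h

/-- Attainment of the count has to be assumed, since the infimum of the empty set is 0. -/
theorem _root_.le_levelFunction {j : ℕ} {k E : ℝ}
    (hne : ∃ E', j ≤ bandCount D (2 * Real.cos k) E')
    (h : ∀ E' < E, bandCount D (2 * Real.cos k) E' < j) : E ≤ levelFunction D j k := by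
  refine le_csInf hne fun E' hE' => ?_
  by_contra! hlt
  exact (h E' hlt).not_ge hE'

/-- Beyond an energy where the discriminant drops below `2` every level is attained. -/
theorem exists_level (hD : IsHillDiscriminant D) {a b : ℝ} (hab : a < b) (ha : D a = 2)
    (hb : ∀ x ∈ Ioc a b, D x < 2) {t : ℝ} (ht : t ∈ Icc (-2 : ℝ) 2) : ∃ x ≥ a, D x = t := by
  have hcont := hD.differentiable.continuous
  obtain ⟨e, he, hDe⟩ := hD.oscillates (b + 1)
  -- A minimum value strictly between -2 and 2 would be taken in the interior, as D = 2 at `a` and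
  -- |D| ≥ 2 at `e`, and would be a forbidden critical point. So D falls to -2 or lower.
  obtain ⟨m, hm, hmin⟩ := isCompact_Icc.exists_isMinOn (nonempty_Icc.2 (by linarith : a ≤ e))
    hcont.continuousOn
  have hmb : D m < 2 := lt_of_le_of_lt (hmin (show b ∈ Icc a e from ⟨hab.le, by linarith⟩))
    (hb b ⟨hab, le_rfl⟩)
  have hm2 : D m ≤ -2 := by
    by_contra! hgt
    have hlt : |D m| < 2 := abs_lt.2 ⟨hgt, hmb⟩
    have ham : a < m := lt_of_le_of_ne hm.1 fun h => by rw [← h, ha] at hmb; linarith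
    have hme : m < e := lt_of_le_of_ne hm.2 fun h => by rw [h] at hlt; linarith
    exact hD.deriv_ne m hlt
      ((hmin.isLocalMin (Icc_mem_nhds ham hme)).deriv_eq_zero)
  obtain ⟨x, hx, hxt⟩ := intermediate_value_Icc' hm.1 hcont.continuousOn
    (show t ∈ Icc (D m) (D a) from ⟨by linarith [ht.1], by linarith [ht.2]⟩)
  exact ⟨x, hx.1, hxt⟩

theorem cos_mem (k : ℝ) : 2 * Real.cos k ∈ Icc (-2 : ℝ) 2 :=
  abs_le.1 (abs_two_mul_cos_le k)

/-- Band edges at a gap: if `D > 2` on `(a, b)` between two band edges and the level zero is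
taken `j` times below the gap, then the gap separates the bands `j` and `j + 1`. -/
theorem levelFunction_gap (hD : IsHillDiscriminant D) {j : ℕ} (hj : 1 ≤ j) {a b b' : ℝ}
    (hab : a < b) (hbb' : b < b') (ha : D a = 2) (hb : D b = 2) (hgap : ∀ x ∈ Ioo a b, 2 < D x)
    (hb' : ∀ x ∈ Ioc b b', D x < 2) (hcount : bandCount D 0 a = j) :
    levelFunction D j 0 = a ∧ levelFunction D (j + 1) 0 = b ∧
      (∀ k, levelFunction D j k ≤ a) ∧ ∀ k, b ≤ levelFunction D (j + 1) k := by
  -- Inside the gap D > 2, so the count is the same for all levels in [-2, 2] and can be taken at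
  -- level 0.
  have hG : ∀ G ∈ Ioo a b, ∀ t ∈ Icc (-2 : ℝ) 2, bandCount D t G = j := by
    intro G hG t ht
    rw [hD.bandCount_eq_of_isPreconnected isPreconnected_Icc Subset.rfl
      (fun h => (hgap G hG).not_ge h.2) ht (show (0 : ℝ) ∈ Icc (-2 : ℝ) 2 by norm_num), ← hcount]
    refine (bandCount_congr hG.1.le fun x hx => ?_).symm
    have := hgap x ⟨hx.1, hx.2.trans_lt hG.2⟩
    linarith
  have h1 : ∀ k, levelFunction D j k ≤ a := by
    intro k
    refine le_of_forall_gt_imp_ge_of_dense fun G hGa => ?_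
    rcases lt_or_ge G b with h | h
    · exact hD.levelFunction_le hj (hG G ⟨hGa, h⟩ _ (cos_mem k)).ge
    · obtain ⟨G', hG'⟩ := exists_between hab
      exact (hD.levelFunction_le hj (hG G' hG' _ (cos_mem k)).ge).trans (hG'.2.le.trans h)
  obtain ⟨G, hGab⟩ := exists_between hab
  have h2 : ∀ k, b ≤ levelFunction D (j + 1) k := by
    intro k
    refine le_levelFunction ?_ fun E' hE' => ?_
    -- The level is attained again beyond `b`, so the count does reach j + 1.
    · obtain ⟨x, hx, hxt⟩ := hD.exists_level hbb' hb hb' (cos_mem k)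
      refine ⟨x, ?_⟩
      have := hD.bandCount_lt (abs_two_mul_cos_le k) (hGab.2.trans_le hx) hxt
      rw [hG G hGab _ (cos_mem k)] at this
      exact this
    · obtain ⟨G', hG'1, hG'2⟩ := exists_between (max_lt hab hE')
      have h3 := hD.bandCount_mono (abs_two_mul_cos_le k)
        ((le_max_right a E').trans hG'1.le)
      rw [hG G' ⟨(le_max_left a E').trans_lt hG'1, hG'2⟩ _ (cos_mem k)] at h3
      omega
  have hcos : 2 * Real.cos 0 = 2 := by simp
  have h22 : |(2 : ℝ)| ≤ 2 := by norm_num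
  refine ⟨le_antisymm (h1 0) (le_levelFunction ⟨G, (hG G hGab _ (cos_mem 0)).ge⟩
    fun E' hE' => ?_), le_antisymm (hD.levelFunction_le (by omega) ?_) (h2 0), h1, h2⟩
  · rw [hcos]
    have h3 := hD.bandCount_lt h22 hE' ha
    have h4 := hD.bandCount_mono h22 hGab.1.le
    rw [hG G hGab 2 (by norm_num)] at h4
    omega
  · rw [hcos]
    have h3 := hD.bandCount_lt h22 hGab.2 hb
    rw [hG G hGab 2 (by norm_num)] at h3
    exact h3

/-- A conical crossing of the bands `j` and `j + 1` fixes the count of levels below it. -/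
theorem bandCount_of_cone (hD : IsHillDiscriminant D) {j : ℕ} (hj : 1 ≤ j) {E₀ : ℝ}
    (hE₀ : D E₀ = 2)
    (hlow : ∀ᶠ k in 𝓝[>] (0 : ℝ), levelFunction D j k < E₀)
    (hlow0 : ∀ᶠ k in 𝓝[>] (0 : ℝ), levelFunction D j k ≠ 0)
    (hup : ∀ᶠ k in 𝓝[>] (0 : ℝ), E₀ < levelFunction D (j + 1) k) : bandCount D 0 E₀ = j := by
  have hk : ∀ᶠ k in 𝓝[>] (0 : ℝ), k < Real.pi / 2 :=
    mem_nhdsWithin_of_mem_nhds (Iio_mem_nhds (by positivity))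
  obtain ⟨k, h1, h2, h3, h4, h5⟩ :=
    (hlow.and (hlow0.and (hup.and (hk.and self_mem_nhdsWithin)))).exists
  have hk0 : 0 < k := h5
  have hcos : 2 * Real.cos k < 2 := by
    have := Real.cos_lt_cos_of_nonneg_of_le_pi_div_two le_rfl h4.le hk0
    rw [Real.cos_zero] at this
    linarith
  have hle : j ≤ bandCount D (2 * Real.cos k) E₀ := by
    -- Were the count never `j`, the infimum of the empty set would give the value 0, which `hlow0`
    -- excludes.
    have hne : {E | j ≤ bandCount D (2 * Real.cos k) E}.Nonempty := by
      by_contra hemp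
      rw [not_nonempty_iff_eq_empty] at hemp
      rw [levelFunction, hemp, Real.sInf_empty] at h2
      exact h2 rfl
    obtain ⟨E, hE, hlt⟩ := exists_lt_of_csInf_lt hne h1
    exact le_trans hE (hD.bandCount_mono (abs_two_mul_cos_le k) hlt.le)
  have hge : bandCount D (2 * Real.cos k) E₀ < j + 1 := by
    by_contra! hcon
    exact h3.not_ge (hD.levelFunction_le (by omega) hcon)
  -- D = 2 at `E₀` lies outside [-2, 2), so the count passes from level 2 cos k to level 0.
  have hconst := hD.bandCount_eq_of_isPreconnected (S := Ico (-2) 2) (E := E₀)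
    isPreconnected_Ico Ico_subset_Icc_self (by simp [hE₀])
    (show (0 : ℝ) ∈ Ico (-2 : ℝ) 2 by norm_num)
    (show 2 * Real.cos k ∈ Ico (-2 : ℝ) 2 from ⟨(cos_mem k).1, hcos⟩)
  omega

/-- At E₀ = 0 a nondegenerate maximum of value 2 would give D < 2 at some negative energy.
Positivity separates band values near `E₀` from the value 0 of an empty infimum. -/
theorem pos_of_double (hD : IsHillDiscriminant D) {E₀ : ℝ} (hE₀ : D E₀ = 2)
    (hd : deriv D E₀ = 0) : 0 < E₀ := by
  refine lt_of_le_of_ne (hD.nonneg_of_level le_rfl hE₀) fun h => ?_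
  have hanti := strictAntiOn_deriv_near hD.contDiff (hD.neg_of_two E₀ hE₀ hd)
  obtain ⟨r, hr, hr0⟩ := (hanti.and self_mem_nhdsWithin).exists
  have hr0 : 0 < r := hr0
  obtain ⟨ξ, hξ, hs⟩ := exists_deriv_eq_slope D (show E₀ - r / 2 < E₀ by linarith)
    hD.differentiable.continuous.continuousOn hD.differentiable.differentiableOn
  have h1 : 0 < deriv D ξ := by
    rw [← hd]
    exact hr ⟨by linarith [hξ.1], by linarith [hξ.2]⟩ ⟨by linarith, by linarith⟩ hξ.2
  rw [hs] at h1
  have h2 : 0 < D E₀ - D (E₀ - r / 2) := by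
    have h3 : 0 < E₀ - (E₀ - r / 2) := by linarith
    exact (div_pos_iff_of_pos_right h3).1 h1
  have := hD.two_lt (E₀ - r / 2) (by linarith)
  linarith

end IsHillDiscriminant

/-! ### Second order expansion and the opening of the gap. -/

/-- The partial derivative of `F` in the first variable. -/
noncomputable def partialFst (F : ℝ × ℝ → ℝ) (p : ℝ × ℝ) : ℝ := fderiv ℝ F p (1, 0)

/-- The partial derivative of `F` in the second variable. -/
noncomputable def partialSnd (F : ℝ × ℝ → ℝ) (p : ℝ × ℝ) : ℝ := fderiv ℝ F p (0, 1)

section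

variable {F : ℝ × ℝ → ℝ}

theorem contDiff_partialFst (hF : ContDiff ℝ ∞ F) : ContDiff ℝ ∞ (partialFst F) :=
  (hF.fderiv_right (by simp)).clm_apply contDiff_const

theorem contDiff_partialSnd (hF : ContDiff ℝ ∞ F) : ContDiff ℝ ∞ (partialSnd F) :=
  (hF.fderiv_right (by simp)).clm_apply contDiff_const

theorem hasDerivAt_along_line (hF : ContDiff ℝ ∞ F) {δ : ℝ} (E u v s : ℝ) :
    HasDerivAt (fun s => F (E + u * s, v * s + δ))
      (u * partialFst F (E + u * s, v * s + δ) + v * partialSnd F (E + u * s, v * s + δ)) s := by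
  have h1 : HasDerivAt (fun s : ℝ => (E + u * s, v * s + δ)) (u, v) s := by
    refine HasDerivAt.prodMk ?_ ?_
    · simpa using ((hasDerivAt_id s).const_mul u).const_add E
    · simpa using ((hasDerivAt_id s).const_mul v).add_const δ
  have h2 := (hF.differentiable (by simp) (E + u * s, v * s + δ)).hasFDerivAt.comp_hasDerivAt s h1
  refine h2.congr_deriv ?_
  have : ((u, v) : ℝ × ℝ) = u • (1, 0) + v • (0, 1) := by simp
  rw [this, map_add, map_smul, map_smul]
  rfl

theorem hasDerivAt_fst (hF : ContDiff ℝ ∞ F) (E δ : ℝ) :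
    HasDerivAt (fun E => F (E, δ)) (partialFst F (E, δ)) E := by
  simpa using hasDerivAt_along_line (δ := δ) hF 0 1 0 E

theorem hasDerivAt_snd (hF : ContDiff ℝ ∞ F) (E δ : ℝ) :
    HasDerivAt (fun δ => F (E, δ)) (partialSnd F (E, δ)) δ := by
  simpa using hasDerivAt_along_line (δ := 0) hF E 0 1 δ

theorem hasDerivAt_ray (hF : ContDiff ℝ ∞ F) (E y s : ℝ) :
    HasDerivAt (fun s => F (E + y * s, s))
      (y * partialFst F (E + y * s, s) + partialSnd F (E + y * s, s)) s := by
  simpa using hasDerivAt_along_line (δ := 0) hF E y 1 s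

theorem partialFst_partialSnd (hF : ContDiff ℝ ∞ F) (p : ℝ × ℝ) :
    partialFst (partialSnd F) p = partialSnd (partialFst F) p := by
  have hd : DifferentiableAt ℝ (fderiv ℝ F) p :=
    (hF.fderiv_right (m := ∞) (by simp)).differentiable (by simp) p
  have key : ∀ a b : ℝ × ℝ, fderiv ℝ (fun q => fderiv ℝ F q a) p b =
      fderiv ℝ (fderiv ℝ F) p b a := by
    intro a b
    rw [fderiv_clm_apply hd (differentiableAt_const _)]
    simp
  have hsymm : IsSymmSndFDerivAt ℝ F p :=
    (contDiff_infty.1 hF 2).contDiffAt.isSymmSndFDerivAt (by simp)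
  calc partialFst (partialSnd F) p = fderiv ℝ (fderiv ℝ F) p (1, 0) (0, 1) := key _ _
    _ = fderiv ℝ (fderiv ℝ F) p (0, 1) (1, 0) := hsymm _ _
    _ = partialSnd (partialFst F) p := (key _ _).symm

end

/-- The mean value theorem raises the order of vanishing by one; three applications turn a bounded
third derivative into a cubic remainder. -/
theorem abs_le_pow_succ_of_deriv {f f' : ℝ → ℝ} {K : ℝ} {n : ℕ} (hK : 0 ≤ K)
    (hf : ∀ s, HasDerivAt f (f' s) s) (h0 : f 0 = 0)
    (hb : ∀ s ∈ Icc (0 : ℝ) 1, |f' s| ≤ K * s ^ n) :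
    ∀ s ∈ Icc (0 : ℝ) 1, |f s| ≤ K * s ^ (n + 1) := by
  intro s hs
  rcases hs.1.eq_or_lt with rfl | hpos
  · simp [h0]
  obtain ⟨ξ, hξ, h⟩ := exists_hasDerivAt_eq_slope f f' hpos
    (fun x _ => (hf x).continuousAt.continuousWithinAt) (fun x _ => hf x)
  have h2 : f s = f' ξ * s := by
    rw [h, h0]
    field_simp
    ring
  rw [h2, abs_mul, abs_of_pos hpos, pow_succ, ← mul_assoc]
  refine mul_le_mul_of_nonneg_right ((hb ξ ⟨hξ.1.le, hξ.2.le.trans hs.2⟩).trans ?_) hpos.le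
  gcongr
  exacts [hξ.1.le, hξ.2.le]

/-- Second order expansion at a critical point, along the rays through it, uniformly in the
direction. -/
theorem exists_quadratic_expansion {F : ℝ × ℝ → ℝ} (hF : ContDiff ℝ ∞ F) {E₀ : ℝ}
    (h1 : partialFst F (E₀, 0) = 0) (h2 : partialSnd F (E₀, 0) = 0) (Y : ℝ) :
    ∃ K ≥ 0, ∀ y ∈ Icc (-Y) Y, ∀ s ∈ Icc (0 : ℝ) 1,
      |F (E₀ + y * s, s) - F (E₀, 0) - s ^ 2 / 2 * (partialFst (partialFst F) (E₀, 0) * y ^ 2 +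
        2 * partialFst (partialSnd F) (E₀, 0) * y + partialSnd (partialSnd F) (E₀, 0))| ≤
        K * s ^ 3 := by
  -- `A`, `B` and `T` are the first three derivatives of s ↦ F(E₀ + ys, s); `T` is bounded for
  -- bounded y, uniformly.
  set A : ℝ → ℝ → ℝ := fun y s => y * partialFst F (E₀ + y * s, s) + partialSnd F (E₀ + y * s, s)
    with hA
  have c1 := contDiff_partialFst hF
  have c2 := contDiff_partialSnd hF
  have c11 := contDiff_partialFst c1
  have c12 := contDiff_partialSnd c1
  have c21 := contDiff_partialFst c2
  have c22 := contDiff_partialSnd c2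
  set B : ℝ → ℝ → ℝ := fun y s =>
    y * (y * partialFst (partialFst F) (E₀ + y * s, s) +
      partialSnd (partialFst F) (E₀ + y * s, s)) +
    (y * partialFst (partialSnd F) (E₀ + y * s, s) +
      partialSnd (partialSnd F) (E₀ + y * s, s)) with hB
  set T : ℝ × ℝ → ℝ := fun q =>
    q.1 * (q.1 * (q.1 * partialFst (partialFst (partialFst F)) (E₀ + q.1 * q.2, q.2) +
        partialSnd (partialFst (partialFst F)) (E₀ + q.1 * q.2, q.2)) +
      (q.1 * partialFst (partialSnd (partialFst F)) (E₀ + q.1 * q.2, q.2) +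
        partialSnd (partialSnd (partialFst F)) (E₀ + q.1 * q.2, q.2))) +
    (q.1 * (q.1 * partialFst (partialFst (partialSnd F)) (E₀ + q.1 * q.2, q.2) +
        partialSnd (partialFst (partialSnd F)) (E₀ + q.1 * q.2, q.2)) +
      (q.1 * partialFst (partialSnd (partialSnd F)) (E₀ + q.1 * q.2, q.2) +
        partialSnd (partialSnd (partialSnd F)) (E₀ + q.1 * q.2, q.2))) with hT
  have dA : ∀ y s, HasDerivAt (A y) (B y s) s := fun y s =>
    ((hasDerivAt_ray c1 E₀ y s).const_mul y).add (hasDerivAt_ray c2 E₀ y s)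
  have dB : ∀ y s, HasDerivAt (B y) (T (y, s)) s := fun y s =>
    ((((hasDerivAt_ray c11 E₀ y s).const_mul y).add (hasDerivAt_ray c12 E₀ y s)).const_mul y).add
      (((hasDerivAt_ray c21 E₀ y s).const_mul y).add (hasDerivAt_ray c22 E₀ y s))
  have cT : Continuous T := by
    have e1 := (contDiff_partialFst c11).continuous
    have e2 := (contDiff_partialSnd c11).continuous
    have e3 := (contDiff_partialFst c12).continuous
    have e4 := (contDiff_partialSnd c12).continuous
    have e5 := (contDiff_partialFst c21).continuous
    have e6 := (contDiff_partialSnd c21).continuous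
    have e7 := (contDiff_partialFst c22).continuous
    have e8 := (contDiff_partialSnd c22).continuous
    fun_prop
  obtain ⟨K, hK⟩ := (isCompact_Icc.prod isCompact_Icc).exists_bound_of_continuousOn
    (s := Icc (-Y) Y ×ˢ Icc (0 : ℝ) 1) cT.continuousOn
  refine ⟨|K|, abs_nonneg K, fun y hy => ?_⟩
  have b3 : ∀ s ∈ Icc (0 : ℝ) 1, |T (y, s)| ≤ |K| * s ^ 0 := fun s hs => by
    have := hK (y, s) ⟨hy, hs⟩
    rw [pow_zero, mul_one]
    exact this.trans (le_abs_self K)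
  have b2 := abs_le_pow_succ_of_deriv (f := fun s => B y s - B y 0) (abs_nonneg K)
    (fun s => (dB y s).sub_const _) (by simp) b3
  have b1 := abs_le_pow_succ_of_deriv (f := fun s => A y s - B y 0 * s) (abs_nonneg K)
    (fun s => ((dA y s).sub ((hasDerivAt_id s).const_mul (B y 0))).congr_deriv (by simp))
    (by simp [hA, h1, h2]) b2
  have b0 := abs_le_pow_succ_of_deriv
    (f := fun s => F (E₀ + y * s, s) - F (E₀, 0) - s ^ 2 / 2 * B y 0) (abs_nonneg K)
    (fun s => by
      have := ((hasDerivAt_ray hF E₀ y s).sub_const (F (E₀, 0))).sub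
        (((hasDerivAt_pow 2 s).div_const 2).mul_const (B y 0))
      refine this.congr_deriv ?_
      simp only [hA]
      push_cast
      ring) (by simp) b1
  intro s hs
  have hBy : B y 0 = partialFst (partialFst F) (E₀, 0) * y ^ 2 +
      2 * partialFst (partialSnd F) (E₀, 0) * y + partialSnd (partialSnd F) (E₀, 0) := by
    simp only [hB, mul_zero, add_zero, ← partialFst_partialSnd hF]
    ring
  rw [← hBy]
  exact b0 s hs

/-- For E = E₀ + yδ, G - t is (δ²/2) a₁(y - m)(y - n) up to the stated error. Since a₁(n - m) = -2w
and 2h < n - m, the quadratic has absolute value at least wh at m ± h and n ± h, with opposite signs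
on the two sides of each root. -/
theorem exists_level_near_roots {G : ℝ → ℝ} (hG : Continuous G) {E₀ t a₁ m n w h δ : ℝ}
    (hneg : a₁ < 0) (haw : a₁ * (n - m) = -2 * w) (hw : 0 < w) (hh : 0 < h)
    (hgap : 2 * h < n - m) (hδ : 0 < δ)
    (hexp : ∀ y ∈ Icc (m - h) (n + h),
      |G (E₀ + y * δ) - t - δ ^ 2 / 2 * (a₁ * ((y - m) * (y - n)))| < δ ^ 2 / 2 * (w * h)) :
    (∃ a ∈ Ioo (E₀ + (m - h) * δ) (E₀ + (m + h) * δ), G a = t) ∧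
      ∃ b ∈ Ioo (E₀ + (n - h) * δ) (E₀ + (n + h) * δ), G b = t := by
  have hlt : ∀ y ∈ Icc (m - h) (n + h), a₁ * ((y - m) * (y - n)) ≤ -(w * h) →
      G (E₀ + y * δ) < t := fun y hy hle => by
    have := (abs_lt.1 (hexp y hy)).2
    have : δ ^ 2 / 2 * (a₁ * ((y - m) * (y - n))) ≤ δ ^ 2 / 2 * (-(w * h)) := by gcongr
    linarith
  have hgt : ∀ y ∈ Icc (m - h) (n + h), w * h ≤ a₁ * ((y - m) * (y - n)) →
      t < G (E₀ + y * δ) := fun y hy hle => by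
    have := (abs_lt.1 (hexp y hy)).1
    have : δ ^ 2 / 2 * (w * h) ≤ δ ^ 2 / 2 * (a₁ * ((y - m) * (y - n))) := by gcongr
    linarith
  have hah : -w ≤ a₁ * h := by
    have := mul_le_mul_of_nonpos_left hgap.le hneg.le
    linarith
  have hwh : 0 < w * h := by positivity
  have hout : h * (-2 * w) + a₁ * h * h ≤ -(w * h) := by
    have : a₁ * h * h ≤ 0 :=
      mul_nonpos_of_nonpos_of_nonneg (mul_neg_of_neg_of_pos hneg hh).le hh.le
    linarith
  have hin : w * h ≤ -h * (-2 * w) + a₁ * h * h := by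
    have := mul_le_mul_of_nonneg_right hah hh.le
    linarith
  have s1 : G (E₀ + (m - h) * δ) < t := hlt _ ⟨le_rfl, by linarith⟩ (by
    have : a₁ * ((m - h - m) * (m - h - n)) = h * (a₁ * (n - m)) + a₁ * h * h := by ring
    rwa [this, haw])
  have s2 : t < G (E₀ + (m + h) * δ) := hgt _ ⟨by linarith, by linarith⟩ (by
    have : a₁ * ((m + h - m) * (m + h - n)) = -h * (a₁ * (n - m)) + a₁ * h * h := by ring
    rwa [this, haw])
  have s3 : t < G (E₀ + (n - h) * δ) := hgt _ ⟨by linarith, by linarith⟩ (by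
    have : a₁ * ((n - h - m) * (n - h - n)) = -h * (a₁ * (n - m)) + a₁ * h * h := by ring
    rwa [this, haw])
  have s4 : G (E₀ + (n + h) * δ) < t := hlt _ ⟨by linarith, le_rfl⟩ (by
    have : a₁ * ((n + h - m) * (n + h - n)) = h * (a₁ * (n - m)) + a₁ * h * h := by ring
    rwa [this, haw])
  exact ⟨intermediate_value_Ioo (show E₀ + (m - h) * δ ≤ E₀ + (m + h) * δ by gcongr; linarith)
      hG.continuousOn ⟨s1, s2⟩,
    intermediate_value_Ioo' (show E₀ + (n - h) * δ ≤ E₀ + (n + h) * δ by gcongr; linarith)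
      hG.continuousOn ⟨s4, s3⟩⟩

theorem StrictConcaveOn.lt_between_and_beyond {G : ℝ → ℝ} {S : Set ℝ}
    (hG : StrictConcaveOn ℝ S G) {a b t : ℝ} (hab : a < b) (ha : a ∈ S) (hb : b ∈ S)
    (hGa : G a = t) (hGb : G b = t) :
    (∀ x ∈ Ioo a b, t < G x) ∧ ∀ x ∈ S, b < x → G x < t := by
  refine ⟨fun x hx => ?_, fun x hxS hx => ?_⟩
  · have := hG.lt_on_openSegment ha hb hab.ne
      (by rwa [openSegment_eq_Ioo hab] : x ∈ openSegment ℝ a b)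
    simpa [hGa, hGb] using this
  · by_contra! hcon
    have := hG.lt_on_openSegment ha hxS (hab.trans hx).ne
      (by rw [openSegment_eq_Ioo (hab.trans hx)]; exact ⟨hab, hx⟩ : b ∈ openSegment ℝ a x)
    rw [hGa, hGb, min_eq_left hcon] at this
    exact lt_irrefl _ this

/-- Near a critical point with value two, strictly concave in the first variable, the region
where a smooth function exceeds two opens linearly when the Hessian is indefinite. -/
theorem exists_gap_of_indefinite {F : ℝ × ℝ → ℝ} (hF : ContDiff ℝ ∞ F) {E₀ a₁ a₂ a₃ : ℝ}
    (h0 : F (E₀, 0) = 2) (h1 : partialFst F (E₀, 0) = 0) (h2 : partialSnd F (E₀, 0) = 0)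
    (ha₁ : partialFst (partialFst F) (E₀, 0) = a₁)
    (ha₂ : partialFst (partialSnd F) (E₀, 0) = a₂)
    (ha₃ : partialSnd (partialSnd F) (E₀, 0) = a₃) (hneg : a₁ < 0)
    (ha : 0 < a₂ ^ 2 - a₁ * a₃) :
    ∃ r > 0, ∃ C, ∀ᶠ δ in 𝓝[>] (0 : ℝ), ∃ a b,
      |a - (E₀ + (-a₂ + √(a₂ ^ 2 - a₁ * a₃)) / a₁ * δ)| ≤ C * δ ^ 2 ∧
      |b - (E₀ + (-a₂ - √(a₂ ^ 2 - a₁ * a₃)) / a₁ * δ)| ≤ C * δ ^ 2 ∧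
      E₀ - r < a ∧ a < b ∧ b < E₀ + r ∧ F (a, δ) = 2 ∧ F (b, δ) = 2 ∧
      (∀ x ∈ Ioo a b, 2 < F (x, δ)) ∧ (∀ x ∈ Ioc b (E₀ + r), F (x, δ) < 2) ∧
      ∀ x ∈ Icc (E₀ - r) (E₀ + r), 0 < F (x, δ) := by
  have c11 := (contDiff_partialFst (contDiff_partialFst hF)).continuous
  have hnear : ∀ᶠ p in 𝓝 (E₀, (0 : ℝ)), partialFst (partialFst F) p < 0 ∧ 0 < F p :=
    (c11.continuousAt.eventually_lt continuousAt_const (by rwa [ha₁])).and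
      (continuousAt_const.eventually_lt hF.continuous.continuousAt (by rw [h0]; norm_num))
  obtain ⟨ρ, hρ, hball⟩ := Metric.eventually_nhds_iff.1 hnear
  set w := √(a₂ ^ 2 - a₁ * a₃) with hw
  have hw0 : 0 < w := Real.sqrt_pos.2 ha
  have hw2 : w ^ 2 = a₂ ^ 2 - a₁ * a₃ := Real.sq_sqrt ha.le
  -- As a₁ < 0, the root with +w is the smaller one.
  set m := (-a₂ + w) / a₁ with hm
  set n := (-a₂ - w) / a₁ with hn
  have hmn : n - m = -2 * w / a₁ := by rw [hm, hn]; ring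
  have hgap : 0 < n - m := by rw [hmn]; exact div_pos_of_neg_of_neg (by linarith) hneg
  have hq : ∀ y, a₁ * y ^ 2 + 2 * a₂ * y + a₃ = a₁ * ((y - m) * (y - n)) := by
    intro y
    have hm' : a₁ * m = -a₂ + w := by rw [hm, mul_div_cancel₀ _ hneg.ne]
    have hn' : a₁ * n = -a₂ - w := by rw [hn, mul_div_cancel₀ _ hneg.ne]
    have : a₁ * (a₁ * y ^ 2 + 2 * a₂ * y + a₃) = a₁ * (a₁ * ((y - m) * (y - n))) := by
      linear_combination (a₁ * y) * hm' + (a₁ * y) * hn' - (a₁ * n) * hm' - (-a₂ + w) * hn' + hw2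
    exact mul_left_cancel₀ hneg.ne this
  set Y := |m| + |n| + 1 with hY
  obtain ⟨K, hK, hexp⟩ := exists_quadratic_expansion hF h1 h2 Y
  simp only [ha₁, ha₂, ha₃, h0, hq] at hexp
  -- With h = Cδ this makes Kδ³ less than (δ²/2)wh. An error h in y is an error Cδ² in the energy.
  set C := 2 * K / w + 1 with hC
  have hC0 : 0 < C := by positivity
  have hKC : K < C * w / 2 := by
    rw [hC]
    field_simp
    linarith
  have haw : a₁ * (n - m) = -2 * w := by rw [hmn, mul_div_cancel₀ _ hneg.ne]
  refine ⟨ρ / 2, by positivity, C, ?_⟩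
  -- The bounds keep δ in the range of the expansion, all energies within the ball of radius ρ, h
  -- below 1 and the two root intervals disjoint.
  have hs1 : ∀ᶠ δ in 𝓝[>] (0 : ℝ), δ < min 1 (min (ρ / 2) (min (ρ / (2 * Y)) (min (1 / C)
      ((n - m) / (2 * C))))) :=
    mem_nhdsWithin_of_mem_nhds (Iio_mem_nhds (by positivity))
  filter_upwards [hs1, self_mem_nhdsWithin] with δ hδ hδ0
  have hδ0 : 0 < δ := hδ0
  simp only [lt_min_iff] at hδ
  obtain ⟨hδ1, hδρ, hδY, hδC, hδg⟩ := hδ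
  have hδC : C * δ < 1 := by rwa [lt_div_iff₀ hC0, mul_comm] at hδC
  have hδg : 2 * (C * δ) < n - m := by
    rw [lt_div_iff₀ (by positivity)] at hδg
    linarith
  have hδY : Y * δ < ρ / 2 := by
    rw [lt_div_iff₀ (by positivity)] at hδY
    linarith
  set h := C * δ with hh
  have hh0 : 0 < h := by positivity
  have hKδ : K * δ ^ 3 < δ ^ 2 / 2 * (w * h) := by
    have : K * δ ^ 3 < C * w / 2 * δ ^ 3 := by gcongr
    rw [hh]
    linarith
  have hmY := neg_abs_le m
  have hmY' := le_abs_self m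
  have hnY := neg_abs_le n
  have hnY' := le_abs_self n
  have hYb : ∀ y, y ∈ Icc (m - h) (n + h) → y ∈ Icc (-Y) Y := fun y hy => by
    have := abs_nonneg m
    have := abs_nonneg n
    exact ⟨by linarith [hy.1], by linarith [hy.2]⟩
  have cF : Continuous fun x => F (x, δ) := hF.continuous.comp (by fun_prop)
  obtain ⟨⟨a, haI, haF⟩, b, hbI, hbF⟩ := exists_level_near_roots cF hneg haw hw0 hh0 hδg hδ0
    fun y hy => (hexp y (hYb y hy) δ ⟨hδ0.le, hδ1.le⟩).trans_lt hKδ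
  have haF : F (a, δ) = 2 := haF
  have hbF : F (b, δ) = 2 := hbF
  have hab : a < b := by
    have : (m + h) * δ ≤ (n - h) * δ := by gcongr; linarith
    linarith [haI.2, hbI.1]
  have har : E₀ - ρ / 2 < a := by
    have : -Y * δ ≤ (m - h) * δ := by gcongr; exact (hYb _ ⟨le_rfl, by linarith⟩).1
    linarith [haI.1]
  have hbr : b < E₀ + ρ / 2 := by
    have : (n + h) * δ ≤ Y * δ := by gcongr; exact (hYb _ ⟨by linarith, le_rfl⟩).2
    linarith [hbI.2]
  have hmem : ∀ x ∈ Icc (E₀ - ρ / 2) (E₀ + ρ / 2),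
      partialFst (partialFst F) (x, δ) < 0 ∧ 0 < F (x, δ) := fun x hx => by
    refine hball ?_
    rw [Prod.dist_eq, max_lt_iff, Real.dist_eq, Real.dist_eq, sub_zero, abs_of_pos hδ0]
    exact ⟨(abs_le.2 ⟨by linarith [hx.1], by linarith [hx.2]⟩ : _ ≤ ρ / 2).trans_lt
      (by linarith), by linarith⟩
  -- Strict concavity in the energy turns the two solutions into the sign of F - 2 between and
  -- beyond them.
  have hconc : StrictConcaveOn ℝ (Icc (E₀ - ρ / 2) (E₀ + ρ / 2)) fun x => F (x, δ) := by
    refine strictConcaveOn_of_deriv2_neg (convex_Icc _ _) cF.continuousOn fun x hx => ?_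
    rw [interior_Icc] at hx
    have e1 : deriv (fun x => F (x, δ)) = fun x => partialFst F (x, δ) :=
      funext fun x => (hasDerivAt_fst hF x δ).deriv
    rw [Function.iterate_succ, Function.iterate_one, Function.comp_apply, e1,
      (hasDerivAt_fst (contDiff_partialFst hF) x δ).deriv]
    exact (hmem x (Ioo_subset_Icc_self hx)).1
  have haM : a ∈ Icc (E₀ - ρ / 2) (E₀ + ρ / 2) := ⟨har.le, by linarith⟩
  have hbM : b ∈ Icc (E₀ - ρ / 2) (E₀ + ρ / 2) := ⟨by linarith, hbr.le⟩
  obtain ⟨hbetween, hbeyond⟩ := hconc.lt_between_and_beyond hab haM hbM haF hbF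
  have hCh : C * δ ^ 2 = h * δ := by rw [hh]; ring
  rw [hCh]
  exact ⟨a, b, abs_le.2 ⟨by linarith [haI.1], by linarith [haI.2]⟩,
    abs_le.2 ⟨by linarith [hbI.1], by linarith [hbI.2]⟩, har, hab, hbr, haF, hbF, hbetween,
    fun x hx => hbeyond x ⟨by linarith [hx.1], hx.2⟩ hx.1, fun x hx => (hmem x hx).2⟩

theorem iteratedDeriv_two_fst {F : ℝ × ℝ → ℝ} (hF : ContDiff ℝ ∞ F) (E δ : ℝ) :
    iteratedDeriv 2 (fun E => F (E, δ)) E = partialFst (partialFst F) (E, δ) := by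
  have e1 : deriv (fun x => F (x, δ)) = fun x => partialFst F (x, δ) :=
    funext fun x => (hasDerivAt_fst hF x δ).deriv
  rw [iteratedDeriv_succ, iteratedDeriv_one, e1,
    (hasDerivAt_fst (contDiff_partialFst hF) E δ).deriv]

theorem iteratedDeriv_two_snd {F : ℝ × ℝ → ℝ} (hF : ContDiff ℝ ∞ F) (E δ : ℝ) :
    iteratedDeriv 2 (fun δ => F (E, δ)) δ = partialSnd (partialSnd F) (E, δ) := by
  have e1 : deriv (fun x => F (E, x)) = fun x => partialSnd F (E, x) :=
    funext fun x => (hasDerivAt_snd hF E x).deriv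
  rw [iteratedDeriv_succ, iteratedDeriv_one, e1,
    (hasDerivAt_snd (contDiff_partialSnd hF) E δ).deriv]

theorem deriv_deriv_fst_snd {F : ℝ × ℝ → ℝ} (hF : ContDiff ℝ ∞ F) (E δ : ℝ) :
    deriv (fun E => deriv (fun δ => F (E, δ)) δ) E = partialFst (partialSnd F) (E, δ) := by
  have e1 : (fun E => deriv (fun δ => F (E, δ)) δ) = fun x => partialSnd F (x, δ) :=
    funext fun x => (hasDerivAt_snd hF x δ).deriv
  rw [e1, (hasDerivAt_fst (contDiff_partialSnd hF) E δ).deriv]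

/-! ### Spectral data at the Dirac point and the conclusion. -/

section

variable {ε μ ε₁ μ₁ : ℝ → ℝ} {c E₀ : ℝ} {j : ℕ}

theorem IsPiecewiseContPeriodic.eventually_half_le (hε : IsPiecewiseContPeriodic ε₁)
    (hc : 0 < c) (hεc : ∀ x, c ≤ ε x) :
    ∀ᶠ δ in 𝓝 (0 : ℝ), ∀ x, c / 2 ≤ (ε + δ • ε₁) x := by
  obtain ⟨K, -, hK⟩ := hε.exists_bound
  have h : ∀ᶠ δ in 𝓝 (0 : ℝ), |δ| * |K| < c / 2 := by
    refine ContinuousAt.eventually_lt (by fun_prop) continuousAt_const ?_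
    simpa using hc
  filter_upwards [h] with δ hδ x
  have h1 : |δ * ε₁ x| ≤ |δ| * |K| := by
    rw [abs_mul]
    exact mul_le_mul_of_nonneg_left ((hK x).trans (le_abs_self K)) (abs_nonneg δ)
  have := (abs_le.1 h1).1
  have := hεc x
  simp only [Pi.add_apply, Pi.smul_apply, smul_eq_mul]
  linarith

/-- If the monodromy matrix is the identity, the discriminant is critical in the perturbation
parameter. -/
theorem partialSnd_perturbedDiscriminant (hε : IsPiecewiseContPeriodic ε)
    (hμ : IsPiecewiseContPeriodic μ) (hε₁ : IsPiecewiseContPeriodic ε₁)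
    (hμ₁ : IsPiecewiseContPeriodic μ₁) (hM : transferMatrix ε μ E₀ 1 = 1) :
    partialSnd (fun p => perturbedDiscriminant ε μ ε₁ μ₁ p.1 p.2) (E₀, 0) = 0 := by
  have hm := fun i k => contDiff_transferMatrix hε hμ hε₁ hμ₁ 1 i k
  have hd := fun i k => hasDerivAt_snd (hm i k) E₀ 0
  -- At M = 1 the derivative of the determinant is the trace of the derivative of M.
  have hdet := ((hd 0 0).mul (hd 1 1)).sub ((hd 0 1).mul (hd 1 0))
  have hone : ∀ δ : ℝ, transferMatrix (ε + δ • ε₁) (μ + δ • μ₁) E₀ 1 0 0 *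
      transferMatrix (ε + δ • ε₁) (μ + δ • μ₁) E₀ 1 1 1 -
      transferMatrix (ε + δ • ε₁) (μ + δ • μ₁) E₀ 1 0 1 *
      transferMatrix (ε + δ • ε₁) (μ + δ • μ₁) E₀ 1 1 0 = 1 := fun δ =>
    transferMatrix_det (hε.add (hε₁.const_smul δ)) (hμ.add (hμ₁.const_smul δ)) E₀ 1
  have hzero := hdet.unique ((hasDerivAt_const (0 : ℝ) (1 : ℝ)).congr_of_eventuallyEq
    (Eventually.of_forall hone))
  have htr := ((hd 0 0).add (hd 1 1)).unique
    ((hasDerivAt_snd (contDiff_perturbedDiscriminant hε hμ hε₁ hμ₁) E₀ 0).congr_of_eventuallyEq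
      (Eventually.of_forall fun δ => (discriminant_eq E₀).symm))
  simp only [zero_smul, add_zero, hM, Matrix.one_apply_eq, Matrix.one_apply_ne zero_ne_one,
    Matrix.one_apply_ne one_ne_zero, mul_one, one_mul, mul_zero, zero_mul, sub_zero] at hzero htr
  rw [← htr]
  exact hzero

/-- At a Dirac point with zero quasi-momentum the monodromy matrix is the identity, and
exactly `j` zeros of the discriminant lie below it. -/
theorem IsDiracPoint.spectral_data (hε : IsPiecewiseContPeriodic ε)
    (hμ : IsPiecewiseContPeriodic μ) (hc : 0 < c) (hεc : ∀ x, c ≤ ε x) (hμc : ∀ x, c ≤ μ x)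
    (h : IsDiracPoint ε μ j 0 E₀) :
    discriminant ε μ E₀ = 2 ∧ deriv (discriminant ε μ) E₀ = 0 ∧ transferMatrix ε μ E₀ 1 = 1 ∧
      bandCount (discriminant ε μ) 0 E₀ = j := by
  have hH := isHillDiscriminant hε hμ hc hεc hμc
  have hmult := h.multiplicity
  have hD : discriminant ε μ E₀ = 2 := by
    by_contra hne
    rw [finrank_blochSpace_of_ne hε hμ hc hμc (by simpa using hne)] at hmult
    exact absurd hmult (by norm_num)
  rw [finrank_blochSpace_of_eq hε hμ hc hεc hμc (by simpa using hD)] at hmult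
  have hd : deriv (discriminant ε μ) E₀ = 0 := by
    by_contra hne
    rw [levelMult_of_ne hne] at hmult
    exact absurd hmult (by norm_num)
  have hpos := hH.pos_of_double hD hd
  refine ⟨hD, hd, ?_, ?_⟩
  · rcases (deriv_discriminant_eq_zero_iff hε hμ hc hεc hμc (by rw [hD]; norm_num)).1 hd
      with hM | hM
    · exact hM
    · rw [discriminant_eq, hM] at hD
      norm_num at hD
  obtain ⟨α, hα, r, hr, C, hcone⟩ := h.conical
  simp only [sub_zero, bandFunction_eq hε hμ hc hεc hμc] at hcone
  -- The second condition lets the linear term of the cone dominate; the third keeps the lower band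
  -- positive, away from the value of an empty infimum.
  have hlim : ∀ᶠ k in 𝓝 (0 : ℝ), |k| < r ∧ C * k < α ∧ α * |k| + C * k ^ 2 < E₀ :=
    (ContinuousAt.eventually_lt (by fun_prop) continuousAt_const (by simpa using hr)).and
      ((ContinuousAt.eventually_lt (by fun_prop) continuousAt_const (by simpa using hα)).and
        (ContinuousAt.eventually_lt (by fun_prop) continuousAt_const (by simpa using hpos)))
  have key : ∀ᶠ k in 𝓝[>] (0 : ℝ), levelFunction (discriminant ε μ) j k < E₀ ∧
      levelFunction (discriminant ε μ) j k ≠ 0 ∧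
      E₀ < levelFunction (discriminant ε μ) (j + 1) k := by
    filter_upwards [nhdsWithin_le_nhds hlim, self_mem_nhdsWithin] with k hk hk0
    have hk0 : 0 < k := hk0
    obtain ⟨hkr, hkα, hkE⟩ := hk
    obtain ⟨h1, h2⟩ := hcone k hkr
    rw [abs_of_pos hk0] at h1 h2 hkE
    have h3 : C * k ^ 2 < α * k := by
      have := mul_lt_mul_of_pos_right hkα hk0
      linarith
    have h1' := abs_le.1 h1
    have h2' := abs_le.1 h2
    refine ⟨?_, ne_of_gt ?_, ?_⟩
    · exact (sub_le_iff_le_add.1 h1'.2).trans_lt (by linarith)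
    · exact lt_of_lt_of_le (by linarith) (neg_le_sub_iff_le_add.1 h1'.1 |> sub_le_iff_le_add.2)
    · exact lt_of_lt_of_le (by linarith) (neg_le_sub_iff_le_add.1 h2'.1 |> sub_le_iff_le_add.2)
  exact hH.bandCount_of_cone h.one_le hD (key.mono fun _ h => h.1)
    (key.mono fun _ h => h.2.1) (key.mono fun _ h => h.2.2)

/-- The bands `j` and `j + 1` next to an interval on which the discriminant exceeds two. -/
theorem band_gap (hε : IsPiecewiseContPeriodic ε)
    (hμ : IsPiecewiseContPeriodic μ) (hc : 0 < c) (hεc : ∀ x, c ≤ ε x) (hμc : ∀ x, c ≤ μ x)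
    (hj : 1 ≤ j) {a b b' : ℝ} (hab : a < b) (hbb' : b < b') (ha : discriminant ε μ a = 2)
    (hb : discriminant ε μ b = 2) (hgap : ∀ x ∈ Ioo a b, 2 < discriminant ε μ x)
    (hb' : ∀ x ∈ Ioc b b', discriminant ε μ x < 2)
    (hcount : bandCount (discriminant ε μ) 0 a = j) :
    a = bandFunction ε μ j 0 ∧ b = bandFunction ε μ (j + 1) 0 ∧ IsGreatest (band ε μ j) a ∧
      IsLeast (band ε μ (j + 1)) b ∧ Disjoint (Ioo a b) (blochSpectrum ε μ) := by
  obtain ⟨h1, h2, h3, h4⟩ := (isHillDiscriminant hε hμ hc hεc hμc).levelFunction_gap hj hab hbb'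
    ha hb hgap hb' hcount
  have hbf : ∀ i k, bandFunction ε μ i k = levelFunction (discriminant ε μ) i k :=
    fun i k => bandFunction_eq hε hμ hc hεc hμc i k
  have h0 : (0 : ℝ) ∈ Icc (-Real.pi) Real.pi := ⟨by linarith [Real.pi_pos], Real.pi_pos.le⟩
  refine ⟨by rw [hbf, h1], by rw [hbf, h2], ⟨⟨0, h0, by rw [hbf, h1]⟩, ?_⟩,
    ⟨⟨0, h0, by rw [hbf, h2]⟩, ?_⟩, ?_⟩
  · rintro _ ⟨k, -, rfl⟩
    exact (hbf j k).trans_le (h3 k)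
  · rintro _ ⟨k, -, rfl⟩
    exact (h4 k).trans_eq (hbf _ k).symm
  · exact Set.disjoint_left.2 fun E hE hS => (hgap E hE).not_ge
      (discriminant_eq_of_mem_blochSpectrum hε hμ hc hμc hS)

end

theorem mainTheorem5
    (ε μ ε₁ μ₁ : ℝ → ℝ)
    (hε : IsPiecewiseContPeriodic ε) (hμ : IsPiecewiseContPeriodic μ)
    (hε₁ : IsPiecewiseContPeriodic ε₁) (hμ₁ : IsPiecewiseContPeriodic μ₁)
    (c : ℝ) (hc : 0 < c) (hεc : ∀ x, c ≤ ε x) (hμc : ∀ x, c ≤ μ x)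
    (j : ℕ) (E₀ : ℝ) (hDirac : IsDiracPoint ε μ j 0 E₀)
    (a₁ a₂ a₃ : ℝ)
    (ha₁ : a₁ = iteratedDeriv 2 (fun E => perturbedDiscriminant ε μ ε₁ μ₁ E 0) E₀)
    (ha₂ : a₂ = deriv (fun E => deriv (fun δ => perturbedDiscriminant ε μ ε₁ μ₁ E δ) 0) E₀)
    (ha₃ : a₃ = iteratedDeriv 2 (fun δ => perturbedDiscriminant ε μ ε₁ μ₁ E₀ δ) 0)
    (ha : 0 < a₂ ^ 2 - a₁ * a₃) :
    ∃ δ₀ > 0, ∃ C : ℝ, ∀ δ : ℝ, 0 < δ → δ < δ₀ →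
      ∃ lower upper : ℝ,
        lower = bandFunction (ε + δ • ε₁) (μ + δ • μ₁) j 0 ∧
        upper = bandFunction (ε + δ • ε₁) (μ + δ • μ₁) (j + 1) 0 ∧
        IsGreatest (band (ε + δ • ε₁) (μ + δ • μ₁) j) lower ∧
        IsLeast (band (ε + δ • ε₁) (μ + δ • μ₁) (j + 1)) upper ∧
        lower < upper ∧
        Disjoint (Ioo lower upper) (blochSpectrum (ε + δ • ε₁) (μ + δ • μ₁)) ∧
        |lower - (E₀ + (-a₂ + √(a₂ ^ 2 - a₁ * a₃)) / a₁ * δ)| ≤ C * δ ^ 2 ∧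
        |upper - (E₀ + (-a₂ - √(a₂ ^ 2 - a₁ * a₃)) / a₁ * δ)| ≤ C * δ ^ 2 := by
  obtain ⟨hD2, hD', hM, hcount⟩ := hDirac.spectral_data hε hμ hc hεc hμc
  obtain ⟨F, hFdef⟩ : ∃ F : ℝ × ℝ → ℝ, F = fun p => perturbedDiscriminant ε μ ε₁ μ₁ p.1 p.2 :=
    ⟨_, rfl⟩
  have hFδ : ∀ δ, (fun E => F (E, δ)) = discriminant (ε + δ • ε₁) (μ + δ • μ₁) := fun δ => by
    rw [hFdef]
    rfl
  have hF : ContDiff ℝ ∞ F := hFdef ▸ contDiff_perturbedDiscriminant hε hμ hε₁ hμ₁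
  have hF0 : (fun E => F (E, 0)) = discriminant ε μ := by
    simpa using hFδ 0
  have hH0 := isHillDiscriminant hε hμ hc hεc hμc
  have e₁ : partialFst (partialFst F) (E₀, 0) = a₁ :=
    (iteratedDeriv_two_fst hF E₀ 0).symm.trans (by rw [ha₁, hFdef])
  have e₂ : partialFst (partialSnd F) (E₀, 0) = a₂ :=
    (deriv_deriv_fst_snd hF E₀ 0).symm.trans (by rw [ha₂, hFdef])
  have e₃ : partialSnd (partialSnd F) (E₀, 0) = a₃ :=
    (iteratedDeriv_two_snd hF E₀ 0).symm.trans (by rw [ha₃, hFdef])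
  -- A double energy with D = 2 is a nondegenerate maximum of D in the energy.
  have hneg : a₁ < 0 := by
    rw [← e₁, ← iteratedDeriv_two_fst hF, hF0, iteratedDeriv_succ, iteratedDeriv_one]
    exact hH0.neg_of_two E₀ hD2 hD'
  have hp₁ : partialFst F (E₀, 0) = 0 := by
    rw [← (hasDerivAt_fst hF E₀ 0).deriv, hF0, hD']
  have hp₂ : partialSnd F (E₀, 0) = 0 :=
    hFdef ▸ partialSnd_perturbedDiscriminant hε hμ hε₁ hμ₁ hM
  obtain ⟨r, hr, C, hopen⟩ := exists_gap_of_indefinite hF ((congrFun hF0 E₀).trans hD2) hp₁ hp₂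
    e₁ e₂ e₃ hneg ha
  have hcε := hε₁.eventually_half_le hc hεc
  have hcμ := hμ₁.eventually_half_le hc hμc
  have hper : ∀ δ : ℝ, IsPiecewiseContPeriodic (ε + δ • ε₁) ∧
      IsPiecewiseContPeriodic (μ + δ • μ₁) :=
    fun δ => ⟨hε.add (hε₁.const_smul δ), hμ.add (hμ₁.const_smul δ)⟩
  have hHill : ∀ᶠ δ in 𝓝 (0 : ℝ), IsHillDiscriminant fun E => F (E, δ) := by
    filter_upwards [hcε, hcμ] with δ h1 h2
    rw [hFδ]
    exact isHillDiscriminant (hper δ).1 (hper δ).2 (half_pos hc) h1 h2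
  -- D = 2 ≠ 0 at `E₀`, so the number `j` of zeros below this fixed energy persists for small δ.
  have hcount' := eventually_bandCount_zero_eq (D := fun δ E => F (E, δ)) (E := E₀)
    (hF.comp (contDiff_snd.prodMk contDiff_fst)) hHill
    (by rw [show F (E₀, 0) = 2 from (congrFun hF0 E₀).trans hD2]; norm_num)
  rw [hF0, hcount] at hcount'
  have hall := hopen.and (nhdsWithin_le_nhds (hcε.and (hcμ.and hcount')))
  obtain ⟨δ₀, hδ₀, hsub⟩ := mem_nhdsGT_iff_exists_Ioo_subset.1 hall
  refine ⟨δ₀, hδ₀, C, fun δ hδ hδ' => ?_⟩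
  obtain ⟨⟨a, b, hCa, hCb, hra, hab, hbr, hFa, hFb, hgap, hbeyond, hposD⟩, h1, h2, h3⟩ :=
    hsub ⟨hδ, hδ'⟩
  have hDδ : ∀ E, F (E, δ) = discriminant (ε + δ • ε₁) (μ + δ • μ₁) E := congrFun (hFδ δ)
  rw [hFδ] at h3
  simp only [hDδ] at hFa hFb hgap hbeyond hposD
  -- D is positive between `E₀` and `a`, so moving the endpoint to `a` passes no zero.
  have hEa : bandCount (discriminant (ε + δ • ε₁) (μ + δ • μ₁)) 0 a = j := by
    rw [← h3]
    rcases le_total a E₀ with hle | hle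
    · exact bandCount_congr hle fun x hx => (hposD x ⟨by linarith [hx.1], by linarith [hx.2]⟩).ne'
    · exact (bandCount_congr hle fun x hx =>
        (hposD x ⟨by linarith [hx.1], by linarith [hx.2]⟩).ne').symm
  obtain ⟨g1, g2, g3, g4, g5⟩ := band_gap (hper δ).1 (hper δ).2 (half_pos hc) h1 h2 hDirac.one_le
    hab hbr hFa hFb hgap hbeyond hEa
  exact ⟨a, b, g1, g2, g3, g4, hab, g5, hCa, hCb⟩
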